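/- **Setting.** Let $P:[0,1]\to[0,\infty)$ and $B,D,W,\sigma:[0,1]\to\mathbb R$ be smooth functions such that: * $P(0)=0$ and $P'>0$ on $[0,1]$; * $B+D>0$ on $[0,1]$ and $B-D=-W'$; * $W$ has exactly three critical points $\rho_-<\rho_*<\rho_+$ in $[0,1]$, with $0<\rho_-$ and $\rho_+<1$; moreover $W(\rho_\pm)<W(\rho)$ for all $\rho\ne\rho_-,\rho_+$, and $W''(\rho_\pm)>0$; * $\int_{\rho_-}^{\rho_+}W'(\rho)P'(\rho)\,d\rho=0$; * $\sigma>0$ on $(0,1)$. Let $\bar u:\mathbb R\to[0,1]$ be the smooth solution of $(P(\bar u))''+B(\bar u)-D(\bar u)=0$ on $\mathbb R$ with $\bar u(\pm\infty)=\rho_\pm$ and $\bar u(0)=(\rho_++\rho_-)/2$, and put $\bar v=P(\bar u)$. Let $$L_{\bar u}\psi=[2\sigma(\bar u)\psi']'-[B(\bar u)+D(\bar u)]\psi .$$ As an operator on $L^2(\mathbb R)$, $L_{\bar u}$ is defined weakly: $-L_{\bar u}\psi=w\in L^2(\mathbb R)$ means that $\psi\in H^1(\mathbb R)$ and $\langle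 2\sigma(\bar u)\psi',\varphi'\rangle_{L^2}+\langle [B(\bar u)+D(\bar u)]\psi,\varphi\rangle_{L^2}=\langle w,\varphi\rangle_{L^2}$ for all $\varphi\in H^1(\mathbb R)$. Put $\tilde W(\rho)=\int_{\rho_-}^{\rho}W'(r)P'(r)\,dr$ and $$\theta_1=\int_{\rho_-}^{\rho_+}\sqrt{2\tilde W(\rho)}\,d\rho,\quad \theta_2=\int_{\rho_-}^{\rho_+}P'(\rho)\sqrt{2\tilde W(\rho)}\,d\rho,\quad \nu=\tfrac12\langle\bar v',-L_{\bar u}\bar v'\rangle_{L^2},\quad \mu=\frac{\nu}{\theta_1^2},\quad \theta=\frac{\theta_2}{\theta_1}.$$ Let $T>0$, let $\mathbb T^n=(\mathbb R/\mathbb Z)^n$, and let $d:[0,T]\times\mathbb T^n\to\mathbb R$ be any smooth function (for instance a regularized signed distance from a smoothly evolving hypersurface). For a smooth $\bar Q:[0,T]\times\mathbb T^n\times\mathbb R\to\mathbb R$ define $$F_{\bar Q}(t,x,\xi)=\bar u'(\xi)\,\partial_t d(t,x)-\bar v'(\xi)\,\Delta d(t,x)-2\bar v''(\xi)\,\partial_\xi\bar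 Q(t,x,\xi)-\bar v'(\xi)\,\partial_\xi^2\bar Q(t,x,\xi).$$ **Claim.** The quantities above and below are well defined: $\bar v'>0$; the integrals over $\mathbb R$, $(-\infty,\tilde\xi\,]$ and $[0,\xi]$ that occur converge absolutely; $\theta_1>0$ and $\mu>0$; for every $w\in L^2(\mathbb R)$ the equation $-L_{\bar u}\psi=w$ has exactly one solution $\psi=(-L_{\bar u})^{-1}w$; and $\bar v'$ is in the domain of $L_{\bar u}$, which acts on it by the differential expression. 1. Let $\bar Q$ be a smooth function with $$\sup_{(t,x,\xi)\in[0,T]\times\mathbb T^n\times\mathbb R}\frac{|\bar Q|+|\partial_\xi\bar Q|+|\partial_\xi^2\bar Q|}{1+|\xi|}<\infty. \tag{a}$$ Then for every $(t,x)\in[0,T]\times\mathbb T^n$ the function $F_{\bar Q}(t,x,\cdot)$ is in $L^2(\mathbb R)$, and $$\int_{\mathbb R}F_{\bar Q}(-L_{\bar u})^{-1}F_{\bar Q}\,d\xi\ \ge\ \frac{(\partial_t d-\theta\Delta d)^2}{2\mu}.$$ 2. Define $$\lambda(t,x)=\frac{2\left(\|\bar v'\|_{L^2}^2\,\Delta d(t,x)-\langle\bar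 u',\bar v'\rangle_{L^2}\,\partial_t d(t,x)\right)}{\langle -L_{\bar u}\bar v',\bar v'\rangle_{L^2}},$$ $$\bar Q_{\min}(t,x,\xi)=\int_0^\xi\frac{1}{\bar v'(\tilde\xi)^2}\int_{-\infty}^{\tilde\xi}\left(\bar u'(\hat\xi)\,\partial_t d(t,x)-\bar v'(\hat\xi)\,\Delta d(t,x)-\frac{\lambda(t,x)}2L_{\bar u}\bar v'(\hat\xi)\right)\bar v'(\hat\xi)\,d\hat\xi\,d\tilde\xi .$$ Then $\lambda$ and $\bar Q_{\min}$ are smooth, $\bar Q_{\min}$ satisfies (a), and equality holds in part 1 for $\bar Q=\bar Q_{\min}$ at every $(t,x)$; that is, $\bar Q_{\min}$ is a minimizer. Furthermore $$\sup_{(t,x,\xi)\in[0,T]\times\mathbb T^n\times\mathbb R}\left(\frac{|\partial_t\bar Q_{\min}|}{1+|\xi|}+\sum_{i=0}^2\sum_{j=0}^2\frac{|\partial_\xi^i\nabla^j\bar Q_{\min}|}{1+|\xi|}\right)<\infty,$$ and also $\sup_{(t,x,\xi)}|\partial_\xi^2\bar Q_{\min}|^2/(1+|\xi|)<\infty$.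 -/

import Mathlib

open Set Filter Topology MeasureTheory
open scoped ContDiff

namespace SharpInterface

noncomputable section

/-- The coefficient functions of the model. Only their values on `[0,1]` matter. -/
structure Coefficients where
  P : ℝ → ℝ
  B : ℝ → ℝ
  D : ℝ → ℝ
  W : ℝ → ℝ
  σ : ℝ → ℝ

namespace Coefficients

/-- `P'` as a function on `[0,1]` (one-sided at the end points). -/
def P' (c : Coefficients) : ℝ → ℝ := derivWithin c.P (Icc 0 1)

/-- `W'` as a function on `[0,1]` (one-sided at the end points). -/
def W' (c : Coefficients) : ℝ → ℝ := derivWithin c.W (Icc 0 1)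

/-- The standing assumptions on the coefficients; `ρm`, `ρs`, `ρp` are the three critical
points `ρ₋ < ρ_* < ρ₊` of the double-well potential `W`. -/
structure Admissible (c : Coefficients) (ρm ρs ρp : ℝ) : Prop where
  smooth_P : ContDiffOn ℝ ∞ c.P (Icc 0 1)
  smooth_B : ContDiffOn ℝ ∞ c.B (Icc 0 1)
  smooth_D : ContDiffOn ℝ ∞ c.D (Icc 0 1)
  smooth_W : ContDiffOn ℝ ∞ c.W (Icc 0 1)
  smooth_σ : ContDiffOn ℝ ∞ c.σ (Icc 0 1)
  P_nonneg : ∀ ρ ∈ Icc (0 : ℝ) 1, 0 ≤ c.P ρ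
  P_zero : c.P 0 = 0
  P'_pos : ∀ ρ ∈ Icc (0 : ℝ) 1, 0 < c.P' ρ
  sum_pos : ∀ ρ ∈ Icc (0 : ℝ) 1, 0 < c.B ρ + c.D ρ
  sub_eq : ∀ ρ ∈ Icc (0 : ℝ) 1, c.B ρ - c.D ρ = -c.W' ρ
  order : 0 < ρm ∧ ρm < ρs ∧ ρs < ρp ∧ ρp < 1
  critical : {ρ ∈ Icc (0 : ℝ) 1 | c.W' ρ = 0} = {ρm, ρs, ρp}
  wells : ∀ ρ ∈ Icc (0 : ℝ) 1, ρ ≠ ρm → ρ ≠ ρp → c.W ρm < c.W ρ ∧ c.W ρp < c.W ρ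
  convex_m : 0 < derivWithin c.W' (Icc 0 1) ρm
  convex_p : 0 < derivWithin c.W' (Icc 0 1) ρp
  balance : ∫ ρ in ρm..ρp, c.W' ρ * c.P' ρ = 0
  σ_pos : ∀ ρ ∈ Ioo (0 : ℝ) 1, 0 < c.σ ρ

/-- `v̄ = P(ū)`. -/
def vbar (c : Coefficients) (u : ℝ → ℝ) : ℝ → ℝ := fun ξ => c.P (u ξ)

/-- `u` is a smooth `[0,1]`-valued solution of the transition layer problem
`(P(u))'' + B(u) - D(u) = 0` on `ℝ`, `u(±∞) = ρ±`, `u(0) = (ρ₊ + ρ₋)/2`. -/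
structure IsTransitionLayer (c : Coefficients) (ρm ρp : ℝ) (u : ℝ → ℝ) : Prop where
  smooth : ContDiff ℝ ∞ u
  mem_Icc : ∀ ξ, u ξ ∈ Icc (0 : ℝ) 1
  ode : ∀ ξ, iteratedDeriv 2 (c.vbar u) ξ + c.B (u ξ) - c.D (u ξ) = 0
  tendsto_bot : Tendsto u atBot (𝓝 ρm)
  tendsto_top : Tendsto u atTop (𝓝 ρp)
  at_zero : u 0 = (ρp + ρm) / 2

/-- The differential expression `L_ū ψ = [2σ(ū)ψ']' - [B(ū) + D(ū)]ψ` for smooth `ψ`. -/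
def L (c : Coefficients) (u ψ : ℝ → ℝ) : ℝ → ℝ := fun ξ =>
  deriv (fun η => 2 * c.σ (u η) * deriv ψ η) ξ - (c.B (u ξ) + c.D (u ξ)) * ψ ξ

/-- `W̃(ρ) = ∫_{ρ₋}^ρ W'(r) P'(r) dr`. -/
def Wtilde (c : Coefficients) (ρm ρ : ℝ) : ℝ := ∫ r in ρm..ρ, c.W' r * c.P' r

def θ₁ (c : Coefficients) (ρm ρp : ℝ) : ℝ :=
  ∫ ρ in ρm..ρp, Real.sqrt (2 * c.Wtilde ρm ρ)

def θ₂ (c : Coefficients) (ρm ρp : ℝ) : ℝ :=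
  ∫ ρ in ρm..ρp, c.P' ρ * Real.sqrt (2 * c.Wtilde ρm ρ)

/-- `ν = ⟨v̄', (-L_ū) v̄'⟩ / 2`. -/
def ν (c : Coefficients) (u : ℝ → ℝ) : ℝ :=
  (∫ ξ, deriv (c.vbar u) ξ * -(c.L u (deriv (c.vbar u)) ξ)) / 2

def μ (c : Coefficients) (ρm ρp : ℝ) (u : ℝ → ℝ) : ℝ := c.ν u / c.θ₁ ρm ρp ^ 2

def θ (c : Coefficients) (ρm ρp : ℝ) : ℝ := c.θ₂ ρm ρp / c.θ₁ ρm ρp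

end Coefficients

/-! ### The operator `L_ū` on `L²(ℝ)` and its inverse -/

/-- `ψ` belongs to the Sobolev space `H¹(ℝ)` and `g` is its weak derivative. -/
def IsH1 (ψ g : ℝ → ℝ) : Prop :=
  MemLp ψ 2 volume ∧ MemLp g 2 volume ∧
    ∀ φ : ℝ → ℝ, ContDiff ℝ ∞ φ → HasCompactSupport φ →
      ∫ ξ, ψ ξ * deriv φ ξ = -∫ ξ, g ξ * φ ξ

namespace Coefficients

/-- `ψ` lies in the domain of the self-adjoint operator `L_ū` and `-L_ū ψ = w`, that is,
`ψ ∈ H¹` and `⟨2σ(ū)ψ', φ'⟩ + ⟨[B(ū) + D(ū)]ψ, φ⟩ = ⟨w, φ⟩` for all `φ ∈ H¹`. -/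
def NegLEq (c : Coefficients) (u ψ w : ℝ → ℝ) : Prop :=
  MemLp w 2 volume ∧ ∃ g : ℝ → ℝ, IsH1 ψ g ∧
    ∀ φ h : ℝ → ℝ, IsH1 φ h →
      (∫ ξ, 2 * c.σ (u ξ) * g ξ * h ξ) + (∫ ξ, (c.B (u ξ) + c.D (u ξ)) * ψ ξ * φ ξ)
        = ∫ ξ, w ξ * φ ξ

open Classical in
/-- A representative of `(-L_ū)⁻¹ w` (zero if `w` is not in the range of `-L_ū`). -/
def negLInv (c : Coefficients) (u w : ℝ → ℝ) : ℝ → ℝ :=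
  if h : ∃ ψ : ℝ → ℝ, c.NegLEq u ψ w then h.choose else 0

/-- `∫ F (-L_ū)⁻¹ F dξ`. -/
def quadForm (c : Coefficients) (u F : ℝ → ℝ) : ℝ := ∫ ξ, F ξ * c.negLInv u F ξ

end Coefficients

/-! ### Functions on `[0,T] × 𝕋ⁿ` and `[0,T] × 𝕋ⁿ × ℝ`, `𝕋ⁿ = (ℝ/ℤ)ⁿ`

A function on the torus is a `ℤⁿ`-periodic function on `ℝⁿ`. -/

/-- `f` is a smooth function on `[0,T] × 𝕋ⁿ` (up to the boundary in time). -/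
def SmoothTX {n : ℕ} (T : ℝ) (f : ℝ → EuclideanSpace ℝ (Fin n) → ℝ) : Prop :=
  ContDiffOn ℝ ∞ (fun p : ℝ × EuclideanSpace ℝ (Fin n) => f p.1 p.2) (Icc 0 T ×ˢ univ) ∧
    ∀ t ∈ Icc (0 : ℝ) T, ∀ (x : EuclideanSpace ℝ (Fin n)) (k : Fin n → ℤ),
      f t (x + WithLp.toLp 2 (fun i => (k i : ℝ))) = f t x

/-- `Q` is a smooth function on `[0,T] × 𝕋ⁿ × ℝ` (up to the boundary in time). -/
def SmoothTXR {n : ℕ} (T : ℝ) (Q : ℝ → EuclideanSpace ℝ (Fin n) → ℝ → ℝ) : Prop :=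
  ContDiffOn ℝ ∞ (fun p : ℝ × EuclideanSpace ℝ (Fin n) × ℝ => Q p.1 p.2.1 p.2.2)
      (Icc 0 T ×ˢ univ) ∧
    ∀ t ∈ Icc (0 : ℝ) T, ∀ (x : EuclideanSpace ℝ (Fin n)) (k : Fin n → ℤ) (ξ : ℝ),
      Q t (x + WithLp.toLp 2 (fun i => (k i : ℝ))) ξ = Q t x ξ

/-- `∂_t d(t,x)`, one-sided at `t = 0` and `t = T`. -/
def dt {n : ℕ} (T : ℝ) (d : ℝ → EuclideanSpace ℝ (Fin n) → ℝ)
    (t : ℝ) (x : EuclideanSpace ℝ (Fin n)) : ℝ :=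
  derivWithin (fun s => d s x) (Icc 0 T) t

/-- `Δ d(t,x)`, the Laplacian in `x`. -/
def lap {n : ℕ} (d : ℝ → EuclideanSpace ℝ (Fin n) → ℝ)
    (t : ℝ) (x : EuclideanSpace ℝ (Fin n)) : ℝ :=
  Laplacian.laplacian (d t) x

/-- `Q̄`, `∂_ξ Q̄` and `∂_ξ² Q̄` grow at most linearly in `ξ`, uniformly in `(t,x)`. -/
def LinearGrowth {n : ℕ} (T : ℝ) (Q : ℝ → EuclideanSpace ℝ (Fin n) → ℝ → ℝ) : Prop :=
  ∃ C : ℝ, ∀ t ∈ Icc (0 : ℝ) T, ∀ (x : EuclideanSpace ℝ (Fin n)) (ξ : ℝ),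
    (|Q t x ξ| + |deriv (Q t x) ξ| + |iteratedDeriv 2 (Q t x) ξ|) / (1 + |ξ|) ≤ C

/-- The full growth condition: `∂_t Q` and `∂_ξ^i ∇^j Q`, `0 ≤ i, j ≤ 2`, grow at most linearly
in `ξ`, uniformly in `(t,x)`. -/
def FullLinearGrowth {n : ℕ} (T : ℝ) (Q : ℝ → EuclideanSpace ℝ (Fin n) → ℝ → ℝ) : Prop :=
  ∃ C : ℝ, ∀ t ∈ Icc (0 : ℝ) T, ∀ (x : EuclideanSpace ℝ (Fin n)) (ξ : ℝ),
    |derivWithin (fun s => Q s x ξ) (Icc 0 T) t| / (1 + |ξ|)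
      + ∑ i ∈ Finset.range 3, ∑ j ∈ Finset.range 3,
          ‖iteratedDeriv i (fun η => iteratedFDeriv ℝ j (fun y => Q t y η) x) ξ‖ / (1 + |ξ|)
      ≤ C

namespace Coefficients

/-- `F_Q̄(t,x,ξ) = ū'(ξ) ∂_t d - v̄'(ξ) Δd - 2 v̄''(ξ) ∂_ξ Q̄ - v̄'(ξ) ∂_ξ² Q̄`. -/
def F {n : ℕ} (c : Coefficients) (u : ℝ → ℝ) (T : ℝ)
    (d : ℝ → EuclideanSpace ℝ (Fin n) → ℝ) (Q : ℝ → EuclideanSpace ℝ (Fin n) → ℝ → ℝ)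
    (t : ℝ) (x : EuclideanSpace ℝ (Fin n)) (ξ : ℝ) : ℝ :=
  deriv u ξ * dt T d t x - deriv (c.vbar u) ξ * lap d t x
    - 2 * iteratedDeriv 2 (c.vbar u) ξ * deriv (Q t x) ξ
    - deriv (c.vbar u) ξ * iteratedDeriv 2 (Q t x) ξ

/-- The Lagrange multiplier
`λ(t,x) = 2 (‖v̄'‖² Δd - ⟨ū', v̄'⟩ ∂_t d) / ⟨-L_ū v̄', v̄'⟩`. -/
def lam {n : ℕ} (c : Coefficients) (u : ℝ → ℝ) (T : ℝ)
    (d : ℝ → EuclideanSpace ℝ (Fin n) → ℝ) (t : ℝ) (x : EuclideanSpace ℝ (Fin n)) : ℝ :=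
  2 * ((∫ ξ, deriv (c.vbar u) ξ ^ 2) * lap d t x
      - (∫ ξ, deriv u ξ * deriv (c.vbar u) ξ) * dt T d t x)
    / (∫ ξ, -(c.L u (deriv (c.vbar u)) ξ) * deriv (c.vbar u) ξ)

/-- The inner integrand `(ū' ∂_t d - v̄' Δd - (λ/2) L_ū v̄') v̄'` in the formula for `Q̄_min`. -/
def innerIntegrand {n : ℕ} (c : Coefficients) (u : ℝ → ℝ) (T : ℝ)
    (d : ℝ → EuclideanSpace ℝ (Fin n) → ℝ) (t : ℝ) (x : EuclideanSpace ℝ (Fin n)) (ξ : ℝ) : ℝ :=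
  (deriv u ξ * dt T d t x - deriv (c.vbar u) ξ * lap d t x
    - c.lam u T d t x / 2 * c.L u (deriv (c.vbar u)) ξ) * deriv (c.vbar u) ξ

/-- The outer integrand in the formula for `Q̄_min`. -/
def outerIntegrand {n : ℕ} (c : Coefficients) (u : ℝ → ℝ) (T : ℝ)
    (d : ℝ → EuclideanSpace ℝ (Fin n) → ℝ) (t : ℝ) (x : EuclideanSpace ℝ (Fin n)) (ξ : ℝ) : ℝ :=
  1 / deriv (c.vbar u) ξ ^ 2 * ∫ η in Iic ξ, c.innerIntegrand u T d t x η

/-- The explicit corrector `Q̄_min`. -/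
def Qmin {n : ℕ} (c : Coefficients) (u : ℝ → ℝ) (T : ℝ)
    (d : ℝ → EuclideanSpace ℝ (Fin n) → ℝ) (t : ℝ) (x : EuclideanSpace ℝ (Fin n)) (ξ : ℝ) : ℝ :=
  ∫ η in (0 : ℝ)..ξ, c.outerIntegrand u T d t x η

end Coefficients

end

end SharpInterface

/-!
# Optimal correctors for a sharp interface limit

Write `p = v̄'` for the slope of the layer, `a = ∂_t d`, `b = Δd`, and
`S = ⟨ū', v̄'⟩`, `A = ‖v̄'‖²`, `N = ⟨-L_ū v̄', v̄'⟩`.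

*The lower bound.* A corrector enters `F_Q` only through
`2 p' ∂_ξQ + p ∂_ξ²Q = p⁻¹ ∂_ξ(p² ∂_ξQ)`, which is orthogonal to `p` because `p` decays
(`IsProfile.corrector_orthogonal`). Hence
`⟨F_Q, p⟩ = S a - A b` for every `Q`, and Cauchy–Schwarz for the energy form of `-L_ū`, tested
with `p`, gives `⟨F_Q, (-L_ū)⁻¹ F_Q⟩ ≥ (S a - A b)² / N`
(`Coefficients.IsTransitionLayer.sq_div_energy_le_quadForm`). The layer equation has the first
integral `v̄'² = 2 W̃(ū)`, so that the change of variables `ρ = ū(ξ)` yields `θ₁ = S` and `θ₂ = A`,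
and the bound is the one claimed (`Coefficients.IsTransitionLayer.bound_eq`).

*The minimizer.* Equality in Cauchy–Schwarz means that `F_Q` is the multiple `(λ/2) L_ū p` of
`L_ū p`, which is a first order equation for `p² ∂_ξQ`. It is solved by
`∂_ξQ = p⁻² ∫_{-∞}^ξ (a ū' - b v̄' - (λ/2) L_ū p) p`, where `λ` makes the total integral of the
integrand vanish. The problem separates into `Q̄_min = a q₁ - b q₂` with functions `q₁, q₂`
of `ξ` alone
(`Coefficients.IsTransitionLayer.exists_Qmin_eq`), so its smoothness and growth follow from those of
`q₁, q₂` and from the boundedness of the derivatives of `d` on the compact set `[0,T] × 𝕋ⁿ`.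

*Estimates for the layer.* The potential `W̃` is positive away from the wells and vanishes there
exactly quadratically. With the first integral and Grönwall's inequality this shows that `ū`
stays strictly between the wells and increases, and that `p` is comparable to `v̄ - P(ρ₋)` on the
left and to `P(ρ₊) - v̄` on the right. The consequences are
collected in `Coefficients.IsTransitionLayer.isProfile`: `p` decays, `|p'| ≤ C p`, and the tail integrals of `p²`
are bounded by multiples of `p²`. Since `ū'` and `L_ū p` are also bounded by multiples of `p`, the
tail estimates make `∂_ξ q₁, ∂_ξ q₂` bounded, the right tail
being treated by means of the vanishing total integral.

*The inverse of `-L_ū`.* Along the layer the coefficients of `L_ū` are bounded above and below by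
positive constants, so `H¹(ℝ)` with the energy form is, up to weights, a closed subspace of
`L² × L²`, and solving the weak equation amounts to an orthogonal projection
(`exists_weak_solution`).
-/

namespace SharpInterface

/-! ### Square integrable functions and the Sobolev space `H¹(ℝ)` -/

theorem memLp_two_of_abs_le {f g : ℝ → ℝ} {C : ℝ} (hg : MemLp g 2 volume)
    (hf : AEStronglyMeasurable f volume) (h : ∀ ξ, |f ξ| ≤ C * |g ξ|) : MemLp f 2 volume :=
  MemLp.of_le_mul hg hf (Eventually.of_forall h)

theorem memLp_two_bounded_mul {f k : ℝ → ℝ} {C : ℝ} (hk : Continuous k) (h : ∀ ξ, |k ξ| ≤ C)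
    (hf : MemLp f 2 volume) : MemLp (fun ξ => k ξ * f ξ) 2 volume :=
  memLp_two_of_abs_le (C := C) hf (hk.aestronglyMeasurable.mul hf.aestronglyMeasurable) fun ξ => by
    rw [abs_mul]; exact mul_le_mul_of_nonneg_right (h ξ) (abs_nonneg _)

theorem integrable_mul_of_memLp_two {f g : ℝ → ℝ} (hf : MemLp f 2 volume)
    (hg : MemLp g 2 volume) : Integrable (fun ξ => f ξ * g ξ) :=
  MemLp.integrable_mul hf hg

theorem inner_toLp_eq_integral {f g : ℝ → ℝ} (hf : MemLp f 2 volume) (hg : MemLp g 2 volume) :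
    inner ℝ (hf.toLp f) (hg.toLp g) = ∫ ξ, f ξ * g ξ := by
  rw [L2.inner_def]
  refine integral_congr_ae ?_
  filter_upwards [hf.coeFn_toLp, hg.coeFn_toLp] with ξ h1 h2
  rw [h1, h2]; simp [mul_comm]

theorem IsH1.sub_smul {ψ g φ h : ℝ → ℝ} (h1 : IsH1 ψ g) (h2 : IsH1 φ h) (τ : ℝ) :
    IsH1 (fun ξ => ψ ξ - τ * φ ξ) (fun ξ => g ξ - τ * h ξ) := by
  refine ⟨h1.1.sub (h2.1.const_mul τ), h1.2.1.sub (h2.2.1.const_mul τ), fun χ hχ hs => ?_⟩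
  have m1 : MemLp χ 2 volume := hχ.continuous.memLp_of_hasCompactSupport hs
  have m2 : MemLp (deriv χ) 2 volume :=
    (hχ.continuous_deriv (by simp)).memLp_of_hasCompactSupport hs.deriv
  have e1 : ∀ ξ, (ψ ξ - τ * φ ξ) * deriv χ ξ = ψ ξ * deriv χ ξ - τ * (φ ξ * deriv χ ξ) := by
    intro ξ; ring
  have e2 : ∀ ξ, (g ξ - τ * h ξ) * χ ξ = g ξ * χ ξ - τ * (h ξ * χ ξ) := by
    intro ξ; ring
  simp_rw [e1, e2]
  rw [integral_sub (integrable_mul_of_memLp_two h1.1 m2)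
      ((integrable_mul_of_memLp_two h2.1 m2).const_mul τ),
    integral_sub (integrable_mul_of_memLp_two h1.2.1 m1)
      ((integrable_mul_of_memLp_two h2.2.1 m1).const_mul τ),
    integral_const_mul, integral_const_mul, h1.2.2 χ hχ hs, h2.2.2 χ hχ hs]
  ring

/-- Smooth cutoffs `χ_k → 1` that are uniformly bounded together with their derivatives, the
derivatives tending to zero. -/
theorem exists_cutoff_sequence : ∃ χ : ℕ → ℝ → ℝ, ∃ C : ℝ,
    (∀ k, ContDiff ℝ ∞ (χ k)) ∧ (∀ k, HasCompactSupport (χ k)) ∧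
    (∀ k ξ, |χ k ξ| ≤ C) ∧ (∀ k ξ, |deriv (χ k) ξ| ≤ C) ∧
    (∀ ξ, Tendsto (fun k => χ k ξ) atTop (𝓝 1)) ∧
    (∀ ξ, Tendsto (fun k => deriv (χ k) ξ) atTop (𝓝 0)) := by
  let b : ContDiffBump (0 : ℝ) := ⟨1, 2, one_pos, one_lt_two⟩
  have hb : ContDiff ℝ ∞ (b : ℝ → ℝ) := b.contDiff
  have hb' : Continuous (deriv (b : ℝ → ℝ)) := hb.continuous_deriv (by simp)
  obtain ⟨C, hC⟩ := b.hasCompactSupport.deriv.exists_bound_of_continuous hb'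
  have hC0 : 0 ≤ C := (norm_nonneg _).trans (hC 0)
  have hpos : ∀ k : ℕ, (0 : ℝ) < ((k : ℝ) + 1)⁻¹ := fun k => by positivity
  have hder : ∀ (k : ℕ) (ξ : ℝ), deriv (fun η => b (((k : ℝ) + 1)⁻¹ * η)) ξ
      = ((k : ℝ) + 1)⁻¹ * deriv (b : ℝ → ℝ) (((k : ℝ) + 1)⁻¹ * ξ) := by
    intro k ξ
    have h1 : HasDerivAt (fun η : ℝ => ((k : ℝ) + 1)⁻¹ * η) (((k : ℝ) + 1)⁻¹) ξ := by
      simpa using (hasDerivAt_id ξ).const_mul (((k : ℝ) + 1)⁻¹)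
    have h2 := ((hb.differentiable (by simp)) (((k : ℝ) + 1)⁻¹ * ξ)).hasDerivAt.comp ξ h1
    rw [mul_comm]
    exact h2.deriv
  have hlim : Tendsto (fun k : ℕ => ((k : ℝ) + 1)⁻¹) atTop (𝓝 0) := by
    simpa using tendsto_one_div_add_atTop_nhds_zero_nat (𝕜 := ℝ)
  refine ⟨fun k ξ => b (((k : ℝ) + 1)⁻¹ * ξ), 1 + C, fun k => ?_, fun k => ?_, fun k ξ => ?_,
    fun k ξ => ?_, fun ξ => ?_, fun ξ => ?_⟩
  · exact hb.comp (contDiff_const.mul contDiff_id)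
  · exact b.hasCompactSupport.comp_homeomorph (Homeomorph.mulLeft₀ _ (hpos k).ne')
  · rw [abs_of_nonneg b.nonneg]
    linarith [b.le_one (x := ((k : ℝ) + 1)⁻¹ * ξ)]
  · rw [hder, abs_mul, abs_of_pos (hpos k)]
    have h1 : ((k : ℝ) + 1)⁻¹ ≤ 1 := inv_le_one_of_one_le₀ (by linarith [k.cast_nonneg (α := ℝ)])
    have h2 := hC (((k : ℝ) + 1)⁻¹ * ξ)
    rw [Real.norm_eq_abs] at h2
    nlinarith [abs_nonneg (deriv (b : ℝ → ℝ) (((k : ℝ) + 1)⁻¹ * ξ)), hpos k]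
  · have h0 : Tendsto (fun k : ℕ => ((k : ℝ) + 1)⁻¹ * ξ) atTop (𝓝 0) := by
      simpa using hlim.mul_const ξ
    have h1 := (hb.continuous.tendsto 0).comp h0
    have h2 : b 0 = 1 := b.one_of_mem_closedBall (by simp [b])
    rw [h2] at h1
    exact h1
  · simp_rw [hder]
    refine squeeze_zero_norm (a := fun k : ℕ => ((k : ℝ) + 1)⁻¹ * C) (fun k => ?_) ?_
    · rw [norm_mul, Real.norm_of_nonneg (hpos k).le]
      exact mul_le_mul_of_nonneg_left (hC _) (hpos k).le
    · simpa using hlim.mul_const C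

/-- Compactly supported test functions in the definition of the weak derivative may be replaced
by smooth functions of class `H¹`. -/
theorem IsH1.integral_mul_deriv {φ h f : ℝ → ℝ} (hφ : IsH1 φ h) (hf : ContDiff ℝ ∞ f)
    (hf0 : MemLp f 2 volume) (hf1 : MemLp (deriv f) 2 volume) :
    ∫ ξ, φ ξ * deriv f ξ = -∫ ξ, h ξ * f ξ := by
  obtain ⟨χ, C, hχ, hs, hb, hb', hl, hl'⟩ := exists_cutoff_sequence
  have hfd : Differentiable ℝ f := hf.differentiable (by simp)
  have hder : ∀ k ξ, deriv (fun η => χ k η * f η) ξ = deriv (χ k) ξ * f ξ + χ k ξ * deriv f ξ :=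
    fun k ξ => deriv_fun_mul ((hχ k).differentiable (by simp) ξ) (hfd ξ)
  have key : ∀ k, ∫ ξ, φ ξ * (deriv (χ k) ξ * f ξ + χ k ξ * deriv f ξ)
      = -∫ ξ, h ξ * (χ k ξ * f ξ) := by
    intro k
    have := hφ.2.2 (fun η => χ k η * f η) ((hχ k).mul hf) ((hs k).mul_right)
    simpa only [hder] using this
  have hmf := hf.continuous.aestronglyMeasurable (μ := (volume : Measure ℝ))
  have hmf' := (hf.continuous_deriv (by simp)).aestronglyMeasurable (μ := (volume : Measure ℝ))
  have hmχ := fun k => (hχ k).continuous.aestronglyMeasurable (μ := (volume : Measure ℝ))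
  have hmχ' := fun k =>
    ((hχ k).continuous_deriv (by simp)).aestronglyMeasurable (μ := (volume : Measure ℝ))
  have i1 := (integrable_mul_of_memLp_two hφ.1 hf0).abs
  have i2 := (integrable_mul_of_memLp_two hφ.1 hf1).abs
  have i3 := (integrable_mul_of_memLp_two hφ.2.1 hf0).abs
  have t1 : Tendsto (fun k => ∫ ξ, φ ξ * (deriv (χ k) ξ * f ξ + χ k ξ * deriv f ξ)) atTop
      (𝓝 (∫ ξ, φ ξ * deriv f ξ)) := by
    refine tendsto_integral_of_dominated_convergence
      (fun ξ => C * |φ ξ * f ξ| + C * |φ ξ * deriv f ξ|)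
      (fun k => hφ.1.aestronglyMeasurable.mul (((hmχ' k).mul hmf).add ((hmχ k).mul hmf')))
      ((i1.const_mul C).add (i2.const_mul C))
      (fun k => Eventually.of_forall fun ξ => ?_) (Eventually.of_forall fun ξ => ?_)
    · have e : φ ξ * (deriv (χ k) ξ * f ξ + χ k ξ * deriv f ξ)
          = deriv (χ k) ξ * (φ ξ * f ξ) + χ k ξ * (φ ξ * deriv f ξ) := by ring
      rw [e]
      refine (norm_add_le _ _).trans ?_
      rw [norm_mul (deriv (χ k) ξ), norm_mul (χ k ξ)]
      exact add_le_add (mul_le_mul_of_nonneg_right (hb' k ξ) (norm_nonneg _))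
        (mul_le_mul_of_nonneg_right (hb k ξ) (norm_nonneg _))
    · simpa using ((((hl' ξ).mul_const (f ξ)).add ((hl ξ).mul_const (deriv f ξ))).const_mul (φ ξ))
  have t2 : Tendsto (fun k => -∫ ξ, h ξ * (χ k ξ * f ξ)) atTop (𝓝 (-∫ ξ, h ξ * f ξ)) := by
    refine (tendsto_integral_of_dominated_convergence (fun ξ => C * |h ξ * f ξ|)
      (fun k => hφ.2.1.aestronglyMeasurable.mul ((hmχ k).mul hmf)) (i3.const_mul C)
      (fun k => Eventually.of_forall fun ξ => ?_) (Eventually.of_forall fun ξ => ?_)).neg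
    · have e : h ξ * (χ k ξ * f ξ) = χ k ξ * (h ξ * f ξ) := by ring
      change ‖h ξ * (χ k ξ * f ξ)‖ ≤ _
      rw [e, norm_mul (χ k ξ)]
      exact mul_le_mul_of_nonneg_right (hb k ξ) (norm_nonneg _)
    · simpa using ((hl ξ).mul_const (f ξ)).const_mul (h ξ)
  simp_rw [key] at t1
  exact tendsto_nhds_unique t1 t2

/-- A smooth function that is square integrable together with its derivative is in `H¹`. -/
theorem isH1_of_contDiff {f : ℝ → ℝ} (hf : ContDiff ℝ ∞ f) (hf0 : MemLp f 2 volume)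
    (hf1 : MemLp (deriv f) 2 volume) : IsH1 f (deriv f) := by
  refine ⟨hf0, hf1, fun φ hφ hs => ?_⟩
  have m1 : MemLp φ 2 volume := hφ.continuous.memLp_of_hasCompactSupport hs
  have m2 : MemLp (deriv φ) 2 volume :=
    (hφ.continuous_deriv (by simp)).memLp_of_hasCompactSupport hs.deriv
  exact integral_mul_deriv_eq_deriv_mul_of_integrable
    (fun ξ _ => (hf.differentiable (by simp) ξ).hasDerivAt)
    (fun ξ _ => (hφ.differentiable (by simp) ξ).hasDerivAt)
    (integrable_mul_of_memLp_two hf0 m2) (integrable_mul_of_memLp_two hf1 m1)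
    (integrable_mul_of_memLp_two hf0 m1)

/-- Solvability of `-(s ψ')' + b ψ = w` in `H¹(ℝ)`. In the coordinates
`(√b ψ, √s ψ')` the space `H¹` becomes a closed subspace of `L² × L²`, on which the energy form is
the inner product; the solution is the orthogonal projection of `(w / √b, 0)`. -/
theorem exists_weak_solution {s b w : ℝ → ℝ} {m M : ℝ} (hm : 0 < m) (hs : Continuous s)
    (hb : Continuous b) (hsm : ∀ ξ, m ≤ s ξ) (hsM : ∀ ξ, s ξ ≤ M) (hbm : ∀ ξ, m ≤ b ξ)
    (hbM : ∀ ξ, b ξ ≤ M) (hw : MemLp w 2 volume) :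
    ∃ ψ g : ℝ → ℝ, IsH1 ψ g ∧ ∀ φ h : ℝ → ℝ, IsH1 φ h →
      (∫ ξ, s ξ * g ξ * h ξ) + (∫ ξ, b ξ * ψ ξ * φ ξ) = ∫ ξ, w ξ * φ ξ := by
  have hs0 : ∀ ξ, 0 < s ξ := fun ξ => hm.trans_le (hsm ξ)
  have hb0 : ∀ ξ, 0 < b ξ := fun ξ => hm.trans_le (hbm ξ)
  have mulsq : ∀ {k f : ℝ → ℝ}, Continuous k → (∀ ξ, k ξ ≤ M) → MemLp f 2 volume →
      MemLp (fun ξ => √(k ξ) * f ξ) 2 volume := fun {k f} hk hkM hf =>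
    memLp_two_bounded_mul (C := √M) (Real.continuous_sqrt.comp hk)
      (fun ξ => by rw [abs_of_nonneg (Real.sqrt_nonneg _)]; exact Real.sqrt_le_sqrt (hkM ξ)) hf
  have divsq : ∀ {k f : ℝ → ℝ}, Continuous k → (∀ ξ, m ≤ k ξ) → MemLp f 2 volume →
      MemLp (fun ξ => (√(k ξ))⁻¹ * f ξ) 2 volume := by
    intro k f hk hkm hf
    refine memLp_two_bounded_mul (C := (√m)⁻¹) ((Real.continuous_sqrt.comp hk).inv₀ fun ξ =>
      (Real.sqrt_pos.2 (hm.trans_le (hkm ξ))).ne') (fun ξ => ?_) hf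
    rw [abs_of_nonneg (inv_nonneg.2 (Real.sqrt_nonneg _))]
    exact inv_anti₀ (Real.sqrt_pos.2 hm) (Real.sqrt_le_sqrt (hkm ξ))
  have test0 : ∀ φ : ℝ → ℝ, ContDiff ℝ ∞ φ → HasCompactSupport φ → MemLp φ 2 volume :=
    fun φ hφ hc => hφ.continuous.memLp_of_hasCompactSupport hc
  have test1 : ∀ φ : ℝ → ℝ, ContDiff ℝ ∞ φ → HasCompactSupport φ → MemLp (deriv φ) 2 volume :=
    fun φ hφ hc => (hφ.continuous_deriv (by simp)).memLp_of_hasCompactSupport hc.deriv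
  let S : Set (WithLp 2 (Lp ℝ 2 (volume : Measure ℝ) × Lp ℝ 2 (volume : Measure ℝ))) :=
    {z | ∃ (φ : ℝ → ℝ) (hφ : ContDiff ℝ ∞ φ) (hc : HasCompactSupport φ),
      z = WithLp.toLp 2 ((divsq hb hbm (test1 φ hφ hc)).toLp _,
        (divsq hs hsm (test0 φ hφ hc)).toLp _)}
  let K := (Submodule.span ℝ S)ᗮ
  have memK : ∀ z, z ∈ K ↔ ∀ y ∈ S, inner ℝ y z = 0 := by
    intro z
    refine ⟨fun h y hy => (Submodule.mem_orthogonal _ _).1 h y (Submodule.subset_span hy),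
      fun h => (Submodule.mem_orthogonal _ _).2 fun y hy => ?_⟩
    induction hy using Submodule.span_induction with
    | mem y hy => exact h y hy
    | zero => simp
    | add x y _ _ hx hy => rw [inner_add_left, hx, hy, add_zero]
    | smul a x _ hx => rw [inner_smul_left, hx, mul_zero]
  -- a pair `(α, β)` lies in `K` exactly when `β / √s` is the weak derivative of `α / √b`
  have memK' : ∀ {α β : ℝ → ℝ} (hα : MemLp α 2 volume) (hβ : MemLp β 2 volume),
      WithLp.toLp 2 (hα.toLp α, hβ.toLp β) ∈ K ↔
        ∀ φ : ℝ → ℝ, ContDiff ℝ ∞ φ → HasCompactSupport φ →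
          ∫ ξ, (√(b ξ))⁻¹ * α ξ * deriv φ ξ = -∫ ξ, (√(s ξ))⁻¹ * β ξ * φ ξ := by
    intro α β hα hβ
    rw [memK]
    have e : ∀ (φ : ℝ → ℝ) (hφ : ContDiff ℝ ∞ φ) (hc : HasCompactSupport φ),
        inner ℝ (WithLp.toLp 2 ((divsq hb hbm (test1 φ hφ hc)).toLp _,
          (divsq hs hsm (test0 φ hφ hc)).toLp _)) (WithLp.toLp 2 (hα.toLp α, hβ.toLp β))
        = (∫ ξ, (√(b ξ))⁻¹ * α ξ * deriv φ ξ) + ∫ ξ, (√(s ξ))⁻¹ * β ξ * φ ξ := by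
      intro φ hφ hc
      rw [WithLp.prod_inner_apply]
      simp only [inner_toLp_eq_integral]
      congr 1 <;> refine integral_congr_ae (Eventually.of_forall fun ξ => ?_) <;> simp only <;> ring
    constructor
    · intro h φ hφ hc
      have := h _ ⟨φ, hφ, hc, rfl⟩
      rw [e φ hφ hc] at this
      linarith
    · rintro h _ ⟨φ, hφ, hc, rfl⟩
      rw [e φ hφ hc, h φ hφ hc]; ring
  have toK : ∀ {φ h : ℝ → ℝ} (H : IsH1 φ h),
      WithLp.toLp 2 ((mulsq hb hbM H.1).toLp _, (mulsq hs hsM H.2.1).toLp _) ∈ K := by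
    intro φ h H
    rw [memK']
    intro χ hχ hc
    have e1 : ∀ ξ, (√(b ξ))⁻¹ * (√(b ξ) * φ ξ) = φ ξ := fun ξ => by
      rw [inv_mul_cancel_left₀ (Real.sqrt_pos.2 (hb0 ξ)).ne']
    have e2 : ∀ ξ, (√(s ξ))⁻¹ * (√(s ξ) * h ξ) = h ξ := fun ξ => by
      rw [inv_mul_cancel_left₀ (Real.sqrt_pos.2 (hs0 ξ)).ne']
    simp_rw [e1, e2]
    exact H.2.2 χ hχ hc
  let y : WithLp 2 (Lp ℝ 2 (volume : Measure ℝ) × Lp ℝ 2 (volume : Measure ℝ)) :=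
    WithLp.toLp 2 ((divsq hb hbm hw).toLp _, 0)
  let z := K.starProjection y
  have hzK : z ∈ K := Submodule.starProjection_apply_mem K y
  have hα : MemLp z.fst 2 volume := Lp.memLp z.fst
  have hβ : MemLp z.snd 2 volume := Lp.memLp z.snd
  have hz : z = WithLp.toLp 2 (hα.toLp _, hβ.toLp _) := by
    rw [Lp.toLp_coeFn, Lp.toLp_coeFn]
    rfl
  refine ⟨fun ξ => (√(b ξ))⁻¹ * z.fst ξ, fun ξ => (√(s ξ))⁻¹ * z.snd ξ,
    ⟨divsq hb hbm hα, divsq hs hsm hβ, ?_⟩, fun φ h H => ?_⟩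
  · rw [hz, memK'] at hzK
    exact hzK
  · have h1 := Submodule.starProjection_inner_eq_zero y _ (toK H)
    rw [inner_sub_left, sub_eq_zero] at h1
    change _ = inner ℝ z _ at h1
    rw [hz, WithLp.prod_inner_apply, WithLp.prod_inner_apply] at h1
    simp only [y, inner_toLp_eq_integral, inner_zero_left, add_zero] at h1
    have e1 : ∀ ξ, s ξ * ((√(s ξ))⁻¹ * z.snd ξ) * h ξ = z.snd ξ * (√(s ξ) * h ξ) := fun ξ => by
      have h0 := (Real.sqrt_pos.2 (hs0 ξ)).ne'
      field_simp
      rw [Real.sq_sqrt (hs0 ξ).le]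
    have e2 : ∀ ξ, b ξ * ((√(b ξ))⁻¹ * z.fst ξ) * φ ξ = z.fst ξ * (√(b ξ) * φ ξ) := fun ξ => by
      have h0 := (Real.sqrt_pos.2 (hb0 ξ)).ne'
      field_simp
      rw [Real.sq_sqrt (hb0 ξ).le]
    have e3 : ∀ ξ, (√(b ξ))⁻¹ * w ξ * (√(b ξ) * φ ξ) = w ξ * φ ξ := fun ξ => by
      have h0 := (Real.sqrt_pos.2 (hb0 ξ)).ne'
      field_simp
    simp_rw [e1, e2]
    simp_rw [e3] at h1
    rw [h1, add_comm]

/-- Cauchy–Schwarz for the energy form, in the form of the nonnegativity of the energy of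
`ψ - τ φ`, where `-(s ψ')' + b ψ = w` and `-(s φ')' + b φ = r`. -/
theorem energy_sub_smul {s b ψ g w φ h r : ℝ → ℝ} {M : ℝ} (hs : Continuous s)
    (hb : Continuous b) (hs0 : ∀ ξ, 0 < s ξ) (hsM : ∀ ξ, s ξ ≤ M) (hb0 : ∀ ξ, 0 < b ξ)
    (hbM : ∀ ξ, b ξ ≤ M) (h1 : IsH1 ψ g) (h2 : IsH1 φ h)
    (hw : MemLp w 2 volume) (hr : MemLp r 2 volume)
    (e1 : ∀ φ h : ℝ → ℝ, IsH1 φ h →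
      (∫ ξ, s ξ * g ξ * h ξ) + (∫ ξ, b ξ * ψ ξ * φ ξ) = ∫ ξ, w ξ * φ ξ)
    (e2 : ∀ φ' h' : ℝ → ℝ, IsH1 φ' h' →
      (∫ ξ, s ξ * h ξ * h' ξ) + (∫ ξ, b ξ * φ ξ * φ' ξ) = ∫ ξ, r ξ * φ' ξ) (τ : ℝ) :
    (∫ ξ, s ξ * (g ξ - τ * h ξ) ^ 2) + (∫ ξ, b ξ * (ψ ξ - τ * φ ξ) ^ 2)
      = (∫ ξ, w ξ * ψ ξ) - 2 * τ * (∫ ξ, w ξ * φ ξ) + τ ^ 2 * ∫ ξ, r ξ * φ ξ := by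
  have H := h1.sub_smul h2 τ
  have a1 := e1 _ _ H
  have a2 := e2 _ _ H
  have sg := memLp_two_bounded_mul hs (fun ξ => (abs_of_pos (hs0 ξ)).trans_le (hsM ξ)) h1.2.1
  have sh := memLp_two_bounded_mul hs (fun ξ => (abs_of_pos (hs0 ξ)).trans_le (hsM ξ)) h2.2.1
  have bp := memLp_two_bounded_mul hb (fun ξ => (abs_of_pos (hb0 ξ)).trans_le (hbM ξ)) h1.1
  have bf := memLp_two_bounded_mul hb (fun ξ => (abs_of_pos (hb0 ξ)).trans_le (hbM ξ)) h2.1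
  have c1 : (∫ ξ, s ξ * (g ξ - τ * h ξ) ^ 2) = (∫ ξ, s ξ * g ξ * (g ξ - τ * h ξ))
      - τ * ∫ ξ, s ξ * h ξ * (g ξ - τ * h ξ) := by
    rw [← integral_const_mul, ← integral_sub (integrable_mul_of_memLp_two sg H.2.1)
      ((integrable_mul_of_memLp_two sh H.2.1).const_mul τ)]
    refine integral_congr_ae (Eventually.of_forall fun ξ => ?_); simp only; ring
  have c2 : (∫ ξ, b ξ * (ψ ξ - τ * φ ξ) ^ 2) = (∫ ξ, b ξ * ψ ξ * (ψ ξ - τ * φ ξ))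
      - τ * ∫ ξ, b ξ * φ ξ * (ψ ξ - τ * φ ξ) := by
    rw [← integral_const_mul, ← integral_sub (integrable_mul_of_memLp_two bp H.1)
      ((integrable_mul_of_memLp_two bf H.1).const_mul τ)]
    refine integral_congr_ae (Eventually.of_forall fun ξ => ?_); simp only; ring
  have d1 : (∫ ξ, w ξ * (ψ ξ - τ * φ ξ)) = (∫ ξ, w ξ * ψ ξ) - τ * ∫ ξ, w ξ * φ ξ := by
    rw [← integral_const_mul, ← integral_sub (integrable_mul_of_memLp_two hw h1.1)
      ((integrable_mul_of_memLp_two hw h2.1).const_mul τ)]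
    refine integral_congr_ae (Eventually.of_forall fun ξ => ?_); simp only; ring
  have d2 : (∫ ξ, r ξ * (ψ ξ - τ * φ ξ)) = (∫ ξ, r ξ * ψ ξ) - τ * ∫ ξ, r ξ * φ ξ := by
    rw [← integral_const_mul, ← integral_sub (integrable_mul_of_memLp_two hr h1.1)
      ((integrable_mul_of_memLp_two hr h2.1).const_mul τ)]
    refine integral_congr_ae (Eventually.of_forall fun ξ => ?_); simp only; ring
  -- the energy form is symmetric
  have sym : (∫ ξ, w ξ * φ ξ) = ∫ ξ, r ξ * ψ ξ := by
    rw [← e1 _ _ h2, ← e2 _ _ h1]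
    congr 1 <;> refine integral_congr_ae (Eventually.of_forall fun ξ => ?_) <;> simp only <;> ring
  rw [c1, c2]
  rw [d1] at a1
  rw [d2, ← sym] at a2
  linear_combination a1 - τ * a2

/-- `H¹` solutions of `-(s ψ')' + b ψ = w` are unique. -/
theorem weak_solution_unique {s b ψ g w φ h : ℝ → ℝ} {M : ℝ} (hs : Continuous s)
    (hb : Continuous b) (hs0 : ∀ ξ, 0 < s ξ) (hsM : ∀ ξ, s ξ ≤ M) (hb0 : ∀ ξ, 0 < b ξ)
    (hbM : ∀ ξ, b ξ ≤ M) (h1 : IsH1 ψ g) (h2 : IsH1 φ h) (hw : MemLp w 2 volume)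
    (e1 : ∀ φ h : ℝ → ℝ, IsH1 φ h →
      (∫ ξ, s ξ * g ξ * h ξ) + (∫ ξ, b ξ * ψ ξ * φ ξ) = ∫ ξ, w ξ * φ ξ)
    (e2 : ∀ φ' h' : ℝ → ℝ, IsH1 φ' h' →
      (∫ ξ, s ξ * h ξ * h' ξ) + (∫ ξ, b ξ * φ ξ * φ' ξ) = ∫ ξ, w ξ * φ' ξ) :
    ψ =ᵐ[volume] φ := by
  have E := energy_sub_smul hs hb hs0 hsM hb0 hbM h1 h2 hw hw e1 e2 1
  have sym : (∫ ξ, w ξ * φ ξ) = ∫ ξ, w ξ * ψ ξ := by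
    rw [← e1 _ _ h2, ← e2 _ _ h1]
    congr 1 <;> refine integral_congr_ae (Eventually.of_forall fun ξ => ?_) <;> simp only <;> ring
  have H := h1.sub_smul h2 1
  have n1 : 0 ≤ ∫ ξ, s ξ * (g ξ - 1 * h ξ) ^ 2 :=
    integral_nonneg fun ξ => mul_nonneg (hs0 ξ).le (sq_nonneg _)
  have n2 : 0 ≤ ∫ ξ, b ξ * (ψ ξ - 1 * φ ξ) ^ 2 :=
    integral_nonneg fun ξ => mul_nonneg (hb0 ξ).le (sq_nonneg _)
  have z : ∫ ξ, b ξ * (ψ ξ - 1 * φ ξ) ^ 2 = 0 := by linarith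
  have int : Integrable fun ξ => b ξ * (ψ ξ - 1 * φ ξ) ^ 2 := by
    have := integrable_mul_of_memLp_two
      (memLp_two_bounded_mul hb (fun ξ => (abs_of_pos (hb0 ξ)).trans_le (hbM ξ)) H.1) H.1
    refine this.congr (Eventually.of_forall fun ξ => ?_); simp only; ring
  rw [integral_eq_zero_iff_of_nonneg (fun ξ => mul_nonneg (hb0 ξ).le (sq_nonneg _)) int] at z
  filter_upwards [z] with ξ hξ
  have := pow_eq_zero_iff (two_ne_zero) |>.1 ((mul_eq_zero.1 hξ).resolve_left (hb0 ξ).ne')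
  linarith

/-! ### Integrals over half-lines -/

/-- A positive primitive of a function with a simple zero and positive slope at `0` is bounded
below by a multiple of `s²`. -/
theorem exists_mul_sq_le_primitive {f : ℝ → ℝ} {ℓ m : ℝ} (hm : 0 < m)
    (hf : ContinuousOn f (Icc 0 ℓ)) (h0 : f 0 = 0) (hd : HasDerivWithinAt f m (Icc 0 ℓ) 0)
    (hpos : ∀ s ∈ Ioc 0 ℓ, 0 < ∫ r in (0 : ℝ)..s, f r) :
    ∃ c, 0 < c ∧ ∀ s ∈ Icc 0 ℓ, c * s ^ 2 ≤ ∫ r in (0 : ℝ)..s, f r := by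
  rcases le_or_gt ℓ 0 with hℓ | hℓ
  · refine ⟨1, one_pos, fun s hs => ?_⟩
    have : s = 0 := le_antisymm (hs.2.trans hℓ) hs.1
    simp [this]
  have hsmall : ∀ᶠ r in 𝓝[Icc 0 ℓ] (0 : ℝ), m / 2 * r ≤ f r := by
    have h1 := (hasDerivWithinAt_iff_isLittleO.1 hd).bound (half_pos hm)
    filter_upwards [h1, self_mem_nhdsWithin] with r hr hr0
    simp only [h0, sub_zero, smul_eq_mul, Real.norm_eq_abs, abs_of_nonneg hr0.1] at hr
    have := (abs_le.1 hr).1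
    linarith
  obtain ⟨ε, hε, hball⟩ := Metric.mem_nhdsWithin_iff.1 hsmall
  set δ := min (ε / 2) ℓ with hδ
  have hδ0 : 0 < δ := lt_min (half_pos hε) hℓ
  have hδℓ : δ ≤ ℓ := min_le_right _ _
  have hloc : ∀ r ∈ Icc 0 δ, m / 2 * r ≤ f r := fun r hr => by
    refine hball ⟨?_, hr.1, hr.2.trans hδℓ⟩
    rw [Metric.mem_ball, Real.dist_eq, sub_zero, abs_of_nonneg hr.1]
    have := hr.2.trans (min_le_left (ε / 2) ℓ)
    linarith
  have hint : ∀ s ∈ Icc 0 ℓ, IntervalIntegrable f volume 0 s := fun s hs => by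
    refine ContinuousOn.intervalIntegrable ?_
    rw [uIcc_of_le hs.1]
    exact hf.mono (Icc_subset_Icc le_rfl hs.2)
  have hcont : ContinuousOn (fun s => ∫ r in (0 : ℝ)..s, f r) (Icc δ ℓ) := by
    have : ContinuousOn (fun s => ∫ r in (0 : ℝ)..s, f r) (uIcc 0 ℓ) :=
      intervalIntegral.continuousOn_primitive_interval'
        (hint ℓ (right_mem_Icc.2 hℓ.le)) (left_mem_uIcc)
    rw [uIcc_of_le hℓ.le] at this
    exact this.mono (Icc_subset_Icc hδ0.le le_rfl)
  obtain ⟨s₀, hs₀, hmin⟩ := isCompact_Icc.exists_isMinOn ⟨δ, left_mem_Icc.2 hδℓ⟩ hcont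
  have hc0 := hpos s₀ ⟨hδ0.trans_le hs₀.1, hs₀.2⟩
  set c₀ := ∫ r in (0 : ℝ)..s₀, f r
  refine ⟨min (m / 4) (c₀ / ℓ ^ 2), by positivity, fun s hs => ?_⟩
  rcases le_total s δ with h | h
  · have h1 : ∫ r in (0 : ℝ)..s, m / 2 * r ≤ ∫ r in (0 : ℝ)..s, f r :=
      intervalIntegral.integral_mono_on hs.1
        ((continuous_const.mul continuous_id).intervalIntegrable _ _) (hint s hs)
        fun r hr => hloc r ⟨hr.1, hr.2.trans h⟩
    rw [intervalIntegral.integral_const_mul, integral_id] at h1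
    have := mul_le_mul_of_nonneg_right (min_le_left (m / 4) (c₀ / ℓ ^ 2)) (sq_nonneg s)
    linarith
  · have h1 : c₀ ≤ ∫ r in (0 : ℝ)..s, f r := hmin (show s ∈ Icc δ ℓ from ⟨h, hs.2⟩)
    have h2 := mul_le_mul_of_nonneg_right (min_le_right (m / 4) (c₀ / ℓ ^ 2)) (sq_nonneg s)
    have h3 : c₀ / ℓ ^ 2 * s ^ 2 ≤ c₀ / ℓ ^ 2 * ℓ ^ 2 :=
      mul_le_mul_of_nonneg_left (pow_le_pow_left₀ hs.1 hs.2 2) (by positivity)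
    rw [div_mul_cancel₀ _ (by positivity)] at h3
    linarith

/-- If `z' = -p` with `p` comparable to `z ≥ 0` on `[0, ∞)`, then `z` decays exponentially, and
so does `p`; only quadratic decay of `p` is recorded. -/
theorem exists_decay_of_comparable {z p : ℝ → ℝ} {k K : ℝ} (hk : 0 < k)
    (hz : ∀ ξ, HasDerivAt z (-p ξ) ξ) (hz0 : ∀ ξ, 0 ≤ z ξ)
    (hkp : ∀ ξ, 0 ≤ ξ → k * z ξ ≤ p ξ) (hpK : ∀ ξ, 0 ≤ ξ → p ξ ≤ K * z ξ) :
    ∃ C, ∀ ξ, 0 ≤ ξ → p ξ * (1 + |ξ|) ^ 2 ≤ C := by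
  have hexp : ∀ ξ, HasDerivAt (fun ξ => z ξ * Real.exp (k * ξ))
      (-p ξ * Real.exp (k * ξ) + z ξ * (Real.exp (k * ξ) * k)) ξ := fun ξ => by
    have h1 : HasDerivAt (fun ξ : ℝ => k * ξ) k ξ := by simpa using (hasDerivAt_id ξ).const_mul k
    exact (hz ξ).mul h1.exp
  have hanti : AntitoneOn (fun ξ => z ξ * Real.exp (k * ξ)) (Ici 0) := by
    refine antitoneOn_of_deriv_nonpos (convex_Ici 0)
      (fun ξ _ => (hexp ξ).continuousAt.continuousWithinAt)
      (fun ξ _ => (hexp ξ).differentiableAt.differentiableWithinAt) fun ξ hξ => ?_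
    rw [interior_Ici] at hξ
    rw [(hexp ξ).deriv]
    nlinarith [hkp ξ hξ.le, Real.exp_pos (k * ξ)]
  refine ⟨|K| * (z 0 * (2 + 4 / k ^ 2)), fun ξ hξ => ?_⟩
  have h1 : z ξ * Real.exp (k * ξ) ≤ z 0 := by
    simpa using hanti (mem_Ici.2 le_rfl) (mem_Ici.2 hξ) hξ
  have h2 : (1 + |ξ|) ^ 2 ≤ (2 + 4 / k ^ 2) * Real.exp (k * ξ) := by
    rw [abs_of_nonneg hξ]
    have e1 := Real.quadratic_le_exp_of_nonneg (mul_nonneg hk.le hξ)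
    have e2 : 1 ≤ Real.exp (k * ξ) := Real.one_le_exp (mul_nonneg hk.le hξ)
    have e3 : (k * ξ) ^ 2 / 2 ≤ Real.exp (k * ξ) := by
      linarith [mul_nonneg hk.le hξ]
    have e4 : 4 / k ^ 2 * ((k * ξ) ^ 2 / 2) ≤ 4 / k ^ 2 * Real.exp (k * ξ) :=
      mul_le_mul_of_nonneg_left e3 (by positivity)
    have e5 : 4 / k ^ 2 * ((k * ξ) ^ 2 / 2) = 2 * ξ ^ 2 := by field_simp; ring
    nlinarith [sq_nonneg (ξ - 1)]
  have h3 : z ξ * (1 + |ξ|) ^ 2 ≤ z 0 * (2 + 4 / k ^ 2) := by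
    have := mul_le_mul_of_nonneg_left h2 (hz0 ξ)
    have h4 := mul_le_mul_of_nonneg_right h1 (show 0 ≤ 2 + 4 / k ^ 2 by positivity)
    linarith
  calc p ξ * (1 + |ξ|) ^ 2 ≤ (|K| * z ξ) * (1 + |ξ|) ^ 2 :=
        mul_le_mul_of_nonneg_right ((hpK ξ hξ).trans
          (mul_le_mul_of_nonneg_right (le_abs_self K) (hz0 ξ))) (by positivity)
    _ = |K| * (z ξ * (1 + |ξ|) ^ 2) := by ring
    _ ≤ _ := mul_le_mul_of_nonneg_left h3 (abs_nonneg K)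

/-- In the situation of `exists_decay_of_comparable`, the tail integral of `p²` is controlled by
the boundary value of `p²`, since `p² ≤ K z p = -(K / 2) (z²)'`. -/
theorem integral_Ioi_sq_le_of_comparable {z p : ℝ → ℝ} {k K : ℝ} (hk : 0 < k) (hp : Continuous p)
    (hz : ∀ ξ, HasDerivAt z (-p ξ) ξ) (hz0 : ∀ ξ, 0 ≤ z ξ) (hp0 : ∀ ξ, 0 ≤ p ξ)
    (hlim : Tendsto z atTop (𝓝 0))
    (hkp : ∀ ξ, 0 ≤ ξ → k * z ξ ≤ p ξ) (hpK : ∀ ξ, 0 ≤ ξ → p ξ ≤ K * z ξ) (ξ : ℝ) (hξ : 0 ≤ ξ) :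
    IntegrableOn (fun η => p η ^ 2) (Ioi ξ) ∧
      ∫ η in Ioi ξ, p η ^ 2 ≤ |K| / (2 * k ^ 2) * p ξ ^ 2 := by
  have hd : ∀ η ∈ Ici ξ, HasDerivAt (fun η => -(z η ^ 2 / 2)) (z η * p η) η := fun η _ => by
    have := (((hz η).fun_pow 2).div_const 2).fun_neg
    refine this.congr_deriv ?_
    norm_num
    ring
  have hl : Tendsto (fun η => -(z η ^ 2 / 2)) atTop (𝓝 0) := by
    simpa using ((hlim.pow 2).div_const 2).neg
  have hnn : ∀ η ∈ Ioi ξ, 0 ≤ z η * p η := fun η _ => mul_nonneg (hz0 η) (hp0 η)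
  have hi := integrableOn_Ioi_deriv_of_nonneg' hd hnn hl
  have he := integral_Ioi_of_hasDerivAt_of_nonneg' hd hnn hl
  have hle : ∀ η ∈ Ioi ξ, p η ^ 2 ≤ |K| * (z η * p η) := fun η hη => by
    have := (hpK η (hξ.trans hη.le)).trans (mul_le_mul_of_nonneg_right (le_abs_self K) (hz0 η))
    nlinarith [hp0 η]
  have hi' : IntegrableOn (fun η => p η ^ 2) (Ioi ξ) := by
    refine Integrable.mono' (hi.const_mul |K|) (hp.pow 2).aestronglyMeasurable ?_
    filter_upwards [ae_restrict_mem measurableSet_Ioi] with η hη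
    rw [Real.norm_of_nonneg (sq_nonneg _)]
    exact hle η hη
  refine ⟨hi', ?_⟩
  have h1 := setIntegral_mono_on hi' (hi.const_mul |K|) measurableSet_Ioi hle
  rw [integral_const_mul, he] at h1
  have h2 : (k * z ξ) ^ 2 ≤ p ξ ^ 2 := pow_le_pow_left₀ (mul_nonneg hk.le (hz0 ξ)) (hkp ξ hξ) 2
  have h3 : z ξ ^ 2 ≤ p ξ ^ 2 / k ^ 2 := by
    rw [le_div_iff₀ (by positivity)]; linarith [mul_pow k (z ξ) 2]
  have h4 := mul_le_mul_of_nonneg_left h3 (show 0 ≤ |K| / 2 by positivity)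
  calc _ ≤ _ := h1
    _ = |K| / 2 * z ξ ^ 2 := by ring
    _ ≤ _ := h4
    _ = _ := by field_simp

theorem hasDerivAt_integral_Iic {g : ℝ → ℝ} (hg : Continuous g) (hi : Integrable g) (ξ : ℝ) :
    HasDerivAt (fun ξ => ∫ η in Iic ξ, g η) (g ξ) ξ := by
  have e : ∀ ξ, ∫ η in Iic ξ, g η = (∫ η in Iic 0, g η) + ∫ η in (0 : ℝ)..ξ, g η := fun ξ => by
    rw [← intervalIntegral.integral_Iic_sub_Iic hi.integrableOn hi.integrableOn]; ring
  rw [funext e]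
  exact (intervalIntegral.integral_hasDerivAt_right (hg.intervalIntegrable _ _)
    (hg.stronglyMeasurableAtFilter _ _) hg.continuousAt).const_add _

theorem contDiff_of_deriv {f g : ℝ → ℝ} (h : ∀ ξ, HasDerivAt f (g ξ) ξ) (hg : ContDiff ℝ ∞ g) :
    ContDiff ℝ ∞ f :=
  contDiff_infty_iff_deriv.2 ⟨fun ξ => (h ξ).differentiableAt, by
    rwa [show deriv f = g from funext fun ξ => (h ξ).deriv]⟩

/-! ### Correctors for a decaying profile -/

/-- The properties of `p = v̄'` on which the construction of the corrector rests: positivity,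
`|p'| ≤ C p`, decay, and comparability of the tail integrals of `p²` with `p²`. -/
structure IsProfile (p : ℝ → ℝ) : Prop where
  smooth : ContDiff ℝ ∞ p
  pos : ∀ ξ, 0 < p ξ
  deriv_le : ∃ C, ∀ ξ, |deriv p ξ| ≤ C * p ξ
  decay : ∃ C, ∀ ξ, p ξ * (1 + |ξ|) ^ 2 ≤ C
  tail_Iic : ∃ C, ∀ ξ ≤ 0, ∫ η in Iic ξ, p η ^ 2 ≤ C * p ξ ^ 2
  tail_Ioi : ∃ C, ∀ ξ, 0 ≤ ξ → ∫ η in Ioi ξ, p η ^ 2 ≤ C * p ξ ^ 2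

/-- A strictly monotone transition whose slope is comparable to the distance to the limits. -/
theorem isProfile_of_comparable {v p : ℝ → ℝ} {a b k K C : ℝ} (hp : ContDiff ℝ ∞ p)
    (hp0 : ∀ ξ, 0 < p ξ) (hC : ∀ ξ, |deriv p ξ| ≤ C * p ξ) (hk : 0 < k)
    (hv : ∀ ξ, HasDerivAt v (p ξ) ξ) (hva : ∀ ξ, a ≤ v ξ) (hvb : ∀ ξ, v ξ ≤ b)
    (hbot : Tendsto v atBot (𝓝 a)) (htop : Tendsto v atTop (𝓝 b))
    (h1 : ∀ ξ ≤ 0, k * (v ξ - a) ≤ p ξ) (h2 : ∀ ξ ≤ 0, p ξ ≤ K * (v ξ - a))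
    (h3 : ∀ ξ, 0 ≤ ξ → k * (b - v ξ) ≤ p ξ) (h4 : ∀ ξ, 0 ≤ ξ → p ξ ≤ K * (b - v ξ)) :
    IsProfile p := by
  have dr : ∀ ξ, HasDerivAt (fun ξ => b - v ξ) (-p ξ) ξ := fun ξ => (hv ξ).const_sub b
  have dl : ∀ ξ, HasDerivAt (fun ξ => v (-ξ) - a) (-p (-ξ)) ξ := fun ξ => by
    have := ((hv (-ξ)).comp ξ (hasDerivAt_neg ξ)).sub_const a
    simpa using this
  have lr : Tendsto (fun ξ => b - v ξ) atTop (𝓝 0) := by simpa using htop.const_sub b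
  have ll : Tendsto (fun ξ => v (-ξ) - a) atTop (𝓝 0) := by
    simpa using (hbot.comp tendsto_neg_atTop_atBot).sub_const a
  refine ⟨hp, hp0, ⟨C, hC⟩, ?_, ⟨|K| / (2 * k ^ 2), fun ξ hξ => ?_⟩,
    ⟨|K| / (2 * k ^ 2), fun ξ hξ => ?_⟩⟩
  · obtain ⟨C1, hC1⟩ := exists_decay_of_comparable hk dr (fun ξ => sub_nonneg.2 (hvb ξ)) h3 h4
    obtain ⟨C2, hC2⟩ := exists_decay_of_comparable hk dl (fun ξ => sub_nonneg.2 (hva _))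
      (fun ξ hξ => h1 _ (neg_nonpos.2 hξ)) (fun ξ hξ => h2 _ (neg_nonpos.2 hξ))
    refine ⟨max C1 C2, fun ξ => ?_⟩
    rcases le_total 0 ξ with h | h
    · exact (hC1 ξ h).trans (le_max_left _ _)
    · have := hC2 (-ξ) (neg_nonneg.2 h)
      rw [neg_neg, abs_neg] at this
      exact this.trans (le_max_right _ _)
  · have := (integral_Ioi_sq_le_of_comparable hk (hp.continuous.comp continuous_neg) dl
      (fun ξ => sub_nonneg.2 (hva _)) (fun ξ => (hp0 _).le) ll
      (fun ξ hξ => h1 _ (neg_nonpos.2 hξ)) (fun ξ hξ => h2 _ (neg_nonpos.2 hξ)) (-ξ)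
      (neg_nonneg.2 hξ)).2
    have e := integral_comp_neg_Ioi (-ξ) (fun η => p η ^ 2)
    rw [neg_neg] at e
    simp only [Function.comp_apply] at this
    rwa [e, neg_neg] at this
  · exact (integral_Ioi_sq_le_of_comparable hk hp.continuous dr (fun ξ => sub_nonneg.2 (hvb ξ))
      (fun ξ => (hp0 ξ).le) lr h3 h4 ξ hξ).2

namespace IsProfile

theorem memLp_linear_mul {p : ℝ → ℝ} (hp : IsProfile p) :
    MemLp (fun ξ => (1 + |ξ|) * p ξ) 2 volume := by
  obtain ⟨C, hC⟩ := hp.decay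
  have hcont : Continuous fun ξ => (1 + |ξ|) * p ξ :=
    (continuous_const.add continuous_abs).mul hp.smooth.continuous
  rw [memLp_two_iff_integrable_sq hcont.aestronglyMeasurable]
  refine Integrable.mono' (integrable_inv_one_add_sq.const_mul (C ^ 2))
    (hcont.pow 2).aestronglyMeasurable (Eventually.of_forall fun ξ => ?_)
  rw [Real.norm_of_nonneg (sq_nonneg _), ← div_eq_mul_inv, le_div_iff₀ (by positivity)]
  have h1 : (p ξ * (1 + |ξ|) ^ 2) ^ 2 ≤ C ^ 2 :=
    pow_le_pow_left₀ (mul_nonneg (hp.pos ξ).le (sq_nonneg _)) (hC ξ) 2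
  have h2 : 1 + ξ ^ 2 ≤ (1 + |ξ|) ^ 2 := by
    rw [← sq_abs ξ]; nlinarith [abs_nonneg ξ]
  calc ((1 + |ξ|) * p ξ) ^ 2 * (1 + ξ ^ 2)
      ≤ ((1 + |ξ|) * p ξ) ^ 2 * (1 + |ξ|) ^ 2 := mul_le_mul_of_nonneg_left h2 (sq_nonneg _)
    _ = (p ξ * (1 + |ξ|) ^ 2) ^ 2 := by ring
    _ ≤ C ^ 2 := h1

theorem memLp_of_abs_le_linear {p : ℝ → ℝ} (hp : IsProfile p) {f : ℝ → ℝ} {C : ℝ}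
    (hf : Continuous f) (h : ∀ ξ, |f ξ| ≤ C * ((1 + |ξ|) * p ξ)) : MemLp f 2 volume :=
  memLp_two_of_abs_le (C := C) hp.memLp_linear_mul hf.aestronglyMeasurable fun ξ => by
    rw [abs_of_nonneg (mul_nonneg (by positivity) (hp.pos ξ).le)]; exact h ξ

theorem memLp_of_abs_le {p : ℝ → ℝ} (hp : IsProfile p) {f : ℝ → ℝ} {C : ℝ} (hf : Continuous f)
    (h : ∀ ξ, |f ξ| ≤ C * p ξ) : MemLp f 2 volume := by
  have hC : 0 ≤ C := by
    by_contra hC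
    nlinarith [(abs_nonneg _).trans (h 0), hp.pos 0]
  refine hp.memLp_of_abs_le_linear (C := C) hf fun ξ => (h ξ).trans ?_
  exact mul_le_mul_of_nonneg_left
    (le_mul_of_one_le_left (hp.pos ξ).le (by linarith [abs_nonneg ξ])) hC

theorem memLp {p : ℝ → ℝ} (hp : IsProfile p) : MemLp p 2 volume :=
  hp.memLp_of_abs_le (C := 1) hp.smooth.continuous fun ξ => by rw [abs_of_pos (hp.pos ξ), one_mul]

theorem contDiff_deriv {p : ℝ → ℝ} (hp : IsProfile p) : ContDiff ℝ ∞ (deriv p) :=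
  (contDiff_infty_iff_deriv.1 hp.smooth).2

theorem memLp_deriv {p : ℝ → ℝ} (hp : IsProfile p) : MemLp (deriv p) 2 volume :=
  let ⟨_, hC⟩ := hp.deriv_le
  hp.memLp_of_abs_le hp.contDiff_deriv.continuous hC

/-- `p⁻² ∫_{-∞}^ξ f p` is bounded if `|f| ≤ C p` and `∫ f p = 0`: for positive `ξ` the integral
over `(-∞, ξ]` is minus the integral over the other tail. -/
theorem exists_abs_corrector_deriv_le {p : ℝ → ℝ} (hp : IsProfile p) {f : ℝ → ℝ} {C : ℝ}
    (hf : ContDiff ℝ ∞ f) (hfC : ∀ ξ, |f ξ| ≤ C * p ξ) (h0 : ∫ ξ, f ξ * p ξ = 0) :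
    ∃ C', ∀ ξ, |1 / p ξ ^ 2 * ∫ η in Iic ξ, f η * p η| ≤ C' := by
  obtain ⟨C1, hC1⟩ := hp.tail_Iic
  obtain ⟨C2, hC2⟩ := hp.tail_Ioi
  have hint : Integrable fun ξ => f ξ * p ξ :=
    integrable_mul_of_memLp_two (hp.memLp_of_abs_le hf.continuous hfC) hp.memLp
  have hint2 : Integrable fun ξ => C * p ξ ^ 2 := hp.memLp.integrable_sq.const_mul C
  have hC : 0 ≤ C := by
    by_contra hC
    nlinarith [(abs_nonneg _).trans (hfC 0), hp.pos 0]
  have hbd : ∀ s : Set ℝ, |∫ η in s, f η * p η| ≤ C * ∫ η in s, p η ^ 2 := by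
    intro s
    rw [← integral_const_mul]
    refine norm_integral_le_of_norm_le (f := fun η => f η * p η) hint2.integrableOn
      (Eventually.of_forall fun η => ?_)
    rw [norm_mul, Real.norm_eq_abs, Real.norm_of_nonneg (hp.pos η).le, sq, ← mul_assoc]
    exact mul_le_mul_of_nonneg_right (hfC η) (hp.pos η).le
  have hfin : ∀ {ξ I D : ℝ}, |I| ≤ C * (D * p ξ ^ 2) → |1 / p ξ ^ 2 * I| ≤ C * D := by
    intro ξ I D h
    have hpp : 0 < p ξ ^ 2 := pow_pos (hp.pos ξ) 2
    rw [abs_mul, abs_of_pos (by positivity), one_div, inv_mul_le_iff₀ hpp]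
    linarith
  refine ⟨max (C * C1) (C * C2), fun ξ => ?_⟩
  rcases le_total ξ 0 with h | h
  · refine le_trans ?_ (le_max_left _ _)
    exact hfin ((hbd _).trans (mul_le_mul_of_nonneg_left (hC1 ξ h) hC))
  · refine le_trans ?_ (le_max_right _ _)
    have hsplit := intervalIntegral.integral_Iic_add_Ioi (b := ξ) hint.integrableOn
      hint.integrableOn
    rw [h0] at hsplit
    rw [eq_neg_of_add_eq_zero_left hsplit]
    refine hfin ?_
    rw [abs_neg]
    exact (hbd _).trans (mul_le_mul_of_nonneg_left (hC2 ξ h) hC)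

/-- The function `q(ξ) = ∫_0^ξ p⁻² ∫_{-∞}^η f p` is smooth, solves `(p² q')' = f p`, and has bounded
first and second derivatives. -/
theorem exists_corrector {p : ℝ → ℝ} (hp : IsProfile p) {f : ℝ → ℝ} {C : ℝ} (hf : ContDiff ℝ ∞ f)
    (hfC : ∀ ξ, |f ξ| ≤ C * p ξ) (h0 : ∫ ξ, f ξ * p ξ = 0) :
    ∃ q r : ℝ → ℝ, ∃ C', (∀ ξ, r ξ = 1 / p ξ ^ 2 * ∫ η in Iic ξ, f η * p η) ∧
      (∀ ξ, q ξ = ∫ η in (0 : ℝ)..ξ, r η) ∧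
      ContDiff ℝ ∞ r ∧ ContDiff ℝ ∞ q ∧ (∀ ξ, HasDerivAt q (r ξ) ξ) ∧
      (∀ ξ, 2 * deriv p ξ * r ξ + p ξ * deriv r ξ = f ξ) ∧
      (∀ ξ, |q ξ| ≤ C' * |ξ|) ∧ (∀ ξ, |r ξ| ≤ C') ∧ ∀ ξ, |deriv r ξ| ≤ C' := by
  obtain ⟨C1, hC1⟩ := hp.exists_abs_corrector_deriv_le hf hfC h0
  obtain ⟨C2, hC2⟩ := hp.deriv_le
  have hint : Integrable fun ξ => f ξ * p ξ :=
    integrable_mul_of_memLp_two (hp.memLp_of_abs_le hf.continuous hfC) hp.memLp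
  have hder := hasDerivAt_integral_Iic (hf.continuous.mul hp.smooth.continuous) hint
  have hG : ContDiff ℝ ∞ fun ξ => ∫ η in Iic ξ, f η * p η :=
    contDiff_of_deriv hder (hf.mul hp.smooth)
  set r : ℝ → ℝ := fun ξ => 1 / p ξ ^ 2 * ∫ η in Iic ξ, f η * p η with hr
  have hrs : ContDiff ℝ ∞ r :=
    (contDiff_const.div (hp.smooth.pow 2) fun ξ => (pow_pos (hp.pos ξ) 2).ne').mul hG
  have hq : ∀ ξ, HasDerivAt (fun ξ => ∫ η in (0 : ℝ)..ξ, r η) (r ξ) ξ := fun ξ =>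
    intervalIntegral.integral_hasDerivAt_right (hrs.continuous.intervalIntegrable _ _)
      (hrs.continuous.stronglyMeasurableAtFilter _ _) hrs.continuous.continuousAt
  have heq : ∀ ξ, 2 * deriv p ξ * r ξ + p ξ * deriv r ξ = f ξ := fun ξ => by
    have hprod : (fun ξ => p ξ ^ 2 * r ξ) = fun ξ => ∫ η in Iic ξ, f η * p η := by
      funext ξ
      have := (hp.pos ξ).ne'
      simp only [hr]; field_simp
    have d1 := ((hp.smooth.differentiable (by simp) ξ).hasDerivAt.fun_pow 2).mul
      (hrs.differentiable (by simp) ξ).hasDerivAt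
    have d2 : HasDerivAt (fun ξ => p ξ ^ 2 * r ξ) (f ξ * p ξ) ξ := by rw [hprod]; exact hder ξ
    have := d1.unique d2
    have hne := (hp.pos ξ).ne'
    apply mul_left_cancel₀ hne
    simp at this
    linear_combination this
  have hfp : ∀ ξ, |deriv r ξ| ≤ C + 2 * C2 * C1 := fun ξ => by
    have hpos := hp.pos ξ
    have e : p ξ * deriv r ξ = f ξ - 2 * deriv p ξ * r ξ := by linarith [heq ξ]
    have h1 : |p ξ * deriv r ξ| ≤ |f ξ| + 2 * |deriv p ξ| * |r ξ| := by
      rw [e]; refine (abs_sub _ _).trans ?_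
      rw [abs_mul, abs_mul, abs_two]
    rw [abs_mul, abs_of_pos hpos] at h1
    have h2 : |deriv p ξ| * |r ξ| ≤ C2 * p ξ * C1 :=
      mul_le_mul (hC2 ξ) (hC1 ξ) (abs_nonneg _) ((abs_nonneg _).trans (hC2 ξ))
    refine le_of_mul_le_mul_left ?_ hpos
    linarith [hfC ξ]
  set M := max C1 (C + 2 * C2 * C1)
  refine ⟨_, r, M, fun ξ => rfl, fun ξ => rfl, hrs, contDiff_of_deriv hq hrs, hq, heq,
    fun ξ => ?_, fun ξ => (hC1 ξ).trans (le_max_left _ _),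
    fun ξ => (hfp ξ).trans (le_max_right _ _)⟩
  have := intervalIntegral.norm_integral_le_of_norm_le_const (a := 0) (b := ξ) (f := r) (C := M)
    fun η _ => (hC1 η).trans (le_max_left _ _)
  simpa using this

end IsProfile

/-! ### Smooth functions on the unit interval -/

theorem uniqueDiffOn_unitInterval : UniqueDiffOn ℝ (Icc (0 : ℝ) 1) := uniqueDiffOn_Icc one_pos

theorem contDiffOn_derivWithin_unitInterval {G : ℝ → ℝ} (hG : ContDiffOn ℝ ∞ G (Icc 0 1)) :
    ContDiffOn ℝ ∞ (derivWithin G (Icc 0 1)) (Icc 0 1) :=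
  hG.derivWithin uniqueDiffOn_unitInterval (by simp)

theorem hasDerivWithinAt_of_contDiffOn {G : ℝ → ℝ} (hG : ContDiffOn ℝ ∞ G (Icc 0 1)) {ρ : ℝ}
    (hρ : ρ ∈ Icc (0 : ℝ) 1) : HasDerivWithinAt G (derivWithin G (Icc 0 1) ρ) (Icc 0 1) ρ :=
  ((hG.differentiableOn (by simp)) ρ hρ).hasDerivWithinAt

theorem hasDerivAt_of_contDiffOn {G : ℝ → ℝ} (hG : ContDiffOn ℝ ∞ G (Icc 0 1)) {ρ : ℝ}
    (hρ : ρ ∈ Ioo (0 : ℝ) 1) : HasDerivAt G (derivWithin G (Icc 0 1) ρ) ρ :=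
  (hasDerivWithinAt_of_contDiffOn hG (Ioo_subset_Icc_self hρ)).hasDerivAt (Icc_mem_nhds hρ.1 hρ.2)

theorem hasDerivAt_comp_of_contDiffOn {G u : ℝ → ℝ} (hG : ContDiffOn ℝ ∞ G (Icc 0 1))
    (hu : ContDiff ℝ ∞ u) (hmem : ∀ ξ, u ξ ∈ Icc (0 : ℝ) 1) (ξ : ℝ) :
    HasDerivAt (fun ξ => G (u ξ)) (derivWithin G (Icc 0 1) (u ξ) * deriv u ξ) ξ :=
  (hasDerivWithinAt_of_contDiffOn hG (hmem ξ)).comp_hasDerivAt ξ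
    (hu.differentiable (by simp) ξ).hasDerivAt (Eventually.of_forall hmem)

theorem exists_abs_le_unitInterval {G : ℝ → ℝ} (hG : ContinuousOn G (Icc 0 1)) :
    ∃ C, 0 ≤ C ∧ ∀ ρ ∈ Icc (0 : ℝ) 1, |G ρ| ≤ C := by
  obtain ⟨C, hC⟩ := isCompact_Icc.exists_bound_of_continuousOn hG
  exact ⟨C, (norm_nonneg _).trans (hC 0 (by simp)), hC⟩

theorem exists_lipschitz_unitInterval {G : ℝ → ℝ} (hG : ContDiffOn ℝ ∞ G (Icc 0 1)) :
    ∃ C, 0 ≤ C ∧ ∀ ρ ∈ Icc (0 : ℝ) 1, ∀ z ∈ Icc (0 : ℝ) 1, |G ρ - G z| ≤ C * |ρ - z| := by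
  obtain ⟨C, hC0, hC⟩ :=
    exists_abs_le_unitInterval (contDiffOn_derivWithin_unitInterval hG).continuousOn
  exact ⟨C, hC0, fun ρ hρ z hz => (convex_Icc 0 1).norm_image_sub_le_of_norm_derivWithin_le
    (hG.differentiableOn (by simp)) hC hz hρ⟩

theorem intervalIntegrable_of_unitInterval {f : ℝ → ℝ} (hf : ContinuousOn f (Icc 0 1)) {a b : ℝ}
    (ha : a ∈ Icc (0 : ℝ) 1) (hb : b ∈ Icc (0 : ℝ) 1) : IntervalIntegrable f volume a b :=
  (hf.mono (ordConnected_Icc.uIcc_subset ha hb)).intervalIntegrable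

theorem hasDerivWithinAt_primitive {f : ℝ → ℝ} (hf : ContinuousOn f (Icc 0 1)) {a ρ : ℝ}
    (ha : a ∈ Icc (0 : ℝ) 1) (hρ : ρ ∈ Icc (0 : ℝ) 1) :
    HasDerivWithinAt (fun ρ => ∫ r in a..ρ, f r) (f ρ) (Icc 0 1) ρ := by
  set g : ℝ → ℝ := IccExtend zero_le_one ((Icc (0 : ℝ) 1).domRestrict f)
  have hg : Continuous g := (continuousOn_iff_continuous_domRestrict.1 hf).Icc_extend'
  have hgf : ∀ r ∈ Icc (0 : ℝ) 1, g r = f r := fun r hr => by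
    simp only [g]
    rw [IccExtend_of_mem _ _ hr]; rfl
  have h1 : HasDerivAt (fun ρ => ∫ r in a..ρ, g r) (g ρ) ρ :=
    intervalIntegral.integral_hasDerivAt_right (hg.intervalIntegrable _ _)
      (hg.stronglyMeasurableAtFilter _ _) hg.continuousAt
  rw [← hgf ρ hρ]
  have he : ∀ b ∈ Icc (0 : ℝ) 1, ∫ r in a..b, f r = ∫ r in a..b, g r := fun b hb =>
    intervalIntegral.integral_congr fun r hr =>
      (hgf r (ordConnected_Icc.uIcc_subset ha hb hr)).symm
  exact h1.hasDerivWithinAt.congr he (he ρ hρ)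

namespace Coefficients.Admissible

variable {c : Coefficients} {ρm ρs ρp : ℝ}

/-! ### The potential `W̃` -/

theorem mem_m (hc : c.Admissible ρm ρs ρp) : ρm ∈ Ioo (0 : ℝ) 1 := by
  obtain ⟨h1, h2, h3, h4⟩ := hc.order
  constructor <;> linarith

theorem mem_p (hc : c.Admissible ρm ρs ρp) : ρp ∈ Ioo (0 : ℝ) 1 := by
  obtain ⟨h1, h2, h3, h4⟩ := hc.order
  constructor <;> linarith

theorem m_lt_p (hc : c.Admissible ρm ρs ρp) : ρm < ρp := hc.order.2.1.trans hc.order.2.2.1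

theorem smooth_P' (hc : c.Admissible ρm ρs ρp) : ContDiffOn ℝ ∞ c.P' (Icc 0 1) :=
  contDiffOn_derivWithin_unitInterval hc.smooth_P

theorem smooth_W' (hc : c.Admissible ρm ρs ρp) : ContDiffOn ℝ ∞ c.W' (Icc 0 1) :=
  contDiffOn_derivWithin_unitInterval hc.smooth_W

theorem smooth_W'P' (hc : c.Admissible ρm ρs ρp) :
    ContDiffOn ℝ ∞ (fun ρ => c.W' ρ * c.P' ρ) (Icc 0 1) :=
  hc.smooth_W'.mul hc.smooth_P'

theorem W'_eq_zero_iff (hc : c.Admissible ρm ρs ρp) {ρ : ℝ} (hρ : ρ ∈ Icc (0 : ℝ) 1) :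
    c.W' ρ = 0 ↔ ρ = ρm ∨ ρ = ρs ∨ ρ = ρp := by
  have := Set.ext_iff.1 hc.critical ρ
  simp only [mem_ofPred_eq, mem_insert_iff, mem_singleton_iff] at this
  rw [← this]; simp [hρ.1, hρ.2]

theorem W'_m (hc : c.Admissible ρm ρs ρp) : c.W' ρm = 0 :=
  (hc.W'_eq_zero_iff (Ioo_subset_Icc_self hc.mem_m)).2 (Or.inl rfl)

theorem W'_p (hc : c.Admissible ρm ρs ρp) : c.W' ρp = 0 :=
  (hc.W'_eq_zero_iff (Ioo_subset_Icc_self hc.mem_p)).2 (Or.inr (Or.inr rfl))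

/-- Between consecutive critical points `W'` has a constant sign, which is read off from the
values of `W` at the end points. -/
theorem W'_sign (hc : c.Admissible ρm ρs ρp) {a b : ℝ} (hab : a < b) (ha : 0 ≤ a) (hb : b ≤ 1)
    (hne : ∀ ρ ∈ Ioo a b, c.W' ρ ≠ 0) (τ : ℝ) (h : 0 < τ * (c.W b - c.W a)) :
    ∀ ρ ∈ Ioo a b, 0 < τ * c.W' ρ := by
  have hsub : Icc a b ⊆ Icc 0 1 := Icc_subset_Icc ha hb
  have hτ : τ ≠ 0 := fun h0 => by simp [h0] at h
  obtain ⟨x, hx, hxe⟩ := exists_hasDerivAt_eq_slope c.W c.W' hab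
    (hc.smooth_W.continuousOn.mono hsub)
    fun x hx => hasDerivAt_of_contDiffOn hc.smooth_W ⟨ha.trans_lt hx.1, hx.2.trans_le hb⟩
  have hx0 : 0 < τ * c.W' x := by
    rw [hxe, ← mul_div_assoc]; exact div_pos h (sub_pos.2 hab)
  intro ρ hρ
  by_contra! hneg
  have hs : uIcc ρ x ⊆ Ioo a b := ordConnected_Ioo.uIcc_subset hρ hx
  obtain ⟨y, hy, hy0⟩ := intermediate_value_uIcc
    ((continuousOn_const.mul hc.smooth_W'.continuousOn : ContinuousOn (fun ρ => τ * c.W' ρ) _).mono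
      (hs.trans (Ioo_subset_Icc_self.trans hsub)))
    (show (0 : ℝ) ∈ uIcc (τ * c.W' ρ) (τ * c.W' x) from mem_uIcc.2 (Or.inl ⟨hneg, hx0.le⟩))
  exact (mul_ne_zero hτ (hne y (hs hy))) hy0

theorem Wtilde_eq_integral_right (hc : c.Admissible ρm ρs ρp) {ρ : ℝ} (hρ : ρ ∈ Icc (0 : ℝ) 1) :
    c.Wtilde ρm ρ = ∫ r in ρp..ρ, c.W' r * c.P' r := by
  have hi := fun {a b : ℝ} (ha : a ∈ Icc (0 : ℝ) 1) (hb : b ∈ Icc (0 : ℝ) 1) =>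
    intervalIntegrable_of_unitInterval hc.smooth_W'P'.continuousOn ha hb
  have hm := Ioo_subset_Icc_self hc.mem_m
  have hp := Ioo_subset_Icc_self hc.mem_p
  rw [Wtilde, ← intervalIntegral.integral_add_adjacent_intervals (hi hm hp) (hi hp hρ),
    hc.balance, zero_add]

theorem Wtilde_p (hc : c.Admissible ρm ρs ρp) : c.Wtilde ρm ρp = 0 := hc.balance

theorem hasDerivWithinAt_Wtilde (hc : c.Admissible ρm ρs ρp) {ρ : ℝ} (hρ : ρ ∈ Icc (0 : ℝ) 1) :
    HasDerivWithinAt (c.Wtilde ρm) (c.W' ρ * c.P' ρ) (Icc 0 1) ρ :=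
  hasDerivWithinAt_primitive hc.smooth_W'P'.continuousOn (Ioo_subset_Icc_self hc.mem_m) hρ

theorem continuousOn_Wtilde (hc : c.Admissible ρm ρs ρp) : ContinuousOn (c.Wtilde ρm) (Icc 0 1) :=
  fun _ hρ => (hc.hasDerivWithinAt_Wtilde hρ).continuousWithinAt

theorem Wtilde_pos (hc : c.Admissible ρm ρs ρp) {ρ : ℝ} (hρ : ρ ∈ Icc (0 : ℝ) 1) (hm : ρ ≠ ρm)
    (hp : ρ ≠ ρp) : 0 < c.Wtilde ρm ρ := by
  have im := Ioo_subset_Icc_self hc.mem_m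
  have ip := Ioo_subset_Icc_self hc.mem_p
  obtain ⟨o1, o2, o3, o4⟩ := hc.order
  have key : ∀ {a b : ℝ}, a < b → 0 ≤ a → b ≤ 1 → (∀ r ∈ Ioo a b, r ≠ ρm ∧ r ≠ ρs ∧ r ≠ ρp) →
      ∀ τ : ℝ, 0 < τ * (c.W b - c.W a) → ∀ x y, a ≤ x → x < y → y ≤ b →
        0 < τ * ∫ r in x..y, c.W' r * c.P' r := by
    intro a b hab ha hb hne τ hτ x y hx hxy hy
    rw [← intervalIntegral.integral_const_mul]
    refine intervalIntegral.intervalIntegral_pos_of_pos_on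
      ((intervalIntegrable_of_unitInterval hc.smooth_W'P'.continuousOn ⟨by linarith, by linarith⟩
        ⟨by linarith, by linarith⟩).const_mul τ) (fun r hr => ?_) hxy
    have hr' : r ∈ Ioo a b := ⟨hx.trans_lt hr.1, hr.2.trans_le hy⟩
    have h1 := hc.W'_sign hab ha hb (fun r hr => by
      have := hne r hr
      rw [ne_eq, hc.W'_eq_zero_iff ⟨by linarith [hr.1], by linarith [hr.2]⟩]; tauto) τ hτ r hr'
    rw [← mul_assoc]
    exact mul_pos h1 (hc.P'_pos r ⟨by linarith [hr'.1], by linarith [hr'.2]⟩)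
  have hws := hc.wells ρs ⟨by linarith, by linarith⟩ (by linarith) (by linarith)
  rcases lt_or_gt_of_ne hm with h | h
  · have hw := hc.wells 0 ⟨le_rfl, zero_le_one⟩ (by linarith) (by linarith)
    have := key o1 le_rfl im.2 (fun r hr => ⟨by linarith [hr.2], by linarith [hr.2],
      by linarith [hr.2]⟩) (-1) (by linarith) ρ ρm hρ.1 h le_rfl
    rw [Wtilde, intervalIntegral.integral_symm]; linarith
  rcases lt_or_gt_of_ne hp with h' | h'
  · rcases le_total ρ ρs with hs | hs
    · have := key o2 im.1 (by linarith) (fun r hr => ⟨by linarith [hr.1], by linarith [hr.2],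
        by linarith [hr.2]⟩) 1 (by linarith) ρm ρ le_rfl h hs
      rw [Wtilde]; linarith
    · have := key o3 (by linarith) ip.2 (fun r hr => ⟨by linarith [hr.1], by linarith [hr.1],
        by linarith [hr.2]⟩) (-1) (by linarith) ρ ρp hs h' le_rfl
      rw [hc.Wtilde_eq_integral_right hρ, intervalIntegral.integral_symm]; linarith
  · have hw := hc.wells 1 ⟨zero_le_one, le_rfl⟩ (by linarith) (by linarith)
    have := key o4 ip.1 le_rfl (fun r hr => ⟨by linarith [hr.1], by linarith [hr.1],
      by linarith [hr.1]⟩) 1 (by linarith) ρp ρ le_rfl h' hρ.2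
    rw [hc.Wtilde_eq_integral_right hρ]; linarith

/-- `W̃` vanishes at least quadratically at the wells. -/
theorem exists_Wtilde_le_sq (hc : c.Admissible ρm ρs ρp) :
    ∃ C, 0 ≤ C ∧ ∀ z, z = ρm ∨ z = ρp → ∀ ρ ∈ Icc (0 : ℝ) 1, c.Wtilde ρm ρ ≤ C * (ρ - z) ^ 2 := by
  obtain ⟨C, hC0, hC⟩ := exists_lipschitz_unitInterval hc.smooth_W'P'
  refine ⟨C, hC0, fun z hz ρ hρ => ?_⟩
  have hzI : z ∈ Icc (0 : ℝ) 1 := by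
    rcases hz with rfl | rfl
    exacts [Ioo_subset_Icc_self hc.mem_m, Ioo_subset_Icc_self hc.mem_p]
  have hW : c.W' z = 0 := by rcases hz with rfl | rfl; exacts [hc.W'_m, hc.W'_p]
  have e : c.Wtilde ρm ρ = ∫ r in z..ρ, c.W' r * c.P' r := by
    rcases hz with rfl | rfl
    exacts [rfl, hc.Wtilde_eq_integral_right hρ]
  rw [e]
  have hbd : ‖∫ r in z..ρ, c.W' r * c.P' r‖ ≤ C * |ρ - z| * |ρ - z| :=
    intervalIntegral.norm_integral_le_of_norm_le_const fun r hr => ?_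
  · rw [mul_assoc, ← sq, sq_abs] at hbd
    exact (le_abs_self _).trans hbd
  · have h1 := hC r (ordConnected_Icc.uIcc_subset hzI hρ (uIoc_subset_uIcc hr)) z hzI
    rw [hW, zero_mul, sub_zero] at h1
    exact h1.trans (mul_le_mul_of_nonneg_left
      (abs_sub_left_of_mem_uIcc (uIoc_subset_uIcc hr)) hC0)

/-- `W̃` is bounded below by a multiple of the squared distance to each well, up to the midpoint
between the wells. -/
theorem exists_sq_le_Wtilde (hc : c.Admissible ρm ρs ρp) :
    ∃ k, 0 < k ∧ (∀ ρ ∈ Icc ρm ((ρp + ρm) / 2), k * (ρ - ρm) ^ 2 ≤ c.Wtilde ρm ρ) ∧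
      ∀ ρ ∈ Icc ((ρp + ρm) / 2) ρp, k * (ρp - ρ) ^ 2 ≤ c.Wtilde ρm ρ := by
  have im := Ioo_subset_Icc_self hc.mem_m
  have ip := Ioo_subset_Icc_self hc.mem_p
  have hlt := hc.m_lt_p
  set ℓ := (ρp - ρm) / 2 with hℓ
  have hder : ∀ z ∈ Icc (0 : ℝ) 1, c.W' z = 0 → HasDerivWithinAt (fun ρ => c.W' ρ * c.P' ρ)
      (derivWithin c.W' (Icc 0 1) z * c.P' z) (Icc 0 1) z := fun z hz h0 => by
    have := (hasDerivWithinAt_of_contDiffOn hc.smooth_W' hz).mul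
      (hasDerivWithinAt_of_contDiffOn hc.smooth_P' hz)
    rw [h0, zero_mul, add_zero] at this
    exact this
  have maps1 : MapsTo (fun s => ρm + s) (Icc 0 ℓ) (Icc 0 1) := fun s hs =>
    ⟨by linarith [hs.1, im.1], by linarith [hs.2, ip.2]⟩
  have maps2 : MapsTo (fun s => ρp - s) (Icc 0 ℓ) (Icc 0 1) := fun s hs =>
    ⟨by linarith [hs.2, im.1], by linarith [hs.1, ip.2]⟩
  have e1 : ∀ s, ∫ r in (0 : ℝ)..s, c.W' (ρm + r) * c.P' (ρm + r) = c.Wtilde ρm (ρm + s) :=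
    fun s => by
      rw [intervalIntegral.integral_comp_add_left (fun r => c.W' r * c.P' r), add_zero, Wtilde]
  have e2 : ∀ s ∈ Icc 0 ℓ, ∫ r in (0 : ℝ)..s, -(c.W' (ρp - r) * c.P' (ρp - r))
      = c.Wtilde ρm (ρp - s) := fun s hs => by
    rw [intervalIntegral.integral_neg,
      intervalIntegral.integral_comp_sub_left (fun r => c.W' r * c.P' r), sub_zero,
      hc.Wtilde_eq_integral_right (maps2 hs), intervalIntegral.integral_symm, neg_neg]
  obtain ⟨k1, hk1, H1⟩ := exists_mul_sq_le_primitive (ℓ := ℓ)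
    (f := fun s => c.W' (ρm + s) * c.P' (ρm + s))
    (mul_pos hc.convex_m (hc.P'_pos ρm im))
    (hc.smooth_W'P'.continuousOn.comp (by fun_prop) maps1)
    (by simp [hc.W'_m])
    (by
      have h := hder ρm im hc.W'_m
      rw [← add_zero ρm] at h
      have := h.comp (0 : ℝ) (((hasDerivAt_id (0 : ℝ)).const_add ρm).hasDerivWithinAt) maps1
      rw [mul_one, add_zero] at this
      exact this)
    (fun s hs => by
      rw [e1]
      exact hc.Wtilde_pos (maps1 (Ioc_subset_Icc_self hs)) (by linarith [hs.1])
        (by linarith [hs.2]))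
  obtain ⟨k2, hk2, H2⟩ := exists_mul_sq_le_primitive (ℓ := ℓ)
    (f := fun s => -(c.W' (ρp - s) * c.P' (ρp - s)))
    (mul_pos hc.convex_p (hc.P'_pos ρp ip))
    (hc.smooth_W'P'.continuousOn.comp (by fun_prop) maps2).neg
    (by simp [hc.W'_p])
    (by
      have h := hder ρp ip hc.W'_p
      rw [← sub_zero ρp] at h
      have := (h.comp (0 : ℝ) (((hasDerivAt_id (0 : ℝ)).const_sub ρp).hasDerivWithinAt) maps2).neg
      rw [mul_neg_one, sub_zero, neg_neg] at this
      exact this)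
    (fun s hs => by
      rw [e2 s (Ioc_subset_Icc_self hs)]
      exact hc.Wtilde_pos (maps2 (Ioc_subset_Icc_self hs)) (by linarith [hs.2])
        (by linarith [hs.1]))
  refine ⟨min k1 k2, lt_min hk1 hk2, fun ρ hρ => ?_, fun ρ hρ => ?_⟩
  · have hs : ρ - ρm ∈ Icc 0 ℓ := ⟨by linarith [hρ.1], by linarith [hρ.2]⟩
    have h := H1 _ hs
    rw [e1, add_sub_cancel] at h
    exact (mul_le_mul_of_nonneg_right (min_le_left _ _) (sq_nonneg _)).trans h
  · have hs : ρp - ρ ∈ Icc 0 ℓ := ⟨by linarith [hρ.2], by linarith [hρ.1]⟩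
    have h := H2 _ hs
    rw [e2 _ hs, sub_sub_cancel] at h
    exact (mul_le_mul_of_nonneg_right (min_le_right _ _) (sq_nonneg _)).trans h

/-- `P` is bi-Lipschitz and increasing on `[0,1]`. -/
theorem exists_P_bounds (hc : c.Admissible ρm ρs ρp) :
    ∃ k K, 0 < k ∧ 0 < K ∧ (∀ ρ ∈ Icc (0 : ℝ) 1, k ≤ c.P' ρ ∧ c.P' ρ ≤ K) ∧
      ∀ a ∈ Icc (0 : ℝ) 1, ∀ b ∈ Icc (0 : ℝ) 1, a ≤ b →
        k * (b - a) ≤ c.P b - c.P a ∧ c.P b - c.P a ≤ K * (b - a) := by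
  obtain ⟨x, hx, hmin⟩ := isCompact_Icc.exists_isMinOn ⟨(0 : ℝ), by simp⟩
    hc.smooth_P'.continuousOn
  obtain ⟨y, hy, hmax⟩ := isCompact_Icc.exists_isMaxOn ⟨(0 : ℝ), by simp⟩
    hc.smooth_P'.continuousOn
  refine ⟨c.P' x, c.P' y, hc.P'_pos x hx, hc.P'_pos y hy, fun ρ hρ => ⟨hmin hρ, hmax hρ⟩,
    fun a ha b hb hab => ?_⟩
  have hderiv : ∀ ρ ∈ interior (Icc (0 : ℝ) 1), HasDerivAt c.P (c.P' ρ) ρ := fun ρ hρ => by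
    rw [interior_Icc] at hρ
    exact hasDerivAt_of_contDiffOn hc.smooth_P hρ
  have hd : DifferentiableOn ℝ c.P (interior (Icc 0 1)) := fun ρ hρ =>
    (hderiv ρ hρ).differentiableAt.differentiableWithinAt
  exact ⟨(convex_Icc 0 1).mul_sub_le_image_sub_of_le_deriv hc.smooth_P.continuousOn hd
      (fun ρ hρ => by rw [(hderiv ρ hρ).deriv]; exact hmin (interior_subset hρ)) a ha b hb hab,
    (convex_Icc 0 1).image_sub_le_mul_sub_of_deriv_le hc.smooth_P.continuousOn hd
      (fun ρ hρ => by rw [(hderiv ρ hρ).deriv]; exact hmax (interior_subset hρ)) a ha b hb hab⟩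

end Coefficients.Admissible

namespace Coefficients.IsTransitionLayer

variable {c : Coefficients} {ρm ρs ρp : ℝ} {u : ℝ → ℝ}

/-! ### The transition layer -/

theorem smooth_comp {G : ℝ → ℝ} (hu : c.IsTransitionLayer ρm ρp u)
    (hG : ContDiffOn ℝ ∞ G (Icc 0 1)) : ContDiff ℝ ∞ fun ξ => G (u ξ) :=
  hG.comp_contDiff hu.smooth hu.mem_Icc

theorem smooth_vbar (hc : c.Admissible ρm ρs ρp) (hu : c.IsTransitionLayer ρm ρp u) :
    ContDiff ℝ ∞ (c.vbar u) := hu.smooth_comp hc.smooth_P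

theorem smooth_deriv_u (hu : c.IsTransitionLayer ρm ρp u) : ContDiff ℝ ∞ (deriv u) :=
  (contDiff_infty_iff_deriv.1 hu.smooth).2

theorem smooth_deriv_vbar (hc : c.Admissible ρm ρs ρp) (hu : c.IsTransitionLayer ρm ρp u) :
    ContDiff ℝ ∞ (deriv (c.vbar u)) := (contDiff_infty_iff_deriv.1 (hu.smooth_vbar hc)).2

theorem deriv_vbar (hc : c.Admissible ρm ρs ρp) (hu : c.IsTransitionLayer ρm ρp u) (ξ : ℝ) :
    deriv (c.vbar u) ξ = c.P' (u ξ) * deriv u ξ :=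
  (hasDerivAt_comp_of_contDiffOn hc.smooth_P hu.smooth hu.mem_Icc ξ).deriv

theorem hasDerivAt_vbar (hc : c.Admissible ρm ρs ρp) (hu : c.IsTransitionLayer ρm ρp u) (ξ : ℝ) :
    HasDerivAt (c.vbar u) (deriv (c.vbar u) ξ) ξ :=
  ((hu.smooth_vbar hc).differentiable (by simp) ξ).hasDerivAt

theorem iteratedDeriv_two_vbar (hc : c.Admissible ρm ρs ρp) (hu : c.IsTransitionLayer ρm ρp u)
    (ξ : ℝ) : iteratedDeriv 2 (c.vbar u) ξ = c.W' (u ξ) := by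
  linarith [hu.ode ξ, hc.sub_eq _ (hu.mem_Icc ξ)]

theorem deriv_deriv_vbar (hc : c.Admissible ρm ρs ρp) (hu : c.IsTransitionLayer ρm ρp u) (ξ : ℝ) :
    deriv (deriv (c.vbar u)) ξ = c.W' (u ξ) := by
  rw [← hu.iteratedDeriv_two_vbar hc, iteratedDeriv_succ, iteratedDeriv_one]

theorem hasDerivAt_deriv_vbar (hc : c.Admissible ρm ρs ρp) (hu : c.IsTransitionLayer ρm ρp u)
    (ξ : ℝ) : HasDerivAt (deriv (c.vbar u)) (c.W' (u ξ)) ξ := by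
  rw [← hu.deriv_deriv_vbar hc]
  exact ((hu.smooth_deriv_vbar hc).differentiable (by simp) ξ).hasDerivAt

theorem tendsto_comp_top {G : ℝ → ℝ} (hc : c.Admissible ρm ρs ρp)
    (hu : c.IsTransitionLayer ρm ρp u) (hG : ContinuousOn G (Icc 0 1)) :
    Tendsto (fun ξ => G (u ξ)) atTop (𝓝 (G ρp)) :=
  (hG ρp (Ioo_subset_Icc_self hc.mem_p)).tendsto.comp
    (tendsto_nhdsWithin_iff.2 ⟨hu.tendsto_top, Eventually.of_forall hu.mem_Icc⟩)

theorem tendsto_comp_bot {G : ℝ → ℝ} (hc : c.Admissible ρm ρs ρp)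
    (hu : c.IsTransitionLayer ρm ρp u) (hG : ContinuousOn G (Icc 0 1)) :
    Tendsto (fun ξ => G (u ξ)) atBot (𝓝 (G ρm)) :=
  (hG ρm (Ioo_subset_Icc_self hc.mem_m)).tendsto.comp
    (tendsto_nhdsWithin_iff.2 ⟨hu.tendsto_bot, Eventually.of_forall hu.mem_Icc⟩)

/-- The first integral `v̄'² = 2 W̃(ū)` of the layer equation; the constant vanishes since `v̄`
converges at `+∞`, so that `v̄'` is small at points tending to `+∞`. -/
theorem deriv_vbar_sq (hc : c.Admissible ρm ρs ρp) (hu : c.IsTransitionLayer ρm ρp u) (ξ : ℝ) :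
    deriv (c.vbar u) ξ ^ 2 = 2 * c.Wtilde ρm (u ξ) := by
  set E : ℝ → ℝ := fun ξ => deriv (c.vbar u) ξ ^ 2 - 2 * c.Wtilde ρm (u ξ) with hE
  have hd : ∀ ξ, HasDerivAt E 0 ξ := fun ξ => by
    have h1 := (hu.hasDerivAt_deriv_vbar hc ξ).fun_pow 2
    have h2 := ((hc.hasDerivWithinAt_Wtilde (hu.mem_Icc ξ)).comp_hasDerivAt ξ
      (hu.smooth.differentiable (by simp) ξ).hasDerivAt
      (Eventually.of_forall hu.mem_Icc)).const_mul 2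
    refine (h1.fun_sub h2).congr_deriv ?_
    rw [hu.deriv_vbar hc]
    norm_num
    ring
  have hconst : ∀ ξ, E ξ = E 0 := fun ξ =>
    is_const_of_deriv_eq_zero (fun ξ => (hd ξ).differentiableAt) (fun ξ => (hd ξ).deriv) ξ 0
  have hpts : ∀ k : ℕ, ∃ x ∈ Ioo (k : ℝ) (k + 1),
      deriv (c.vbar u) x = c.vbar u (k + 1) - c.vbar u k := fun k => by
    obtain ⟨x, hx, hxe⟩ := exists_deriv_eq_slope (c.vbar u) (lt_add_one (k : ℝ))
      (hu.smooth_vbar hc).continuous.continuousOn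
      ((hu.smooth_vbar hc).differentiable (by simp)).differentiableOn
    exact ⟨x, hx, by rw [hxe]; simp⟩
  choose x hx hxe using hpts
  have hxt : Tendsto x atTop atTop :=
    tendsto_atTop_mono (fun k => (hx k).1.le) tendsto_natCast_atTop_atTop
  have hv := hu.tendsto_comp_top hc hc.smooth_P.continuousOn
  have h1 : Tendsto (fun k => deriv (c.vbar u) (x k)) atTop (𝓝 0) := by
    simp_rw [hxe]
    rw [← sub_self (c.P ρp)]
    refine Tendsto.sub ?_ ?_
    · exact hv.comp (tendsto_atTop_add_const_right _ _ tendsto_natCast_atTop_atTop)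
    · exact hv.comp tendsto_natCast_atTop_atTop
  have h2 := (hu.tendsto_comp_top hc hc.continuousOn_Wtilde).comp hxt
  rw [hc.Wtilde_p] at h2
  have h3 : Tendsto (fun k => E (x k)) atTop (𝓝 0) := by
    simpa using (h1.pow 2).sub (h2.const_mul 2)
  simp_rw [hconst] at h3
  have h4 : E ξ = 0 := by rw [hconst]; exact tendsto_nhds_unique tendsto_const_nhds h3
  simp only [hE] at h4
  linarith

/-- `|v̄'|` is controlled by the distance of `ū` to either well. -/
theorem exists_abs_deriv_vbar_le (hc : c.Admissible ρm ρs ρp)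
    (hu : c.IsTransitionLayer ρm ρp u) :
    ∃ C, 0 ≤ C ∧ ∀ z, z = ρm ∨ z = ρp → ∀ ξ, |deriv (c.vbar u) ξ| ≤ C * |u ξ - z| := by
  obtain ⟨C, hC0, hC⟩ := hc.exists_Wtilde_le_sq
  refine ⟨√(2 * C), Real.sqrt_nonneg _, fun z hz ξ => ?_⟩
  rw [← Real.sqrt_sq_eq_abs, ← Real.sqrt_sq_eq_abs, ← Real.sqrt_mul (by positivity)]
  refine Real.sqrt_le_sqrt ?_
  rw [hu.deriv_vbar_sq hc]
  linarith [hC z hz _ (hu.mem_Icc ξ)]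

theorem abs_sub_le_vbar (hc : c.Admissible ρm ρs ρp) (hu : c.IsTransitionLayer ρm ρp u) :
    ∃ C, 0 ≤ C ∧ ∀ z ∈ Icc (0 : ℝ) 1, ∀ ξ, |u ξ - z| ≤ C * |c.vbar u ξ - c.P z| := by
  obtain ⟨k, K, hk, hK, -, hkK⟩ := hc.exists_P_bounds
  refine ⟨k⁻¹, by positivity, fun z hz ξ => ?_⟩
  rw [le_inv_mul_iff₀ hk]
  rcases le_total z (u ξ) with h | h
  · rw [abs_of_nonneg (sub_nonneg.2 h)]
    exact ((hkK z hz _ (hu.mem_Icc ξ) h).1).trans (le_abs_self _)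
  · rw [abs_sub_comm, abs_of_nonneg (sub_nonneg.2 h), abs_sub_comm]
    exact ((hkK _ (hu.mem_Icc ξ) z hz h).1).trans (le_abs_self _)

/-- The layer never reaches a well: by Grönwall's inequality it would be constant. -/
theorem ne_well (hc : c.Admissible ρm ρs ρp) (hu : c.IsTransitionLayer ρm ρp u) (ξ₀ : ℝ) :
    u ξ₀ ≠ ρm ∧ u ξ₀ ≠ ρp := by
  obtain ⟨C1, hC1, h1⟩ := hu.exists_abs_deriv_vbar_le hc
  obtain ⟨C2, hC2, h2⟩ := hu.abs_sub_le_vbar hc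
  have key : ∀ z, z = ρm ∨ z = ρp → u ξ₀ = z → ∀ ξ, u ξ = z := by
    intro z hz h0
    have hzI : z ∈ Icc (0 : ℝ) 1 := h0 ▸ hu.mem_Icc ξ₀
    have hb : ∀ ξ, ‖deriv (c.vbar u) ξ‖ ≤ C1 * C2 * ‖c.vbar u ξ - c.P z‖ := fun ξ => by
      rw [mul_assoc]
      exact (h1 z hz ξ).trans (mul_le_mul_of_nonneg_left (h2 z hzI ξ) hC1)
    have hd : ∀ ξ, HasDerivAt (fun ξ => c.vbar u ξ - c.P z) (deriv (c.vbar u) ξ) ξ := fun ξ =>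
      (hu.hasDerivAt_vbar hc ξ).sub_const _
    have hdl : ∀ ξ, HasDerivAt (fun ξ => c.vbar u (-ξ) - c.P z) (-deriv (c.vbar u) (-ξ)) ξ :=
      fun ξ => by
        have := (hd (-ξ)).comp ξ (hasDerivAt_neg ξ)
        rw [mul_neg_one] at this
        exact this
    have hv0 : c.vbar u ξ₀ - c.P z = 0 := by simp [vbar, h0]
    have hv : ∀ ξ, c.vbar u ξ - c.P z = 0 := fun ξ => by
      rcases le_total ξ₀ ξ with h | h
      · exact eq_zero_of_abs_deriv_le_mul_abs_self_of_eq_zero_right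
          (fun x _ => (hd x).continuousAt.continuousWithinAt)
          (fun x _ => (hd x).hasDerivWithinAt) hv0 (fun x _ => hb x) ξ ⟨h, le_rfl⟩
      · have := eq_zero_of_abs_deriv_le_mul_abs_self_of_eq_zero_right (a := -ξ₀) (b := -ξ)
          (K := C1 * C2) (f := fun ξ => c.vbar u (-ξ) - c.P z)
          (fun x _ => (hdl x).continuousAt.continuousWithinAt)
          (fun x _ => (hdl x).hasDerivWithinAt) (by simpa using hv0)
          (fun x _ => by rw [norm_neg]; exact hb (-x)) (-ξ) ⟨neg_le_neg h, le_rfl⟩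
        simpa using this
    intro ξ
    have := h2 z hzI ξ
    rw [hv ξ, abs_zero, mul_zero] at this
    exact sub_eq_zero.1 (abs_eq_zero.1 (le_antisymm this (abs_nonneg _)))
  have hlt := hc.m_lt_p
  have hne : ∀ z, z = ρm ∨ z = ρp → u ξ₀ ≠ z := fun z hz h => by
    have := key z hz h 0
    rw [hu.at_zero] at this
    rcases hz with rfl | rfl <;> linarith
  exact ⟨hne _ (Or.inl rfl), hne _ (Or.inr rfl)⟩

theorem mem_Ioo (hc : c.Admissible ρm ρs ρp) (hu : c.IsTransitionLayer ρm ρp u) (ξ : ℝ) :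
    u ξ ∈ Ioo ρm ρp := by
  have hlt := hc.m_lt_p
  have hcont := hu.smooth.continuous
  have h0 := hu.at_zero
  by_contra hcon
  rw [Set.mem_Ioo, not_and_or, not_lt, not_lt] at hcon
  rcases hcon with h | h
  · obtain ⟨y, -, hy⟩ := intermediate_value_uIcc (hcont.continuousOn (s := uIcc ξ 0))
      (show ρm ∈ uIcc (u ξ) (u 0) from mem_uIcc.2 (Or.inl ⟨h, by linarith⟩))
    exact (hu.ne_well hc y).1 hy
  · obtain ⟨y, -, hy⟩ := intermediate_value_uIcc (hcont.continuousOn (s := uIcc ξ 0))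
      (show ρp ∈ uIcc (u ξ) (u 0) from mem_uIcc.2 (Or.inr ⟨by linarith, h⟩))
    exact (hu.ne_well hc y).2 hy

theorem deriv_vbar_pos (hc : c.Admissible ρm ρs ρp) (hu : c.IsTransitionLayer ρm ρp u) (ξ : ℝ) :
    0 < deriv (c.vbar u) ξ := by
  have hne : ∀ ξ, deriv (c.vbar u) ξ ≠ 0 := fun ξ h => by
    have h1 := hu.deriv_vbar_sq hc ξ
    have h2 := hc.Wtilde_pos (hu.mem_Icc ξ) (hu.ne_well hc ξ).1 (hu.ne_well hc ξ).2
    rw [h] at h1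
    linarith
  obtain ⟨k, K, hk, hK, -, hkK⟩ := hc.exists_P_bounds
  have h0 : c.vbar u 0 < c.P ρp := by
    have h1 := (hu.mem_Ioo hc 0).2
    have := (hkK _ (hu.mem_Icc 0) ρp (Ioo_subset_Icc_self hc.mem_p) h1.le).1
    have h2 := mul_pos hk (sub_pos.2 h1)
    simp only [vbar]; linarith
  -- a point with positive slope exists since `v̄` increases from `v̄(0)` to its limit
  obtain ⟨b, hb1, hb0⟩ := (((hu.tendsto_comp_top hc hc.smooth_P.continuousOn).eventually
    (lt_mem_nhds h0)).and (eventually_gt_atTop (0 : ℝ))).exists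
  obtain ⟨x, hx, hxe⟩ := exists_deriv_eq_slope (c.vbar u) hb0
    (hu.smooth_vbar hc).continuous.continuousOn
    ((hu.smooth_vbar hc).differentiable (by simp)).differentiableOn
  have hx0 : 0 < deriv (c.vbar u) x := by
    rw [hxe]; exact div_pos (sub_pos.2 hb1) (by linarith)
  by_contra! hneg
  obtain ⟨y, -, hy⟩ := intermediate_value_uIcc
    ((hu.smooth_deriv_vbar hc).continuous.continuousOn (s := uIcc ξ x))
    (show (0 : ℝ) ∈ uIcc _ _ from mem_uIcc.2 (Or.inl ⟨hneg, hx0.le⟩))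
  exact hne y hy

theorem deriv_u_pos (hc : c.Admissible ρm ρs ρp) (hu : c.IsTransitionLayer ρm ρp u) (ξ : ℝ) :
    0 < deriv u ξ := by
  have h := hu.deriv_vbar_pos hc ξ
  rw [hu.deriv_vbar hc] at h
  exact pos_of_mul_pos_right h (hc.P'_pos _ (hu.mem_Icc ξ)).le

theorem deriv_vbar_eq_sqrt (hc : c.Admissible ρm ρs ρp) (hu : c.IsTransitionLayer ρm ρp u)
    (ξ : ℝ) : deriv (c.vbar u) ξ = √(2 * c.Wtilde ρm (u ξ)) := by
  rw [← hu.deriv_vbar_sq hc, Real.sqrt_sq (hu.deriv_vbar_pos hc ξ).le]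

theorem strictMono_u (hc : c.Admissible ρm ρs ρp) (hu : c.IsTransitionLayer ρm ρp u) :
    StrictMono u := strictMono_of_deriv_pos (hu.deriv_u_pos hc)

theorem exists_deriv_u_le (hc : c.Admissible ρm ρs ρp) (hu : c.IsTransitionLayer ρm ρp u) :
    ∃ C, 0 ≤ C ∧ ∀ ξ, |deriv u ξ| ≤ C * deriv (c.vbar u) ξ := by
  obtain ⟨k, K, hk, hK, hkK, -⟩ := hc.exists_P_bounds
  refine ⟨k⁻¹, by positivity, fun ξ => ?_⟩
  have h := hu.deriv_u_pos hc ξ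
  rw [abs_of_pos h, le_inv_mul_iff₀ hk, hu.deriv_vbar hc]
  exact mul_le_mul_of_nonneg_right (hkK _ (hu.mem_Icc ξ)).1 h.le

/-- `v̄'` is bounded below by the distance of `ū` to the nearer well. -/
theorem exists_le_deriv_vbar (hc : c.Admissible ρm ρs ρp) (hu : c.IsTransitionLayer ρm ρp u) :
    ∃ k, 0 < k ∧ (∀ ξ ≤ 0, k * (u ξ - ρm) ≤ deriv (c.vbar u) ξ) ∧
      ∀ ξ, 0 ≤ ξ → k * (ρp - u ξ) ≤ deriv (c.vbar u) ξ := by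
  obtain ⟨k, hk, h1, h2⟩ := hc.exists_sq_le_Wtilde
  refine ⟨√(2 * k), Real.sqrt_pos.2 (by positivity), fun ξ hξ => ?_, fun ξ hξ => ?_⟩
  · have hm := (hu.mem_Ioo hc ξ).1.le
    have hmid : u ξ ≤ (ρp + ρm) / 2 := hu.at_zero ▸ (hu.strictMono_u hc).monotone hξ
    rw [hu.deriv_vbar_eq_sqrt hc, ← Real.sqrt_sq (sub_nonneg.2 hm),
      ← Real.sqrt_mul (by positivity)]
    exact Real.sqrt_le_sqrt (by linarith [h1 _ ⟨hm, hmid⟩])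
  · have hm := (hu.mem_Ioo hc ξ).2.le
    have hmid : (ρp + ρm) / 2 ≤ u ξ := hu.at_zero ▸ (hu.strictMono_u hc).monotone hξ
    rw [hu.deriv_vbar_eq_sqrt hc, ← Real.sqrt_sq (sub_nonneg.2 hm),
      ← Real.sqrt_mul (by positivity)]
    exact Real.sqrt_le_sqrt (by linarith [h2 _ ⟨hmid, hm⟩])

theorem exists_W'_le (hc : c.Admissible ρm ρs ρp) (hu : c.IsTransitionLayer ρm ρp u) :
    ∃ C, 0 ≤ C ∧ ∀ ξ, |c.W' (u ξ)| ≤ C * deriv (c.vbar u) ξ := by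
  obtain ⟨k, hk, h1, h2⟩ := hu.exists_le_deriv_vbar hc
  obtain ⟨C, hC0, hC⟩ := exists_lipschitz_unitInterval hc.smooth_W'
  refine ⟨C * k⁻¹, by positivity, fun ξ => ?_⟩
  rw [mul_assoc]
  rcases le_total ξ 0 with h | h
  · have e := hC _ (hu.mem_Icc ξ) ρm (Ioo_subset_Icc_self hc.mem_m)
    rw [hc.W'_m, sub_zero, abs_of_pos (sub_pos.2 (hu.mem_Ioo hc ξ).1)] at e
    refine e.trans (mul_le_mul_of_nonneg_left ?_ hC0)
    rw [le_inv_mul_iff₀ hk]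
    exact h1 ξ h
  · have e := hC _ (hu.mem_Icc ξ) ρp (Ioo_subset_Icc_self hc.mem_p)
    rw [hc.W'_p, sub_zero, abs_sub_comm, abs_of_pos (sub_pos.2 (hu.mem_Ioo hc ξ).2)] at e
    refine e.trans (mul_le_mul_of_nonneg_left ?_ hC0)
    rw [le_inv_mul_iff₀ hk]
    exact h2 ξ h

theorem isProfile (hc : c.Admissible ρm ρs ρp) (hu : c.IsTransitionLayer ρm ρp u) :
    IsProfile (deriv (c.vbar u)) := by
  obtain ⟨C, hC0, hC⟩ := hu.exists_W'_le hc
  obtain ⟨k1, hk1, h1, h2⟩ := hu.exists_le_deriv_vbar hc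
  obtain ⟨k, K, hk, hK, -, hkK⟩ := hc.exists_P_bounds
  obtain ⟨C1, hC1, h3⟩ := hu.exists_abs_deriv_vbar_le hc
  obtain ⟨C2, hC2, h4⟩ := hu.abs_sub_le_vbar hc
  have im := Ioo_subset_Icc_self hc.mem_m
  have ip := Ioo_subset_Icc_self hc.mem_p
  have bm := fun ξ => hkK ρm im _ (hu.mem_Icc ξ) (hu.mem_Ioo hc ξ).1.le
  have bp := fun ξ => hkK _ (hu.mem_Icc ξ) ρp ip (hu.mem_Ioo hc ξ).2.le
  have nm : ∀ ξ, 0 ≤ c.P (u ξ) - c.P ρm := fun ξ =>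
    (mul_nonneg hk.le (sub_nonneg.2 (hu.mem_Ioo hc ξ).1.le)).trans (bm ξ).1
  have np : ∀ ξ, 0 ≤ c.P ρp - c.P (u ξ) := fun ξ =>
    (mul_nonneg hk.le (sub_nonneg.2 (hu.mem_Ioo hc ξ).2.le)).trans (bp ξ).1
  have lower : ∀ {x y q : ℝ}, y ≤ K * x → k1 * x ≤ q → k1 / K * y ≤ q := by
    intro x y q hy hq
    refine le_trans ?_ hq
    rw [div_mul_eq_mul_div, div_le_iff₀ hK]
    nlinarith
  have upper : ∀ z ∈ Icc (0 : ℝ) 1, z = ρm ∨ z = ρp → ∀ ξ,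
      deriv (c.vbar u) ξ ≤ C1 * C2 * |c.vbar u ξ - c.P z| := fun z hz hz' ξ => by
    rw [mul_assoc]
    exact (le_abs_self _).trans
      ((h3 z hz' ξ).trans (mul_le_mul_of_nonneg_left (h4 z hz ξ) hC1))
  refine isProfile_of_comparable (v := c.vbar u) (a := c.P ρm) (b := c.P ρp) (k := k1 / K)
    (K := C1 * C2) (C := C) (hu.smooth_deriv_vbar hc) (hu.deriv_vbar_pos hc)
    (fun ξ => by rw [hu.deriv_deriv_vbar hc]; exact hC ξ) (by positivity) (hu.hasDerivAt_vbar hc)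
    (fun ξ => sub_nonneg.1 (nm ξ)) (fun ξ => sub_nonneg.1 (np ξ))
    (hu.tendsto_comp_bot hc hc.smooth_P.continuousOn)
    (hu.tendsto_comp_top hc hc.smooth_P.continuousOn)
    (fun ξ hξ => lower (bm ξ).2 (h1 ξ hξ)) (fun ξ _ => ?_)
    (fun ξ hξ => lower (bp ξ).2 (h2 ξ hξ)) (fun ξ _ => ?_)
  · have := upper ρm im (Or.inl rfl) ξ
    rwa [vbar, abs_of_nonneg (nm ξ)] at this
  · have := upper ρp ip (Or.inr rfl) ξ
    rwa [abs_sub_comm, vbar, abs_of_nonneg (np ξ)] at this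

/-- Change of variables `ρ = ū(ξ)`. -/
theorem integral_comp_mul_deriv (hc : c.Admissible ρm ρs ρp) (hu : c.IsTransitionLayer ρm ρp u)
    {f : ℝ → ℝ} (hf : ContinuousOn f (Icc 0 1)) (hi : Integrable fun ξ => f (u ξ) * deriv u ξ) :
    ∫ ξ, f (u ξ) * deriv u ξ = ∫ ρ in ρm..ρp, f ρ := by
  have im := Ioo_subset_Icc_self hc.mem_m
  have hG : ContinuousOn (fun ρ => ∫ r in ρm..ρ, f r) (Icc 0 1) := fun ρ hρ =>
    (hasDerivWithinAt_primitive hf im hρ).continuousWithinAt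
  have := integral_of_hasDerivAt_of_tendsto (f := fun ξ => ∫ r in ρm..u ξ, f r)
    (fun ξ => (hasDerivWithinAt_primitive hf im (hu.mem_Icc ξ)).comp_hasDerivAt ξ
      (hu.smooth.differentiable (by simp) ξ).hasDerivAt (Eventually.of_forall hu.mem_Icc)) hi
    (hu.tendsto_comp_bot hc hG) (hu.tendsto_comp_top hc hG)
  rw [this, intervalIntegral.integral_same, sub_zero]

theorem memLp_deriv_u (hc : c.Admissible ρm ρs ρp) (hu : c.IsTransitionLayer ρm ρp u) :
    MemLp (deriv u) 2 volume :=
  let ⟨_, _, hC⟩ := hu.exists_deriv_u_le hc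
  (hu.isProfile hc).memLp_of_abs_le hu.smooth_deriv_u.continuous hC

theorem theta₁_eq (hc : c.Admissible ρm ρs ρp) (hu : c.IsTransitionLayer ρm ρp u) :
    c.θ₁ ρm ρp = ∫ ξ, deriv u ξ * deriv (c.vbar u) ξ := by
  have e : ∀ ξ, deriv u ξ * deriv (c.vbar u) ξ = √(2 * c.Wtilde ρm (u ξ)) * deriv u ξ := fun ξ => by
    rw [hu.deriv_vbar_eq_sqrt hc, mul_comm]
  have hi := integrable_mul_of_memLp_two (hu.memLp_deriv_u hc) (hu.isProfile hc).memLp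
  simp_rw [e] at hi ⊢
  exact (hu.integral_comp_mul_deriv hc
    (f := fun ρ => √(2 * c.Wtilde ρm ρ))
    (Real.continuous_sqrt.comp_continuousOn (continuousOn_const.mul hc.continuousOn_Wtilde))
    hi).symm

theorem theta₂_eq (hc : c.Admissible ρm ρs ρp) (hu : c.IsTransitionLayer ρm ρp u) :
    c.θ₂ ρm ρp = ∫ ξ, deriv (c.vbar u) ξ ^ 2 := by
  have e : ∀ ξ, deriv (c.vbar u) ξ ^ 2
      = c.P' (u ξ) * √(2 * c.Wtilde ρm (u ξ)) * deriv u ξ := fun ξ => by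
    rw [← hu.deriv_vbar_eq_sqrt hc, sq]
    nth_rw 1 [hu.deriv_vbar hc]
    ring
  have hi := (hu.isProfile hc).memLp.integrable_sq
  simp_rw [e] at hi ⊢
  exact (hu.integral_comp_mul_deriv hc
    (f := fun ρ => c.P' ρ * √(2 * c.Wtilde ρm ρ))
    (hc.smooth_P'.continuousOn.mul
      (Real.continuous_sqrt.comp_continuousOn (continuousOn_const.mul hc.continuousOn_Wtilde)))
    hi).symm

theorem integral_deriv_u_mul_pos (hc : c.Admissible ρm ρs ρp)
    (hu : c.IsTransitionLayer ρm ρp u) : 0 < ∫ ξ, deriv u ξ * deriv (c.vbar u) ξ := by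
  have hi := integrable_mul_of_memLp_two (hu.memLp_deriv_u hc) (hu.isProfile hc).memLp
  have hpos : ∀ ξ, 0 < deriv u ξ * deriv (c.vbar u) ξ := fun ξ =>
    mul_pos (hu.deriv_u_pos hc ξ) (hu.deriv_vbar_pos hc ξ)
  rw [integral_pos_iff_support_of_nonneg (fun ξ => (hpos ξ).le) hi]
  have : Function.support (fun ξ => deriv u ξ * deriv (c.vbar u) ξ) = univ :=
    eq_univ_of_forall fun ξ => (hpos ξ).ne'
  simp [this]

/-! ### The linearized operator along the layer -/

theorem smooth_diffusion (hc : c.Admissible ρm ρs ρp) (hu : c.IsTransitionLayer ρm ρp u) :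
    ContDiff ℝ ∞ fun ξ => 2 * c.σ (u ξ) :=
  contDiff_const.mul (hu.smooth_comp hc.smooth_σ)

theorem smooth_reaction (hc : c.Admissible ρm ρs ρp) (hu : c.IsTransitionLayer ρm ρp u) :
    ContDiff ℝ ∞ fun ξ => c.B (u ξ) + c.D (u ξ) :=
  (hu.smooth_comp hc.smooth_B).add (hu.smooth_comp hc.smooth_D)

/-- Along the layer the coefficients of `L_ū` lie between two positive constants. -/
theorem exists_coefficient_bounds (hc : c.Admissible ρm ρs ρp)
    (hu : c.IsTransitionLayer ρm ρp u) :
    ∃ m M, 0 < m ∧ (∀ ξ, m ≤ 2 * c.σ (u ξ)) ∧ (∀ ξ, 2 * c.σ (u ξ) ≤ M) ∧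
      (∀ ξ, m ≤ c.B (u ξ) + c.D (u ξ)) ∧ ∀ ξ, c.B (u ξ) + c.D (u ξ) ≤ M := by
  have hsub : Icc ρm ρp ⊆ Icc 0 1 := Icc_subset_Icc hc.mem_m.1.le hc.mem_p.2.le
  have hne : (Icc ρm ρp).Nonempty := ⟨ρm, left_mem_Icc.2 hc.m_lt_p.le⟩
  have mem := fun ξ => Ioo_subset_Icc_self (hu.mem_Ioo hc ξ)
  have c1 : ContinuousOn (fun ρ => 2 * c.σ ρ) (Icc ρm ρp) :=
    continuousOn_const.mul (hc.smooth_σ.continuousOn.mono hsub)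
  have c2 : ContinuousOn (fun ρ => c.B ρ + c.D ρ) (Icc ρm ρp) :=
    (hc.smooth_B.continuousOn.add hc.smooth_D.continuousOn).mono hsub
  obtain ⟨x1, hx1, m1⟩ := isCompact_Icc.exists_isMinOn hne c1
  obtain ⟨y1, hy1, M1⟩ := isCompact_Icc.exists_isMaxOn hne c1
  obtain ⟨x2, hx2, m2⟩ := isCompact_Icc.exists_isMinOn hne c2
  obtain ⟨y2, hy2, M2⟩ := isCompact_Icc.exists_isMaxOn hne c2
  refine ⟨min (2 * c.σ x1) (c.B x2 + c.D x2), max (2 * c.σ y1) (c.B y2 + c.D y2),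
    lt_min (mul_pos two_pos (hc.σ_pos _ ⟨hc.mem_m.1.trans_le hx1.1, hx1.2.trans_lt hc.mem_p.2⟩))
      (hc.sum_pos _ (hsub hx2)),
    fun ξ => (min_le_left _ _).trans (m1 (mem ξ)), fun ξ => (M1 (mem ξ)).trans (le_max_left _ _),
    fun ξ => (min_le_right _ _).trans (m2 (mem ξ)), fun ξ => (M2 (mem ξ)).trans (le_max_right _ _)⟩

theorem smooth_flux (hc : c.Admissible ρm ρs ρp) (hu : c.IsTransitionLayer ρm ρp u) :
    ContDiff ℝ ∞ fun ξ => 2 * c.σ (u ξ) * deriv (deriv (c.vbar u)) ξ :=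
  (hu.smooth_diffusion hc).mul (hu.isProfile hc).contDiff_deriv

theorem smooth_L (hc : c.Admissible ρm ρs ρp) (hu : c.IsTransitionLayer ρm ρp u) :
    ContDiff ℝ ∞ (c.L u (deriv (c.vbar u))) :=
  (contDiff_infty_iff_deriv.1 (hu.smooth_flux hc)).2.sub
    ((hu.smooth_reaction hc).mul (hu.smooth_deriv_vbar hc))

theorem exists_abs_deriv_flux_le (hc : c.Admissible ρm ρs ρp)
    (hu : c.IsTransitionLayer ρm ρp u) :
    ∃ C, ∀ ξ, |deriv (fun ξ => 2 * c.σ (u ξ) * deriv (deriv (c.vbar u)) ξ) ξ|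
      ≤ C * deriv (c.vbar u) ξ := by
  -- the flux is `G(ū)` for a function `G` smooth on the unit interval
  have hG : ContDiffOn ℝ ∞ (fun ρ => 2 * c.σ ρ * c.W' ρ) (Icc 0 1) :=
    (contDiffOn_const.mul hc.smooth_σ).mul hc.smooth_W'
  obtain ⟨C1, h1, hC1⟩ :=
    exists_abs_le_unitInterval (contDiffOn_derivWithin_unitInterval hG).continuousOn
  obtain ⟨C2, h2, hC2⟩ := hu.exists_deriv_u_le hc
  refine ⟨C1 * C2, fun ξ => ?_⟩
  have e : (fun ξ => 2 * c.σ (u ξ) * deriv (deriv (c.vbar u)) ξ)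
      = fun ξ => 2 * c.σ (u ξ) * c.W' (u ξ) := by
    funext ξ; rw [hu.deriv_deriv_vbar hc]
  rw [e, (hasDerivAt_comp_of_contDiffOn hG hu.smooth hu.mem_Icc ξ).deriv, abs_mul, mul_assoc]
  exact mul_le_mul (hC1 _ (hu.mem_Icc ξ)) (hC2 ξ) (abs_nonneg _) h1

theorem exists_abs_L_le (hc : c.Admissible ρm ρs ρp) (hu : c.IsTransitionLayer ρm ρp u) :
    ∃ C, ∀ ξ, |c.L u (deriv (c.vbar u)) ξ| ≤ C * deriv (c.vbar u) ξ := by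
  obtain ⟨C1, hC1⟩ := hu.exists_abs_deriv_flux_le hc
  obtain ⟨m, M, hm, -, -, hbm, hbM⟩ := hu.exists_coefficient_bounds hc
  refine ⟨C1 + M, fun ξ => (abs_sub _ _).trans ?_⟩
  have hp := hu.deriv_vbar_pos hc ξ
  rw [abs_mul, abs_of_pos hp, abs_of_pos (hm.trans_le (hbm ξ)), add_mul C1]
  exact add_le_add (hC1 ξ) (mul_le_mul_of_nonneg_right (hbM ξ) hp.le)

theorem memLp_L (hc : c.Admissible ρm ρs ρp) (hu : c.IsTransitionLayer ρm ρp u) :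
    MemLp (c.L u (deriv (c.vbar u))) 2 volume :=
  let ⟨_, hC⟩ := hu.exists_abs_L_le hc
  (hu.isProfile hc).memLp_of_abs_le (hu.smooth_L hc).continuous hC

theorem isH1_deriv_vbar (hc : c.Admissible ρm ρs ρp) (hu : c.IsTransitionLayer ρm ρp u) :
    IsH1 (deriv (c.vbar u)) (deriv (deriv (c.vbar u))) :=
  isH1_of_contDiff (hu.smooth_deriv_vbar hc) (hu.isProfile hc).memLp (hu.isProfile hc).memLp_deriv

/-- `v̄'` satisfies the weak form of `-L_ū v̄' = -(L_ū v̄')`. -/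
theorem weak_form_deriv_vbar (hc : c.Admissible ρm ρs ρp) (hu : c.IsTransitionLayer ρm ρp u)
    {φ h : ℝ → ℝ} (H : IsH1 φ h) :
    (∫ ξ, 2 * c.σ (u ξ) * deriv (deriv (c.vbar u)) ξ * h ξ)
      + (∫ ξ, (c.B (u ξ) + c.D (u ξ)) * deriv (c.vbar u) ξ * φ ξ)
      = ∫ ξ, -(c.L u (deriv (c.vbar u)) ξ) * φ ξ := by
  obtain ⟨m, M, hm, hsm, hsM, hbm, hbM⟩ := hu.exists_coefficient_bounds hc
  obtain ⟨C, hC⟩ := hu.exists_abs_deriv_flux_le hc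
  have hflux' := (contDiff_infty_iff_deriv.1 (hu.smooth_flux hc)).2
  have m0 : MemLp (fun ξ => 2 * c.σ (u ξ) * deriv (deriv (c.vbar u)) ξ) 2 volume :=
    memLp_two_bounded_mul (C := M) (hu.smooth_diffusion hc).continuous
      (fun ξ => (abs_of_pos (hm.trans_le (hsm ξ))).trans_le (hsM ξ)) (hu.isProfile hc).memLp_deriv
  have m1 := (hu.isProfile hc).memLp_of_abs_le hflux'.continuous hC
  have m2 : MemLp (fun ξ => (c.B (u ξ) + c.D (u ξ)) * deriv (c.vbar u) ξ) 2 volume :=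
    memLp_two_bounded_mul (C := M) (hu.smooth_reaction hc).continuous
      (fun ξ => (abs_of_pos (hm.trans_le (hbm ξ))).trans_le (hbM ξ)) (hu.isProfile hc).memLp
  have key := H.integral_mul_deriv (hu.smooth_flux hc) m0 m1
  have e1 : (∫ ξ, -(c.L u (deriv (c.vbar u)) ξ) * φ ξ)
      = (∫ ξ, (c.B (u ξ) + c.D (u ξ)) * deriv (c.vbar u) ξ * φ ξ)
        - ∫ ξ, φ ξ * deriv (fun ξ => 2 * c.σ (u ξ) * deriv (deriv (c.vbar u)) ξ) ξ := by
    rw [← integral_sub (integrable_mul_of_memLp_two m2 H.1) (integrable_mul_of_memLp_two H.1 m1)]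
    refine integral_congr_ae (Eventually.of_forall fun ξ => ?_)
    simp only [L]; ring
  have e2 : (∫ ξ, 2 * c.σ (u ξ) * deriv (deriv (c.vbar u)) ξ * h ξ)
      = ∫ ξ, h ξ * (2 * c.σ (u ξ) * deriv (deriv (c.vbar u)) ξ) :=
    integral_congr_ae (Eventually.of_forall fun ξ => mul_comm _ _)
  rw [e1, e2, key]; ring

theorem negLEq_deriv_vbar (hc : c.Admissible ρm ρs ρp) (hu : c.IsTransitionLayer ρm ρp u) :
    c.NegLEq u (deriv (c.vbar u)) fun ξ => -(c.L u (deriv (c.vbar u)) ξ) :=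
  ⟨(hu.memLp_L hc).neg, _, hu.isH1_deriv_vbar hc, fun _ _ H => hu.weak_form_deriv_vbar hc H⟩

theorem exists_unique_negLEq (hc : c.Admissible ρm ρs ρp) (hu : c.IsTransitionLayer ρm ρp u)
    {w : ℝ → ℝ} (hw : MemLp w 2 volume) :
    ∃ ψ, c.NegLEq u ψ w ∧ ∀ ψ', c.NegLEq u ψ' w → ψ' =ᵐ[volume] ψ := by
  obtain ⟨m, M, hm, hsm, hsM, hbm, hbM⟩ := hu.exists_coefficient_bounds hc
  have hs := (hu.smooth_diffusion hc).continuous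
  have hb := (hu.smooth_reaction hc).continuous
  obtain ⟨ψ, g, H, e⟩ := exists_weak_solution hm hs hb hsm hsM hbm hbM hw
  refine ⟨ψ, ⟨hw, g, H, e⟩, fun ψ' ⟨_, g', H', e'⟩ => ?_⟩
  exact weak_solution_unique hs hb (fun ξ => hm.trans_le (hsm ξ)) hsM
    (fun ξ => hm.trans_le (hbm ξ)) hbM H' H hw e' e

theorem negLEq_negLInv (hc : c.Admissible ρm ρs ρp) (hu : c.IsTransitionLayer ρm ρp u)
    {w : ℝ → ℝ} (hw : MemLp w 2 volume) : c.NegLEq u (c.negLInv u w) w := by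
  obtain ⟨ψ, hψ, -⟩ := hu.exists_unique_negLEq hc hw
  have h : ∃ ψ : ℝ → ℝ, c.NegLEq u ψ w := ⟨ψ, hψ⟩
  rw [negLInv, dif_pos h]
  exact h.choose_spec

theorem integrable_mul_negLInv (hc : c.Admissible ρm ρs ρp) (hu : c.IsTransitionLayer ρm ρp u)
    {w : ℝ → ℝ} (hw : MemLp w 2 volume) : Integrable fun ξ => w ξ * c.negLInv u w ξ := by
  obtain ⟨_, g, H, -⟩ := hu.negLEq_negLInv hc hw
  exact integrable_mul_of_memLp_two hw H.1

/-- `⟨-L_ū v̄', v̄'⟩ > 0`, as the energy of `v̄'`. -/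
theorem energy_deriv_vbar_pos (hc : c.Admissible ρm ρs ρp) (hu : c.IsTransitionLayer ρm ρp u) :
    0 < ∫ ξ, -(c.L u (deriv (c.vbar u)) ξ) * deriv (c.vbar u) ξ := by
  obtain ⟨m, M, hm, hsm, hsM, hbm, hbM⟩ := hu.exists_coefficient_bounds hc
  rw [← hu.weak_form_deriv_vbar hc (hu.isH1_deriv_vbar hc)]
  refine add_pos_of_nonneg_of_pos (integral_nonneg fun ξ => ?_) ?_
  · simp only [Pi.zero_apply]
    rw [mul_assoc]
    exact mul_nonneg (hm.le.trans (hsm ξ)) (mul_self_nonneg _)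
  · have m2 : MemLp (fun ξ => (c.B (u ξ) + c.D (u ξ)) * deriv (c.vbar u) ξ) 2 volume :=
      memLp_two_bounded_mul (C := M) (hu.smooth_reaction hc).continuous
        (fun ξ => (abs_of_pos (hm.trans_le (hbm ξ))).trans_le (hbM ξ)) (hu.isProfile hc).memLp
    have hpos : ∀ ξ, 0 < (c.B (u ξ) + c.D (u ξ)) * deriv (c.vbar u) ξ * deriv (c.vbar u) ξ :=
      fun ξ => mul_pos (mul_pos (hm.trans_le (hbm ξ)) (hu.deriv_vbar_pos hc ξ))
        (hu.deriv_vbar_pos hc ξ)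
    rw [integral_pos_iff_support_of_nonneg (fun ξ => (hpos ξ).le)
      (integrable_mul_of_memLp_two m2 (hu.isProfile hc).memLp)]
    have : Function.support (fun ξ => (c.B (u ξ) + c.D (u ξ)) * deriv (c.vbar u) ξ
        * deriv (c.vbar u) ξ) = univ := eq_univ_of_forall fun ξ => (hpos ξ).ne'
    simp [this]

/-- Cauchy–Schwarz for the energy form of `-L_ū`. -/
theorem sq_div_energy_le_quadForm (hc : c.Admissible ρm ρs ρp) (hu : c.IsTransitionLayer ρm ρp u)
    {w : ℝ → ℝ} (hw : MemLp w 2 volume) :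
    (∫ ξ, w ξ * deriv (c.vbar u) ξ) ^ 2
        / (∫ ξ, -(c.L u (deriv (c.vbar u)) ξ) * deriv (c.vbar u) ξ) ≤ c.quadForm u w := by
  obtain ⟨m, M, hm, hsm, hsM, hbm, hbM⟩ := hu.exists_coefficient_bounds hc
  have hs := (hu.smooth_diffusion hc).continuous
  have hb := (hu.smooth_reaction hc).continuous
  have hN := hu.energy_deriv_vbar_pos hc
  obtain ⟨_, g, H, e⟩ := hu.negLEq_negLInv hc hw
  set N := ∫ ξ, -(c.L u (deriv (c.vbar u)) ξ) * deriv (c.vbar u) ξ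
  set I := ∫ ξ, w ξ * deriv (c.vbar u) ξ
  have E := energy_sub_smul hs hb (fun ξ => hm.trans_le (hsm ξ)) hsM
    (fun ξ => hm.trans_le (hbm ξ)) hbM H (hu.isH1_deriv_vbar hc) hw (hu.memLp_L hc).neg e
    (fun _ _ H' => hu.weak_form_deriv_vbar hc H') (I / N)
  change _ = c.quadForm u w - 2 * (I / N) * I + (I / N) ^ 2 * N at E
  have n1 : 0 ≤ ∫ ξ, 2 * c.σ (u ξ) * (g ξ - I / N * deriv (deriv (c.vbar u)) ξ) ^ 2 :=
    integral_nonneg fun ξ => mul_nonneg (hm.le.trans (hsm ξ)) (sq_nonneg _)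
  have n2 : 0 ≤ ∫ ξ, (c.B (u ξ) + c.D (u ξ))
      * (c.negLInv u w ξ - I / N * deriv (c.vbar u) ξ) ^ 2 :=
    integral_nonneg fun ξ => mul_nonneg (hm.le.trans (hbm ξ)) (sq_nonneg _)
  have e3 : (I / N) ^ 2 * N = I ^ 2 / N := by field_simp
  have e4 : 2 * (I / N) * I = 2 * (I ^ 2 / N) := by ring
  linarith

/-- The quadratic form on multiples of `L_ū v̄'`. -/
theorem quadForm_smul_L (hc : c.Admissible ρm ρs ρp) (hu : c.IsTransitionLayer ρm ρp u) (a : ℝ) :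
    c.quadForm u (fun ξ => a * c.L u (deriv (c.vbar u)) ξ)
      = a ^ 2 * ∫ ξ, -(c.L u (deriv (c.vbar u)) ξ) * deriv (c.vbar u) ξ := by
  have hw : MemLp (fun ξ => a * c.L u (deriv (c.vbar u)) ξ) 2 volume := (hu.memLp_L hc).const_mul a
  have hsol : c.NegLEq u (fun ξ => -a * deriv (c.vbar u) ξ)
      fun ξ => a * c.L u (deriv (c.vbar u)) ξ := by
    have H0 := hu.isH1_deriv_vbar hc
    have H : IsH1 (fun ξ => -a * deriv (c.vbar u) ξ)
        (fun ξ => -a * deriv (deriv (c.vbar u)) ξ) := by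
      refine ⟨H0.1.const_mul _, H0.2.1.const_mul _, fun φ hφ hs => ?_⟩
      simp_rw [mul_assoc]
      rw [integral_const_mul, integral_const_mul, H0.2.2 φ hφ hs]; ring
    refine ⟨hw, _, H, fun φ h H' => ?_⟩
    have := hu.weak_form_deriv_vbar hc H'
    have e1 : ∀ ξ, 2 * c.σ (u ξ) * (-a * deriv (deriv (c.vbar u)) ξ) * h ξ
        = -a * (2 * c.σ (u ξ) * deriv (deriv (c.vbar u)) ξ * h ξ) := fun ξ => by ring
    have e2 : ∀ ξ, (c.B (u ξ) + c.D (u ξ)) * (-a * deriv (c.vbar u) ξ) * φ ξ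
        = -a * ((c.B (u ξ) + c.D (u ξ)) * deriv (c.vbar u) ξ * φ ξ) := fun ξ => by ring
    have e3 : ∀ ξ, a * c.L u (deriv (c.vbar u)) ξ * φ ξ
        = -a * (-(c.L u (deriv (c.vbar u)) ξ) * φ ξ) := fun ξ => by ring
    simp_rw [e1, e2, e3]
    rw [integral_const_mul, integral_const_mul, integral_const_mul, ← this]; ring
  obtain ⟨ψ, -, hψ⟩ := hu.exists_unique_negLEq hc hw
  have hae := (hψ _ (hu.negLEq_negLInv hc hw)).trans (hψ _ hsol).symm
  rw [quadForm, ← integral_const_mul]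
  refine integral_congr_ae ?_
  filter_upwards [hae] with ξ hξ
  rw [hξ]; ring

end Coefficients.IsTransitionLayer

/-! ### Smooth functions on `[0,T] × 𝕋ⁿ` -/

section Slab

variable {n : ℕ} {T : ℝ} {G : Type*} [NormedAddCommGroup G]

theorem uniqueDiffOn_slab {E : Type*} [NormedAddCommGroup E] [NormedSpace ℝ E] (hT : 0 < T) :
    UniqueDiffOn ℝ (Icc 0 T ×ˢ (univ : Set E)) :=
  (uniqueDiffOn_Icc hT).prod uniqueDiffOn_univ

/-- Joint smoothness on `[0,T] × ℝⁿ` passes to the spatial Fréchet derivative. -/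
theorem contDiffOn_fderiv_space [NormedSpace ℝ G] {E : Type*} [NormedAddCommGroup E]
    [NormedSpace ℝ E] (hT : 0 < T) {f : ℝ → E → G}
    (hf : ContDiffOn ℝ ∞ (fun p : ℝ × E => f p.1 p.2) (Icc 0 T ×ˢ univ)) :
    ContDiffOn ℝ ∞ (fun p : ℝ × E => fderiv ℝ (f p.1) p.2) (Icc 0 T ×ˢ univ) := by
  have h1 := hf.fderivWithin (uniqueDiffOn_slab hT) (m := ∞) (by simp)
  have h2 : ContDiffOn ℝ ∞ (fun p : ℝ × E =>
      (fderivWithin ℝ (fun p : ℝ × E => f p.1 p.2) (Icc 0 T ×ˢ univ) p).comp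
        (ContinuousLinearMap.inr ℝ ℝ E)) (Icc 0 T ×ˢ univ) := h1.clm_comp contDiffOn_const
  refine h2.congr fun p hp => ?_
  have h3 := (hf.differentiableOn (by simp) p hp).hasFDerivWithinAt
  have h4 : HasFDerivWithinAt (fun y : E => (p.1, y)) (ContinuousLinearMap.inr ℝ ℝ E) univ p.2 :=
    (hasFDerivAt_prodMk_right p.1 p.2).hasFDerivWithinAt
  have hm : MapsTo (fun y : E => (p.1, y)) univ (Icc 0 T ×ˢ univ) := fun y _ => ⟨hp.1, mem_univ _⟩
  have h5 := HasFDerivWithinAt.comp (g := fun p : ℝ × E => f p.1 p.2) p.2 h3 h4 hm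
  rw [hasFDerivWithinAt_univ] at h5
  exact h5.fderiv

/-- Joint smoothness on `[0,T] × ℝⁿ` passes to the iterated spatial derivatives. -/
theorem contDiffOn_iteratedFDeriv_space [NormedSpace ℝ G] {E : Type*} [NormedAddCommGroup E]
    [NormedSpace ℝ E] (hT : 0 < T) {f : ℝ → E → G}
    (hf : ContDiffOn ℝ ∞ (fun p : ℝ × E => f p.1 p.2) (Icc 0 T ×ˢ univ)) (j : ℕ) :
    ContDiffOn ℝ ∞ (fun p : ℝ × E => iteratedFDeriv ℝ j (f p.1) p.2) (Icc 0 T ×ˢ univ) := by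
  induction j with
  | zero =>
    simp only [iteratedFDeriv_zero_eq_comp]
    exact (continuousMultilinearCurryFin0 ℝ E G).symm.contDiff.comp_contDiffOn hf
  | succ j ih =>
    simp only [iteratedFDeriv_succ_eq_comp_left]
    exact (continuousMultilinearCurryLeftEquiv ℝ (fun _ : Fin (j + 1) => E)
      G).symm.contDiff.comp_contDiffOn (contDiffOn_fderiv_space hT
        (f := fun t => iteratedFDeriv ℝ j (f t)) ih)

/-- Joint smoothness on `[0,T] × ℝⁿ` passes to the time derivative. -/
theorem contDiffOn_derivWithin_time [NormedSpace ℝ G] {E : Type*} [NormedAddCommGroup E]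
    [NormedSpace ℝ E] (hT : 0 < T) {f : ℝ → E → G}
    (hf : ContDiffOn ℝ ∞ (fun p : ℝ × E => f p.1 p.2) (Icc 0 T ×ˢ univ)) :
    ContDiffOn ℝ ∞ (fun p : ℝ × E => derivWithin (fun s => f s p.2) (Icc 0 T) p.1)
      (Icc 0 T ×ˢ univ) := by
  have h1 := hf.fderivWithin (uniqueDiffOn_slab hT) (m := ∞) (by simp)
  have h2 : ContDiffOn ℝ ∞ (fun p : ℝ × E =>
      fderivWithin ℝ (fun p : ℝ × E => f p.1 p.2) (Icc 0 T ×ˢ univ) p ((1 : ℝ), (0 : E)))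
        (Icc 0 T ×ˢ univ) := h1.clm_apply contDiffOn_const
  refine h2.congr fun p hp => ?_
  have h3 := (hf.differentiableOn (by simp) p hp).hasFDerivWithinAt
  have h4 : HasDerivWithinAt (fun s : ℝ => (s, p.2)) ((1 : ℝ), (0 : E)) (Icc 0 T) p.1 :=
    (hasDerivWithinAt_id _ _).prodMk (hasDerivWithinAt_const _ _ _)
  have hm : MapsTo (fun s : ℝ => (s, p.2)) (Icc 0 T) (Icc 0 T ×ˢ univ) :=
    fun s hs => ⟨hs, mem_univ _⟩
  have h5 := HasFDerivWithinAt.comp_hasDerivWithinAt (l := fun p : ℝ × E => f p.1 p.2) p.1 h3 h4 hm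
  exact h5.derivWithin (uniqueDiffOn_Icc hT _ hp.1)

/-- A continuous function on `[0,T] × 𝕋ⁿ` is bounded. -/
theorem exists_bound_of_periodic {f : ℝ → EuclideanSpace ℝ (Fin n) → G}
    (hf : ContinuousOn (fun p : ℝ × EuclideanSpace ℝ (Fin n) => f p.1 p.2) (Icc 0 T ×ˢ univ))
    (hper : ∀ t ∈ Icc (0 : ℝ) T, ∀ (x : EuclideanSpace ℝ (Fin n)) (k : Fin n → ℤ),
      f t (x + WithLp.toLp 2 (fun i => (k i : ℝ))) = f t x) :
    ∃ C, 0 ≤ C ∧ ∀ t ∈ Icc (0 : ℝ) T, ∀ x, ‖f t x‖ ≤ C := by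
  have hK : IsCompact (WithLp.toLp 2 '' (univ.pi fun _ : Fin n => Icc (0 : ℝ) 1) :
      Set (EuclideanSpace ℝ (Fin n))) :=
    (isCompact_univ_pi fun _ => isCompact_Icc).image (PiLp.continuous_toLp 2 _)
  obtain ⟨C, hC⟩ := ((isCompact_Icc (a := (0 : ℝ)) (b := T)).prod hK).exists_bound_of_continuousOn
    (hf.mono (prod_mono_right (subset_univ _)))
  refine ⟨max C 0, le_max_right _ _, fun t ht x => ?_⟩
  rw [← hper t ht x fun i => -⌊x i⌋]
  refine (hC (t, _) ⟨ht, ?_⟩).trans (le_max_left _ _)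
  refine ⟨fun i => Int.fract (x i), fun i _ => ⟨Int.fract_nonneg _, (Int.fract_lt_one _).le⟩, ?_⟩
  ext i
  simp [Int.fract, sub_eq_add_neg]

end Slab

namespace SmoothTX

variable {n : ℕ} {T : ℝ} {f g : ℝ → EuclideanSpace ℝ (Fin n) → ℝ}

theorem add (hf : SmoothTX T f) (hg : SmoothTX T g) : SmoothTX T fun t x => f t x + g t x :=
  ⟨hf.1.add hg.1, fun t ht x k => by simp only [hf.2 t ht, hg.2 t ht]⟩

theorem const_mul (hf : SmoothTX T f) (a : ℝ) : SmoothTX T fun t x => a * f t x :=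
  ⟨contDiffOn_const.mul hf.1, fun t ht x k => by simp only [hf.2 t ht]⟩

theorem contDiff_space (hf : SmoothTX T f) {t : ℝ} (ht : t ∈ Icc (0 : ℝ) T) :
    ContDiff ℝ ∞ (f t) := by
  have : ContDiff ℝ ∞ fun x : EuclideanSpace ℝ (Fin n) => (t, x) :=
    contDiff_const.prodMk contDiff_id
  exact hf.1.comp_contDiff this fun x => ⟨ht, mem_univ _⟩

theorem differentiableWithinAt_time (hf : SmoothTX T f) {t : ℝ} (ht : t ∈ Icc (0 : ℝ) T)
    (x : EuclideanSpace ℝ (Fin n)) :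
    DifferentiableWithinAt ℝ (fun s => f s x) (Icc 0 T) t := by
  have : ContDiffOn ℝ ∞ (fun s => f s x) (Icc 0 T) :=
    hf.1.comp (contDiff_id.prodMk contDiff_const).contDiffOn fun s hs => ⟨hs, mem_univ _⟩
  exact this.differentiableOn (by simp) t ht

theorem iteratedFDeriv_periodic (hf : SmoothTX T f) (j : ℕ) (t : ℝ) (ht : t ∈ Icc (0 : ℝ) T)
    (x : EuclideanSpace ℝ (Fin n)) (k : Fin n → ℤ) :
    iteratedFDeriv ℝ j (f t) (x + WithLp.toLp 2 (fun i => (k i : ℝ)))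
      = iteratedFDeriv ℝ j (f t) x := by
  rw [← iteratedFDeriv_comp_add_right]
  congr 1
  funext y
  exact hf.2 t ht y k

theorem dt (hT : 0 < T) (hf : SmoothTX T f) : SmoothTX T (SharpInterface.dt T f) :=
  ⟨contDiffOn_derivWithin_time hT hf.1, fun t ht x k =>
    derivWithin_congr (fun s hs => hf.2 s hs x k) (hf.2 t ht x k)⟩

theorem lap (hT : 0 < T) (hf : SmoothTX T f) : SmoothTX T (SharpInterface.lap f) := by
  have e : ∀ t x, SharpInterface.lap f t x = ∑ i, iteratedFDeriv ℝ 2 (f t) x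
      ![EuclideanSpace.basisFun (Fin n) ℝ i, EuclideanSpace.basisFun (Fin n) ℝ i] := fun t x => by
    rw [SharpInterface.lap, InnerProductSpace.laplacian_eq_iteratedFDeriv_orthonormalBasis _
      (EuclideanSpace.basisFun (Fin n) ℝ)]
  refine ⟨?_, fun t ht x k => ?_⟩
  · simp only [e]
    refine ContDiffOn.sum fun i _ => ?_
    exact (ContinuousMultilinearMap.apply ℝ (fun _ : Fin 2 => EuclideanSpace ℝ (Fin n)) ℝ
      _).contDiff.comp_contDiffOn (contDiffOn_iteratedFDeriv_space hT hf.1 2)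
  · simp only [e, hf.iteratedFDeriv_periodic 2 t ht x k]

theorem exists_iteratedFDeriv_bound (hT : 0 < T) (hf : SmoothTX T f) (j : ℕ) :
    ∃ C, 0 ≤ C ∧ ∀ t ∈ Icc (0 : ℝ) T, ∀ x, ‖iteratedFDeriv ℝ j (f t) x‖ ≤ C :=
  exists_bound_of_periodic (contDiffOn_iteratedFDeriv_space hT hf.1 j).continuousOn
    (hf.iteratedFDeriv_periodic j)

theorem exists_bound (hf : SmoothTX T f) :
    ∃ C, 0 ≤ C ∧ ∀ t ∈ Icc (0 : ℝ) T, ∀ x, |f t x| ≤ C :=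
  exists_bound_of_periodic hf.1.continuousOn hf.2

end SmoothTX

/-! ### Functions `a(t,x) q(ξ) + b(t,x) r(ξ)` -/

section Separated

variable {n : ℕ} {T : ℝ} {a b : ℝ → EuclideanSpace ℝ (Fin n) → ℝ} {q r : ℝ → ℝ}

theorem smoothTXR_separated (ha : SmoothTX T a) (hb : SmoothTX T b) (hq : ContDiff ℝ ∞ q)
    (hr : ContDiff ℝ ∞ r) : SmoothTXR T fun t x ξ => a t x * q ξ + b t x * r ξ := by
  have hm : MapsTo (fun p : ℝ × EuclideanSpace ℝ (Fin n) × ℝ => (p.1, p.2.1))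
      (Icc 0 T ×ˢ univ) (Icc 0 T ×ˢ univ) := fun p hp => ⟨hp.1, mem_univ _⟩
  have h1 : ContDiff ℝ ∞ fun p : ℝ × EuclideanSpace ℝ (Fin n) × ℝ => (p.1, p.2.1) := by fun_prop
  have h2 : ContDiff ℝ ∞ fun p : ℝ × EuclideanSpace ℝ (Fin n) × ℝ => p.2.2 := by fun_prop
  refine ⟨?_, fun t ht x k ξ => by simp only [ha.2 t ht, hb.2 t ht]⟩
  exact ((ha.1.comp h1.contDiffOn hm).mul (hq.comp h2).contDiffOn).add
    ((hb.1.comp h1.contDiffOn hm).mul (hr.comp h2).contDiffOn)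

theorem iteratedFDeriv_separated (ha : SmoothTX T a) (hb : SmoothTX T b) {t : ℝ}
    (ht : t ∈ Icc (0 : ℝ) T) (j : ℕ) (x : EuclideanSpace ℝ (Fin n)) (η : ℝ) :
    iteratedFDeriv ℝ j (fun y => a t y * q η + b t y * r η) x
      = q η • iteratedFDeriv ℝ j (a t) x + r η • iteratedFDeriv ℝ j (b t) x := by
  have ca : ContDiffAt ℝ j (a t) x :=
    ((ha.contDiff_space ht).of_le (by exact_mod_cast le_top)).contDiffAt
  have cb : ContDiffAt ℝ j (b t) x :=
    ((hb.contDiff_space ht).of_le (by exact_mod_cast le_top)).contDiffAt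
  have e : (fun y => a t y * q η + b t y * r η) = q η • a t + r η • b t := by
    funext y; simp [mul_comm]
  rw [e, iteratedFDeriv_add_apply (f := q η • a t) (g := r η • b t) (ca.const_smul (q η))
    (cb.const_smul (r η)), iteratedFDeriv_const_smul_apply ca, iteratedFDeriv_const_smul_apply cb]

theorem iteratedDeriv_smul_add_smul {G : Type*} [NormedAddCommGroup G] [NormedSpace ℝ G]
    (hq : ContDiff ℝ ∞ q) (hr : ContDiff ℝ ∞ r) (A B : G) (i : ℕ) (ξ : ℝ) :
    iteratedDeriv i (fun η => q η • A + r η • B) ξ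
      = iteratedDeriv i q ξ • A + iteratedDeriv i r ξ • B := by
  induction i generalizing ξ with
  | zero => simp
  | succ i ih =>
    have hd : ∀ {s : ℝ → ℝ}, ContDiff ℝ ∞ s →
        HasDerivAt (iteratedDeriv i s) (iteratedDeriv (i + 1) s ξ) ξ := fun {s} hs => by
      rw [iteratedDeriv_succ]
      exact (hs.differentiable_iteratedDeriv i
        (by exact_mod_cast WithTop.coe_lt_top _) ξ).hasDerivAt
    rw [iteratedDeriv_succ, show iteratedDeriv i (fun η => q η • A + r η • B)
      = fun ξ => iteratedDeriv i q ξ • A + iteratedDeriv i r ξ • B from funext ih]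
    exact (((hd hq).smul_const A).add ((hd hr).smul_const B)).deriv

theorem fullLinearGrowth_separated (hT : 0 < T) (ha : SmoothTX T a) (hb : SmoothTX T b)
    (hq : ContDiff ℝ ∞ q) (hr : ContDiff ℝ ∞ r) {C : ℝ}
    (hqC : ∀ i ∈ Finset.range 3, ∀ ξ, |iteratedDeriv i q ξ| ≤ C * (1 + |ξ|))
    (hrC : ∀ i ∈ Finset.range 3, ∀ ξ, |iteratedDeriv i r ξ| ≤ C * (1 + |ξ|)) :
    FullLinearGrowth T fun t x ξ => a t x * q ξ + b t x * r ξ := by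
  have hC : 0 ≤ C := by
    have := (abs_nonneg _).trans (hqC 0 (by simp) 0)
    simpa using this
  choose Ma hMa hA using fun j => ha.exists_iteratedFDeriv_bound hT j
  choose Mb hMb hB using fun j => hb.exists_iteratedFDeriv_bound hT j
  obtain ⟨Da, hDa, hdA⟩ := (ha.dt hT).exists_bound
  obtain ⟨Db, hDb, hdB⟩ := (hb.dt hT).exists_bound
  refine ⟨C * Da + C * Db + ∑ i ∈ Finset.range 3, ∑ j ∈ Finset.range 3, (C * Ma j + C * Mb j),
    fun t ht x ξ => add_le_add ?_ (Finset.sum_le_sum fun i hi => Finset.sum_le_sum fun j _ => ?_)⟩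
  · rw [div_le_iff₀ (by positivity)]
    have e : derivWithin (fun s => a s x * q ξ + b s x * r ξ) (Icc 0 T) t
        = dt T a t x * q ξ + dt T b t x * r ξ :=
      (((ha.differentiableWithinAt_time ht x).hasDerivWithinAt.mul_const _).add
        ((hb.differentiableWithinAt_time ht x).hasDerivWithinAt.mul_const _)).derivWithin
        (uniqueDiffOn_Icc hT t ht)
    rw [e]
    refine (abs_add_le _ _).trans ?_
    rw [abs_mul, abs_mul, add_mul]
    have h1 := hqC 0 (by simp) ξ
    have h2 := hrC 0 (by simp) ξ
    rw [iteratedDeriv_zero] at h1 h2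
    have h3 := mul_le_mul (hdA t ht x) h1 (abs_nonneg _) hDa
    have h4 := mul_le_mul (hdB t ht x) h2 (abs_nonneg _) hDb
    linarith
  · rw [div_le_iff₀ (by positivity)]
    simp_rw [iteratedFDeriv_separated ha hb ht]
    rw [iteratedDeriv_smul_add_smul hq hr]
    refine (norm_add_le _ _).trans ?_
    rw [norm_smul, norm_smul, Real.norm_eq_abs, Real.norm_eq_abs, add_mul]
    have hx : 0 ≤ C * (1 + |ξ|) := by positivity
    have h3 := mul_le_mul (hqC i hi ξ) (hA j t ht x) (norm_nonneg _) hx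
    have h4 := mul_le_mul (hrC i hi ξ) (hB j t ht x) (norm_nonneg _) hx
    linarith

end Separated

/-! ### The lower bound -/

theorem SmoothTXR.contDiff_profile {n : ℕ} {T : ℝ} {Q : ℝ → EuclideanSpace ℝ (Fin n) → ℝ → ℝ}
    (hQ : SmoothTXR T Q) {t : ℝ} (ht : t ∈ Icc (0 : ℝ) T) (x : EuclideanSpace ℝ (Fin n)) :
    ContDiff ℝ ∞ (Q t x) := by
  have : ContDiff ℝ ∞ fun ξ : ℝ => (t, x, ξ) := contDiff_const.prodMk
    (contDiff_const.prodMk contDiff_id)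
  exact hQ.1.comp_contDiff this fun ξ => ⟨ht, mem_univ _⟩

theorem LinearGrowth.exists_bound {n : ℕ} {T : ℝ} {Q : ℝ → EuclideanSpace ℝ (Fin n) → ℝ → ℝ}
    (hQ : LinearGrowth T Q) : ∃ C, ∀ t ∈ Icc (0 : ℝ) T, ∀ x ξ,
      |deriv (Q t x) ξ| ≤ C * (1 + |ξ|) ∧ |deriv (deriv (Q t x)) ξ| ≤ C * (1 + |ξ|) := by
  obtain ⟨C, hC⟩ := hQ
  refine ⟨C, fun t ht x ξ => ?_⟩
  have h := hC t ht x ξ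
  rw [div_le_iff₀ (by positivity), iteratedDeriv_succ, iteratedDeriv_one] at h
  constructor <;>
    linarith [abs_nonneg (Q t x ξ), abs_nonneg (deriv (Q t x) ξ),
      abs_nonneg (deriv (deriv (Q t x)) ξ)]

/-- The contribution `2 p' Q' + p Q''` of a corrector `Q` of linear growth is square integrable and
orthogonal to `p`, as `p (2 p' Q' + p Q'') = (p² Q')'`. -/
theorem IsProfile.corrector_orthogonal {p q : ℝ → ℝ} {C : ℝ} (hp : IsProfile p)
    (hq : ContDiff ℝ ∞ q) (h1 : ∀ ξ, |deriv q ξ| ≤ C * (1 + |ξ|))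
    (h2 : ∀ ξ, |deriv (deriv q) ξ| ≤ C * (1 + |ξ|)) :
    MemLp (fun ξ => 2 * deriv p ξ * deriv q ξ + p ξ * deriv (deriv q) ξ) 2 volume ∧
      ∫ ξ, (2 * deriv p ξ * deriv q ξ + p ξ * deriv (deriv q) ξ) * p ξ = 0 := by
  obtain ⟨K, hK⟩ := hp.deriv_le
  have hq1 : ContDiff ℝ ∞ (deriv q) := (contDiff_infty_iff_deriv.1 hq).2
  have hq2 : ContDiff ℝ ∞ (deriv (deriv q)) := (contDiff_infty_iff_deriv.1 hq1).2
  have hm : MemLp (fun ξ => 2 * deriv p ξ * deriv q ξ + p ξ * deriv (deriv q) ξ) 2 volume := by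
    refine hp.memLp_of_abs_le_linear (C := 2 * K * C + C)
      (((contDiff_const.mul hp.contDiff_deriv).mul hq1).add (hp.smooth.mul hq2)).continuous
      fun ξ => (abs_add_le _ _).trans ?_
    have e1 := mul_le_mul (hK ξ) (h1 ξ) (abs_nonneg _) ((abs_nonneg _).trans (hK ξ))
    have e2 := mul_le_mul_of_nonneg_left (h2 ξ) (hp.pos ξ).le
    rw [abs_mul, abs_mul, abs_two, abs_mul, abs_of_pos (hp.pos ξ)]
    nlinarith
  have hm' : MemLp (fun ξ => p ξ * deriv q ξ) 2 volume := by
    refine hp.memLp_of_abs_le_linear (C := C) (hp.smooth.mul hq1).continuous fun ξ => ?_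
    rw [abs_mul, abs_of_pos (hp.pos ξ)]
    have e2 := mul_le_mul_of_nonneg_left (h1 ξ) (hp.pos ξ).le
    linarith
  refine ⟨hm, integral_eq_zero_of_hasDerivAt_of_integrable
    (f := fun ξ => p ξ * deriv q ξ * p ξ) (fun ξ => ?_)
    (integrable_mul_of_memLp_two hm hp.memLp) (integrable_mul_of_memLp_two hm' hp.memLp)⟩
  have dp := (hp.smooth.differentiable (by simp) ξ).hasDerivAt
  have dq := (hq1.differentiable (by simp) ξ).hasDerivAt
  refine ((dp.fun_mul dq).fun_mul dp).congr_deriv ?_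
  ring

namespace Coefficients.IsTransitionLayer

variable {c : Coefficients} {ρm ρs ρp : ℝ} {u : ℝ → ℝ} {n : ℕ} {T : ℝ}
  {d : ℝ → EuclideanSpace ℝ (Fin n) → ℝ}

theorem two_mul_nu (c : Coefficients) (u : ℝ → ℝ) :
    2 * c.ν u = ∫ ξ, -(c.L u (deriv (c.vbar u)) ξ) * deriv (c.vbar u) ξ := by
  rw [ν, mul_div_cancel₀ _ two_ne_zero]
  exact integral_congr_ae (Eventually.of_forall fun ξ => mul_comm _ _)

theorem mu_pos (hc : c.Admissible ρm ρs ρp) (hu : c.IsTransitionLayer ρm ρp u) :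
    0 < c.μ ρm ρp u := by
  have h1 := hu.energy_deriv_vbar_pos hc
  have h2 := hu.integral_deriv_u_mul_pos hc
  rw [← two_mul_nu] at h1
  rw [μ, hu.theta₁_eq hc]
  exact div_pos (by linarith) (pow_pos h2 2)

/-- The bound of the theorem in terms of integrals of the layer. -/
theorem bound_eq (hc : c.Admissible ρm ρs ρp) (hu : c.IsTransitionLayer ρm ρp u) (a b : ℝ) :
    (a - c.θ ρm ρp * b) ^ 2 / (2 * c.μ ρm ρp u)
      = ((∫ ξ, deriv u ξ * deriv (c.vbar u) ξ) * a - (∫ ξ, deriv (c.vbar u) ξ ^ 2) * b) ^ 2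
        / ∫ ξ, -(c.L u (deriv (c.vbar u)) ξ) * deriv (c.vbar u) ξ := by
  have h1 := hu.energy_deriv_vbar_pos hc
  have h2 := hu.integral_deriv_u_mul_pos hc
  rw [← two_mul_nu] at h1 ⊢
  have h3 : c.ν u ≠ 0 := by
    intro h
    simp [h] at h1
  rw [θ, μ, hu.theta₁_eq hc, hu.theta₂_eq hc]
  field_simp

theorem F_eq (c : Coefficients) (u : ℝ → ℝ) (T : ℝ) (d : ℝ → EuclideanSpace ℝ (Fin n) → ℝ)
    (Q : ℝ → EuclideanSpace ℝ (Fin n) → ℝ → ℝ) (t : ℝ) (x : EuclideanSpace ℝ (Fin n)) (ξ : ℝ) :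
    c.F u T d Q t x ξ = deriv u ξ * dt T d t x - deriv (c.vbar u) ξ * lap d t x
      - (2 * deriv (deriv (c.vbar u)) ξ * deriv (Q t x) ξ
        + deriv (c.vbar u) ξ * deriv (deriv (Q t x)) ξ) := by
  rw [F, iteratedDeriv_succ, iteratedDeriv_one, iteratedDeriv_succ, iteratedDeriv_one]
  ring

/-- `F_Q` is square integrable, and its component along `v̄'` does not depend on `Q`. -/
theorem memLp_F_and_integral (hc : c.Admissible ρm ρs ρp) (hu : c.IsTransitionLayer ρm ρp u)
    {Q : ℝ → EuclideanSpace ℝ (Fin n) → ℝ → ℝ} (hQ : SmoothTXR T Q) (hg : LinearGrowth T Q)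
    {t : ℝ} (ht : t ∈ Icc (0 : ℝ) T) (x : EuclideanSpace ℝ (Fin n)) :
    MemLp (c.F u T d Q t x) 2 volume ∧
      ∫ ξ, c.F u T d Q t x ξ * deriv (c.vbar u) ξ
        = (∫ ξ, deriv u ξ * deriv (c.vbar u) ξ) * dt T d t x
          - (∫ ξ, deriv (c.vbar u) ξ ^ 2) * lap d t x := by
  obtain ⟨C, hC⟩ := hg.exists_bound
  have hp := hu.isProfile hc
  obtain ⟨m, e⟩ := hp.corrector_orthogonal (hQ.contDiff_profile ht x)
    (fun ξ => (hC t ht x ξ).1) (fun ξ => (hC t ht x ξ).2)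
  have m1 := hu.memLp_deriv_u hc
  have hF := funext (F_eq c u T d Q t x)
  refine ⟨?_, ?_⟩
  · rw [hF]
    exact ((m1.mul_const _).sub (hp.memLp.mul_const _)).sub m
  · have i1 := (integrable_mul_of_memLp_two m1 hp.memLp).mul_const (dt T d t x)
    have i2 := hp.memLp.integrable_sq.mul_const (lap d t x)
    have i3 := integrable_mul_of_memLp_two m hp.memLp
    rw [← integral_mul_const, ← integral_mul_const, ← integral_sub i1 i2]
    have := integral_sub (i1.sub i2) i3
    rw [e, sub_zero] at this
    simp only [Pi.sub_apply] at this
    rw [← this, hF]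
    refine integral_congr_ae (Eventually.of_forall fun ξ => ?_)
    simp only; ring

/-! ### The minimizing corrector -/

/-- `Q̄_min` splits as `∂_t d(t,x) q₁(ξ) - Δd(t,x) q₂(ξ)`, where `q₁` and `q₂` are correctors for
the components of `ū'` and `v̄'` that remain after subtracting multiples of `-L_ū v̄'`. -/
theorem exists_Qmin_eq (hc : c.Admissible ρm ρs ρp) (hu : c.IsTransitionLayer ρm ρp u) :
    ∃ q₁ r₁ q₂ r₂ : ℝ → ℝ, ∃ C : ℝ, ContDiff ℝ ∞ q₁ ∧ ContDiff ℝ ∞ q₂ ∧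
      ContDiff ℝ ∞ r₁ ∧ ContDiff ℝ ∞ r₂ ∧
      (∀ ξ, HasDerivAt q₁ (r₁ ξ) ξ) ∧ (∀ ξ, HasDerivAt q₂ (r₂ ξ) ξ) ∧
      (∀ ξ, |q₁ ξ| ≤ C * |ξ| ∧ |r₁ ξ| ≤ C ∧ |deriv r₁ ξ| ≤ C) ∧
      (∀ ξ, |q₂ ξ| ≤ C * |ξ| ∧ |r₂ ξ| ≤ C ∧ |deriv r₂ ξ| ≤ C) ∧
      ∀ (n : ℕ) (T : ℝ) (d : ℝ → EuclideanSpace ℝ (Fin n) → ℝ) (t : ℝ)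
        (x : EuclideanSpace ℝ (Fin n)),
        Integrable (c.innerIntegrand u T d t x) ∧
        (∀ ξ, c.outerIntegrand u T d t x ξ = dt T d t x * r₁ ξ + -1 * lap d t x * r₂ ξ) ∧
        (∀ ξ, c.Qmin u T d t x ξ = dt T d t x * q₁ ξ + -1 * lap d t x * q₂ ξ) ∧
        ∀ ξ, deriv u ξ * dt T d t x - deriv (c.vbar u) ξ * lap d t x
          - (2 * deriv (deriv (c.vbar u)) ξ * (dt T d t x * r₁ ξ + -1 * lap d t x * r₂ ξ)
            + deriv (c.vbar u) ξ * (dt T d t x * deriv r₁ ξ + -1 * lap d t x * deriv r₂ ξ))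
          = c.lam u T d t x / 2 * c.L u (deriv (c.vbar u)) ξ := by
  have hp := hu.isProfile hc
  have hN := hu.energy_deriv_vbar_pos hc
  have iS := integrable_mul_of_memLp_two (hu.memLp_deriv_u hc) hp.memLp
  have iA := hp.memLp.integrable_sq
  have iN := integrable_mul_of_memLp_two (hu.memLp_L hc) hp.memLp
  obtain ⟨CL, hCL⟩ := hu.exists_abs_L_le hc
  obtain ⟨Cu, -, hCu⟩ := hu.exists_deriv_u_le hc
  set p := deriv (c.vbar u) with hpdef
  set N := ∫ ξ, -(c.L u p ξ) * p ξ with hNdef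
  set S := ∫ ξ, deriv u ξ * p ξ with hS
  set A := ∫ ξ, p ξ ^ 2 with hA
  have hNL : ∫ ξ, c.L u p ξ * p ξ = -N := by
    rw [hNdef, ← integral_neg]
    refine integral_congr_ae (Eventually.of_forall fun ξ => ?_)
    simp only; ring
  set f₁ : ℝ → ℝ := fun ξ => deriv u ξ + S / N * c.L u p ξ with hf₁
  set f₂ : ℝ → ℝ := fun ξ => p ξ + A / N * c.L u p ξ with hf₂
  have s₁ : ContDiff ℝ ∞ f₁ := hu.smooth_deriv_u.add (contDiff_const.mul (hu.smooth_L hc))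
  have s₂ : ContDiff ℝ ∞ f₂ := hp.smooth.add (contDiff_const.mul (hu.smooth_L hc))
  have b₁ : ∀ ξ, |f₁ ξ| ≤ (Cu + |S / N| * CL) * p ξ := fun ξ => by
    refine (abs_add_le _ _).trans ?_
    rw [abs_mul, add_mul, mul_assoc]
    exact add_le_add (hCu ξ) (mul_le_mul_of_nonneg_left (hCL ξ) (abs_nonneg _))
  have b₂ : ∀ ξ, |f₂ ξ| ≤ (1 + |A / N| * CL) * p ξ := fun ξ => by
    refine (abs_add_le _ _).trans ?_
    rw [abs_mul, add_mul, mul_assoc, one_mul, abs_of_pos (hp.pos ξ)]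
    gcongr
    exact hCL ξ
  have e₁ : ∀ ξ, f₁ ξ * p ξ = deriv u ξ * p ξ + S / N * (c.L u p ξ * p ξ) := fun ξ => by
    simp only [hf₁]; ring
  have e₂ : ∀ ξ, f₂ ξ * p ξ = p ξ ^ 2 + A / N * (c.L u p ξ * p ξ) := fun ξ => by
    simp only [hf₂]; ring
  have i₁ : Integrable fun ξ => f₁ ξ * p ξ := by
    simp_rw [e₁]; exact iS.add (iN.const_mul _)
  have i₂ : Integrable fun ξ => f₂ ξ * p ξ := by
    simp_rw [e₂]; exact iA.add (iN.const_mul _)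
  have z₁ : ∫ ξ, f₁ ξ * p ξ = 0 := by
    simp_rw [e₁]
    rw [integral_add iS (iN.const_mul _), integral_const_mul, hNL, ← hS]
    field_simp; ring
  have z₂ : ∫ ξ, f₂ ξ * p ξ = 0 := by
    simp_rw [e₂]
    rw [integral_add iA (iN.const_mul _), integral_const_mul, hNL, ← hA]
    field_simp; ring
  obtain ⟨q₁, r₁, C₁, hr₁, hq₁, sr₁, sq₁, d₁, eq₁, bq₁, br₁, bd₁⟩ := hp.exists_corrector s₁ b₁ z₁
  obtain ⟨q₂, r₂, C₂, hr₂, hq₂, sr₂, sq₂, d₂, eq₂, bq₂, br₂, bd₂⟩ := hp.exists_corrector s₂ b₂ z₂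
  have l1 := le_max_left C₁ C₂
  have l2 := le_max_right C₁ C₂
  refine ⟨q₁, r₁, q₂, r₂, max C₁ C₂, sq₁, sq₂, sr₁, sr₂, d₁, d₂,
    fun ξ => ⟨(bq₁ ξ).trans (mul_le_mul_of_nonneg_right l1 (abs_nonneg _)), (br₁ ξ).trans l1,
      (bd₁ ξ).trans l1⟩,
    fun ξ => ⟨(bq₂ ξ).trans (mul_le_mul_of_nonneg_right l2 (abs_nonneg _)), (br₂ ξ).trans l2,
      (bd₂ ξ).trans l2⟩, fun n T d t x => ?_⟩
  have hlam : c.lam u T d t x / 2 = (A * lap d t x - S * dt T d t x) / N := by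
    simp only [lam, ← hpdef, ← hNdef, ← hS, ← hA]
    ring
  have hinner : ∀ η, c.innerIntegrand u T d t x η
      = dt T d t x * (f₁ η * p η) + -1 * lap d t x * (f₂ η * p η) := fun η => by
    rw [innerIntegrand, hlam]
    simp only [hf₁, hf₂, ← hpdef]
    field_simp
    ring
  have houter : ∀ ξ, c.outerIntegrand u T d t x ξ
      = dt T d t x * r₁ ξ + -1 * lap d t x * r₂ ξ := fun ξ => by
    rw [outerIntegrand, funext hinner, integral_add (i₁.integrableOn.const_mul _)
      (i₂.integrableOn.const_mul _), integral_const_mul, integral_const_mul, hr₁, hr₂]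
    ring
  refine ⟨?_, houter, fun ξ => ?_, fun ξ => ?_⟩
  · rw [funext hinner]
    exact (i₁.const_mul _).add (i₂.const_mul _)
  · rw [Qmin, funext houter, hq₁, hq₂, ← intervalIntegral.integral_const_mul,
      ← intervalIntegral.integral_const_mul]
    exact intervalIntegral.integral_add
      ((continuous_const.mul sr₁.continuous).intervalIntegrable _ _)
      ((continuous_const.mul sr₂.continuous).intervalIntegrable _ _)
  · have h₁ := eq₁ ξ
    have h₂ := eq₂ ξ
    simp only [hf₁, hf₂] at h₁ h₂
    rw [hlam]
    linear_combination (-dt T d t x) * h₁ + lap d t x * h₂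

end Coefficients.IsTransitionLayer

/-- Derivatives in `ξ` of `a(t,x) q₁(ξ) + b(t,x) q₂(ξ)`, and their bounds when the first and
second derivatives of `q₁` and `q₂` are bounded. -/
theorem exists_separated_bounds {n : ℕ} {T C : ℝ} {a b : ℝ → EuclideanSpace ℝ (Fin n) → ℝ}
    {q₁ r₁ q₂ r₂ : ℝ → ℝ} (ha : SmoothTX T a) (hb : SmoothTX T b)
    (s₁ : ContDiff ℝ ∞ r₁) (s₂ : ContDiff ℝ ∞ r₂)
    (d₁ : ∀ ξ, HasDerivAt q₁ (r₁ ξ) ξ) (d₂ : ∀ ξ, HasDerivAt q₂ (r₂ ξ) ξ)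
    (h₁ : ∀ ξ, |q₁ ξ| ≤ C * |ξ| ∧ |r₁ ξ| ≤ C ∧ |deriv r₁ ξ| ≤ C)
    (h₂ : ∀ ξ, |q₂ ξ| ≤ C * |ξ| ∧ |r₂ ξ| ≤ C ∧ |deriv r₂ ξ| ≤ C) :
    (∀ t x, deriv (fun ξ => a t x * q₁ ξ + b t x * q₂ ξ)
      = fun ξ => a t x * r₁ ξ + b t x * r₂ ξ) ∧
    (∀ t x ξ, deriv (fun ξ => a t x * r₁ ξ + b t x * r₂ ξ) ξ
      = a t x * deriv r₁ ξ + b t x * deriv r₂ ξ) ∧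
    (∀ t x ξ, iteratedDeriv 2 (fun ξ => a t x * q₁ ξ + b t x * q₂ ξ) ξ
      = a t x * deriv r₁ ξ + b t x * deriv r₂ ξ) ∧
    ∃ M, 0 ≤ M ∧ ∀ t ∈ Icc (0 : ℝ) T, ∀ x ξ, |a t x * q₁ ξ + b t x * q₂ ξ| ≤ M * |ξ| ∧
      |a t x * r₁ ξ + b t x * r₂ ξ| ≤ M ∧ |a t x * deriv r₁ ξ + b t x * deriv r₂ ξ| ≤ M := by
  have e1 : ∀ t x, deriv (fun ξ => a t x * q₁ ξ + b t x * q₂ ξ)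
      = fun ξ => a t x * r₁ ξ + b t x * r₂ ξ := fun t x => funext fun ξ =>
    (((d₁ ξ).const_mul _).add ((d₂ ξ).const_mul _)).deriv
  have e2 : ∀ t x ξ, deriv (fun ξ => a t x * r₁ ξ + b t x * r₂ ξ) ξ
      = a t x * deriv r₁ ξ + b t x * deriv r₂ ξ := fun t x ξ =>
    (((s₁.differentiable (by simp) ξ).hasDerivAt.const_mul _).add
      ((s₂.differentiable (by simp) ξ).hasDerivAt.const_mul _)).deriv
  refine ⟨e1, e2, fun t x ξ => by rw [iteratedDeriv_succ, iteratedDeriv_one, e1, e2], ?_⟩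
  obtain ⟨Ma, hMa, hA⟩ := ha.exists_bound
  obtain ⟨Mb, hMb, hB⟩ := hb.exists_bound
  have hC : 0 ≤ C := (abs_nonneg _).trans (h₁ 0).2.1
  have key : ∀ t ∈ Icc (0 : ℝ) T, ∀ x, ∀ {y z R : ℝ}, |y| ≤ R → |z| ≤ R →
      |a t x * y + b t x * z| ≤ Ma * R + Mb * R := fun t ht x y z R hy hz => by
    refine (abs_add_le _ _).trans ?_
    rw [abs_mul, abs_mul]
    exact add_le_add (mul_le_mul (hA t ht x) hy (abs_nonneg _) hMa)
      (mul_le_mul (hB t ht x) hz (abs_nonneg _) hMb)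
  refine ⟨Ma * C + Mb * C, by positivity, fun t ht x ξ => ⟨?_, key t ht x (h₁ ξ).2.1 (h₂ ξ).2.1,
    key t ht x (h₁ ξ).2.2 (h₂ ξ).2.2⟩⟩
  refine (key t ht x (h₁ ξ).1 (h₂ ξ).1).trans_eq ?_
  ring

end SharpInterface

theorem proposition3p2
    (c : SharpInterface.Coefficients) (ρm ρs ρp : ℝ) (hc : c.Admissible ρm ρs ρp)
    (u : ℝ → ℝ) (hu : c.IsTransitionLayer ρm ρp u)
    (n : ℕ) (T : ℝ) (hT : 0 < T)
    (d : ℝ → EuclideanSpace ℝ (Fin n) → ℝ) (hd : SharpInterface.SmoothTX T d) :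
    -- the quantities in the statement are well defined
    ((∀ ξ, 0 < deriv (c.vbar u) ξ) ∧
      Integrable (fun ξ => deriv u ξ * deriv (c.vbar u) ξ) ∧
      Integrable (fun ξ => deriv (c.vbar u) ξ ^ 2) ∧
      Integrable (fun ξ => deriv (c.vbar u) ξ * c.L u (deriv (c.vbar u)) ξ) ∧
      0 < c.θ₁ ρm ρp ∧ 0 < c.μ ρm ρp u ∧
      -- `-L_ū` is invertible, and acts on `v̄'` by the differential expression
      (∀ w : ℝ → ℝ, MemLp w 2 volume →
        ∃ ψ, c.NegLEq u ψ w ∧ ∀ ψ', c.NegLEq u ψ' w → ψ' =ᵐ[volume] ψ) ∧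
      c.NegLEq u (deriv (c.vbar u)) (fun ξ => -(c.L u (deriv (c.vbar u)) ξ))) ∧
    -- the lower bound for every corrector of linear growth
    (∀ Q : ℝ → EuclideanSpace ℝ (Fin n) → ℝ → ℝ,
      SharpInterface.SmoothTXR T Q → SharpInterface.LinearGrowth T Q →
      ∀ t ∈ Icc (0 : ℝ) T, ∀ x : EuclideanSpace ℝ (Fin n),
        MemLp (c.F u T d Q t x) 2 volume ∧
        Integrable (fun ξ => c.F u T d Q t x ξ * c.negLInv u (c.F u T d Q t x) ξ) ∧
        (SharpInterface.dt T d t x - c.θ ρm ρp * SharpInterface.lap d t x) ^ 2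
            / (2 * c.μ ρm ρp u)
          ≤ c.quadForm u (c.F u T d Q t x)) ∧
    -- the explicit minimizer
    (SharpInterface.SmoothTX T (c.lam u T d) ∧
      (∀ t ∈ Icc (0 : ℝ) T, ∀ (x : EuclideanSpace ℝ (Fin n)) (ξ : ℝ),
        IntegrableOn (c.innerIntegrand u T d t x) (Iic ξ) ∧
        IntervalIntegrable (c.outerIntegrand u T d t x) volume 0 ξ) ∧
      SharpInterface.SmoothTXR T (c.Qmin u T d) ∧
      SharpInterface.LinearGrowth T (c.Qmin u T d) ∧
      (∀ t ∈ Icc (0 : ℝ) T, ∀ x : EuclideanSpace ℝ (Fin n),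
        c.quadForm u (c.F u T d (c.Qmin u T d) t x)
          = (SharpInterface.dt T d t x - c.θ ρm ρp * SharpInterface.lap d t x) ^ 2
              / (2 * c.μ ρm ρp u)) ∧
      SharpInterface.FullLinearGrowth T (c.Qmin u T d) ∧
      (∃ C : ℝ, ∀ t ∈ Icc (0 : ℝ) T, ∀ (x : EuclideanSpace ℝ (Fin n)) (ξ : ℝ),
        |iteratedDeriv 2 (c.Qmin u T d t x) ξ| ^ 2 / (1 + |ξ|) ≤ C)) := by
  have hp := hu.isProfile hc
  have hlap := hd.lap hT
  have hdt := hd.dt hT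
  obtain ⟨q₁, r₁, q₂, r₂, C, sq₁, sq₂, sr₁, sr₂, d₁, d₂, h₁, h₂, hQ⟩ := hu.exists_Qmin_eq hc
  have hb := hlap.const_mul (-1)
  have hQeq : c.Qmin u T d = fun t x ξ => SharpInterface.dt T d t x * q₁ ξ
      + -1 * SharpInterface.lap d t x * q₂ ξ :=
    funext fun t => funext fun x => funext fun ξ => (hQ n T d t x).2.2.1 ξ
  obtain ⟨e1, e2, e3, M, hM, hbd⟩ :=
    SharpInterface.exists_separated_bounds hdt hb sr₁ sr₂ d₁ d₂ h₁ h₂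
  have hC : 0 ≤ C := (abs_nonneg _).trans (h₁ 0).2.1
  have hit : ∀ {q r : ℝ → ℝ}, (∀ ξ, HasDerivAt q (r ξ) ξ) →
      (∀ ξ, |q ξ| ≤ C * |ξ| ∧ |r ξ| ≤ C ∧ |deriv r ξ| ≤ C) →
      ∀ i ∈ Finset.range 3, ∀ ξ, |iteratedDeriv i q ξ| ≤ C * (1 + |ξ|) := by
    intro q r hqr h i hi ξ
    have hq : deriv q = r := funext fun ξ => (hqr ξ).deriv
    have hx := mul_nonneg hC (abs_nonneg ξ)
    obtain ⟨b0, b1, b2⟩ := h ξ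
    rw [Finset.mem_range] at hi
    interval_cases i
    · rw [iteratedDeriv_zero]; linarith
    · rw [iteratedDeriv_one, hq]; linarith
    · rw [iteratedDeriv_succ, iteratedDeriv_one, hq]; linarith
  refine ⟨⟨hu.deriv_vbar_pos hc,
    SharpInterface.integrable_mul_of_memLp_two (hu.memLp_deriv_u hc) hp.memLp,
    hp.memLp.integrable_sq,
    SharpInterface.integrable_mul_of_memLp_two hp.memLp (hu.memLp_L hc),
    by rw [hu.theta₁_eq hc]; exact hu.integral_deriv_u_mul_pos hc, hu.mu_pos hc,
    fun w hw => hu.exists_unique_negLEq hc hw, hu.negLEq_deriv_vbar hc⟩,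
    fun Q hQs hQg t ht x => ?_, ?_, fun t ht x ξ => ⟨(hQ n T d t x).1.integrableOn, ?_⟩,
    ?_, ?_, fun t ht x => ?_, ?_, M ^ 2, fun t ht x ξ => ?_⟩
  · obtain ⟨m, e⟩ := hu.memLp_F_and_integral hc (d := d) hQs hQg ht x
    refine ⟨m, hu.integrable_mul_negLInv hc m, ?_⟩
    rw [hu.bound_eq hc, ← e]
    exact hu.sq_div_energy_le_quadForm hc m
  · have e : c.lam u T d = fun t x =>
        2 * (∫ ξ, deriv (c.vbar u) ξ ^ 2)
          / (∫ ξ, -(c.L u (deriv (c.vbar u)) ξ) * deriv (c.vbar u) ξ) * SharpInterface.lap d t x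
        + -2 * (∫ ξ, deriv u ξ * deriv (c.vbar u) ξ)
          / (∫ ξ, -(c.L u (deriv (c.vbar u)) ξ) * deriv (c.vbar u) ξ)
          * SharpInterface.dt T d t x := by
      funext t x
      rw [SharpInterface.Coefficients.lam]
      ring
    rw [e]
    exact (hlap.const_mul _).add (hdt.const_mul _)
  · rw [funext (hQ n T d t x).2.1]
    exact ((continuous_const.mul sr₁.continuous).add
      (continuous_const.mul sr₂.continuous)).intervalIntegrable _ _
  · rw [hQeq]
    exact SharpInterface.smoothTXR_separated hdt hb sq₁ sq₂
  · rw [hQeq]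
    refine ⟨2 * M, fun t ht x ξ => ?_⟩
    obtain ⟨b0, b1, b2⟩ := hbd t ht x ξ
    rw [div_le_iff₀ (by positivity)]
    simp only [e3, e1]
    have := mul_nonneg hM (abs_nonneg ξ)
    linarith
  · have hF : c.F u T d (c.Qmin u T d) t x
        = fun ξ => c.lam u T d t x / 2 * c.L u (deriv (c.vbar u)) ξ := by
      funext ξ
      rw [SharpInterface.Coefficients.IsTransitionLayer.F_eq, ← (hQ n T d t x).2.2.2 ξ, hQeq]
      simp only [e1, e2]
    have hN := (hu.energy_deriv_vbar_pos hc).ne'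
    rw [hF, hu.quadForm_smul_L hc, hu.bound_eq hc, SharpInterface.Coefficients.lam]
    field_simp
    ring
  · rw [hQeq]
    exact SharpInterface.fullLinearGrowth_separated hT hdt hb sq₁ sq₂ (hit d₁ h₁) (hit d₂ h₂)
  · rw [hQeq]
    simp only [e3]
    rw [div_le_iff₀ (by positivity)]
    have h3 := pow_le_pow_left₀ (abs_nonneg _) (hbd t ht x ξ).2.2 2
    nlinarith [mul_nonneg (sq_nonneg M) (abs_nonneg ξ)]
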